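/- Consider, for unknown functions $\gamma=(\gamma^1,\gamma^2,\gamma^3)$ and $P$ of $(t,\xi^1,\xi^2,\xi^3)$, the system (incompressible ideal MHD in natural coordinates, density normalized to $1$) $$\gamma_{tt}-\gamma_{\xi^1\xi^1}+P_{\xi^1}(\gamma_{\xi^2}\times\gamma_{\xi^3})+P_{\xi^2}(\gamma_{\xi^3}\times\gamma_{\xi^1})+P_{\xi^3}(\gamma_{\xi^1}\times\gamma_{\xi^2})=0,\qquad [\gamma_{\xi^1},\gamma_{\xi^2},\gamma_{\xi^3}]=1,$$ where $[\cdot,\cdot,\cdot]$ is the mixed product. Let $Z=\mathbb R^8$ be the space of $(t,\xi,\gamma,P)$. A smooth vector field $X$ on an open set $U\subset Z$ is an *infinitesimal symmetry* if its second prolongation annihilates the equations at all second-order jets over $U$ that satisfy the system and the first derivatives of its second equation. The *Lie point symmetry group* $G$ is the group of transformations of $Z$ generated by all $\Phi_s$, where $(\Phi_s)_{s\in\mathbb R}$ is a smooth isotopy of diffeomorphisms of $Z$ with $\Phi_0=\mathrm{id}$ whose velocity field at each $s$ is an infinitesimal symmetry on $Z$. Let $N$ be the reparametrization group, consisting of the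 transformations $$\bar\xi^1=\xi^1+a(\xi^2,\xi^3),\quad \bar\xi^2=\bar\xi^2(\xi^2,\xi^3),\quad \bar\xi^3=\bar\xi^3(\xi^2,\xi^3),\quad \frac{\partial(\bar\xi^2,\bar\xi^3)}{\partial(\xi^2,\xi^3)}=1$$ ($t,\gamma,P$ fixed), with $a$ an arbitrary smooth function and $(\bar\xi^2,\bar\xi^3)$ an arbitrary diffeomorphism of $\mathbb R^2$ of unit Jacobian. Let $H$ be the generalized Galilean group, generated by the one-parameter groups of the operators $$T=\partial_t,\quad R_i=\varepsilon_{ijk}\gamma^j\partial_{\gamma^k},\quad S_1=t\partial_t+\xi^j\partial_{\xi^j}+\gamma^j\partial_{\gamma^j},\quad S_2=3\xi^2\partial_{\xi^2}+3\xi^3\partial_{\xi^3}+2\gamma^j\partial_{\gamma^j}+4P\partial_P,$$ $$G_i(\alpha^i(t))=\alpha^i(t)\partial_{\gamma^i}-\gamma^i\ddot\alpha^i(t)\partial_P,\quad K=\beta(t)\partial_P\qquad(i=1,2,3),$$ where summation is over $j,k=1,2,3$ only, $\varepsilon_{ijk}$ is the Levi-Civita symbol, and $\alpha^i,\beta$ are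 arbitrary smooth functions of $t$. **Theorem 1.** The Lie point symmetry group $G$ is the semidirect product of $N$ and $H$: $N$ and $H$ are subgroups of $G$, $N$ is normal, and every element of $G$ is uniquely a product of an element of $N$ and an element of $H$. Every element of $G$ carries (graphs of) local smooth solutions to local smooth solutions. Moreover, on every convex open $U\subset Z$ the infinitesimal symmetries are exactly the sums of an infinitesimal reparametrization $a\,\partial_{\xi^1}+b\,\partial_{\xi^2}+c\,\partial_{\xi^3}$, with $a,b,c$ smooth functions of $(\xi^2,\xi^3)$ and $b_{\xi^2}+c_{\xi^3}=0$, and a linear combination of $T,R_i,S_1,S_2,G_i(\alpha^i),K$ with smooth $\alpha^i,\beta$. The decomposition is unique, the first summands form an ideal in the infinitesimal symmetries, and the second form a subalgebra. -/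

import Mathlib

open scoped ContDiff Matrix

namespace NaturalMHD

/-- Independent variables `x = (t, ξ¹, ξ², ξ³)`: index `0` is the time. -/
abbrev Indep := Fin 4 → ℝ

/-- Dependent variables `u = (P, γ¹, γ², γ³)`: index `0` is the total pressure. -/
abbrev Dep := Fin 4 → ℝ

/-- The space of independent and dependent variables, on which point transformations act. -/
abbrev Z := Indep × Dep

/-- First-order derivative coordinates: `p a μ` stands for `∂u^a/∂x^μ`. -/
abbrev D1 := Fin 4 → Fin 4 → ℝ

/-- Second-order derivative coordinates: `q a μ ν` stands for `∂²u^a/∂x^μ∂x^ν`. -/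
abbrev D2 := Fin 4 → Fin 4 → Fin 4 → ℝ

/-- First-order jets `(z, p)`. -/
abbrev Jet1 := Z × D1

/-- Second-order jets `((z, p), q)`. -/
abbrev Jet2 := Jet1 × D2

/-! ### The system -/

/-- The vector `∂γ/∂x^μ` read off from the first derivatives. -/
def gradγ (p : D1) (μ : Fin 4) : Fin 3 → ℝ := fun k => p k.succ μ

/-- The mixed product `[∂γ/∂ξ¹, ∂γ/∂ξ², ∂γ/∂ξ³]`. -/
def mixedProduct (p : D1) : ℝ := gradγ p 1 ⬝ᵥ (gradγ p 2 ⨯₃ gradγ p 3)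

/-- Left-hand side of the momentum equation. -/
def momentum (p : D1) (q : D2) : Fin 3 → ℝ :=
  (fun k => q k.succ 0 0) - (fun k => q k.succ 1 1)
    + p 0 1 • (gradγ p 2 ⨯₃ gradγ p 3)
    + p 0 2 • (gradγ p 3 ⨯₃ gradγ p 1)
    + p 0 3 • (gradγ p 1 ⨯₃ gradγ p 2)

/-- The system in the form `system j = 0`. -/
def system (j : Jet2) : (Fin 3 → ℝ) × ℝ :=
  (momentum j.1.2 j.2, mixedProduct j.1.2 - 1)

/-- The first derivatives of `u` at `x`. -/
noncomputable def der1 (u : Indep → Dep) (x : Indep) : D1 :=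
  fun a μ => fderiv ℝ u x (Pi.single μ 1) a

/-- The 2-jet of `u` at `x`. -/
noncomputable def jet2 (u : Indep → Dep) (x : Indep) : Jet2 :=
  (((x, u x), der1 u x),
    fun a μ ν => fderiv ℝ (fun y => der1 u y a μ) x (Pi.single ν 1))

/-- `u = (P, γ)` is a smooth solution of the system on the open set `Ω`. -/
def IsSolutionOn (Ω : Set Indep) (u : Indep → Dep) : Prop :=
  ContDiffOn ℝ ∞ u Ω ∧ ∀ x ∈ Ω, system (jet2 u x) = 0

/-- The point transformation `Φ` carries the graph of every local solution of the system onto the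
graph of a local solution. -/
def MapsSolutionsToSolutions (Φ : Equiv.Perm Z) : Prop :=
  ∀ (Ω : Set Indep) (u : Indep → Dep), IsOpen Ω → IsSolutionOn Ω u →
    ∃ (Ω' : Set Indep) (v : Indep → Dep), IsOpen Ω' ∧ IsSolutionOn Ω' v ∧
      Φ '' Set.graphOn u Ω = Set.graphOn v Ω'

/-! ### Prolongation and infinitesimal symmetries -/

/-- The part of the total derivative with respect to `x^μ` that acts on the variables `z = (x, u)`,
as a tangent vector: `∂/∂x^μ + ∑ₐ p^a_μ ∂/∂u^a`. -/
def totalVec (p : D1) (μ : Fin 4) : Z := (Pi.single μ 1, fun a => p a μ)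

/-- The total derivative `D_μ f` of a function of `z = (x, u)`. -/
noncomputable def totalDeriv0 (f : Z → ℝ) (μ : Fin 4) (j : Jet1) : ℝ :=
  fderiv ℝ f j.1 (totalVec j.2 μ)

/-- The total derivative `D_μ f` of a function of first-order jets. -/
noncomputable def totalDeriv1 (f : Jet1 → ℝ) (μ : Fin 4) (j : Jet2) : ℝ :=
  fderiv ℝ f j.1 (totalVec j.1.2 μ, fun a ν => j.2 a ν μ)

/-- First prolongation of `X = ∑ ξ^μ ∂_{x^μ} + ∑ φ^a ∂_{u^a}`:
`φ^a_μ = D_μ φ^a - ∑_ν p^a_ν D_μ ξ^ν`. -/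
noncomputable def prolong1 (X : Z → Z) (a μ : Fin 4) (j : Jet1) : ℝ :=
  totalDeriv0 (fun z => (X z).2 a) μ j
    - ∑ ν, j.2 a ν * totalDeriv0 (fun z => (X z).1 ν) μ j

/-- Second prolongation: `φ^a_{μν} = D_ν φ^a_μ - ∑_κ q^a_{μκ} D_ν ξ^κ`. -/
noncomputable def prolong2 (X : Z → Z) (a μ ν : Fin 4) (j : Jet2) : ℝ :=
  totalDeriv1 (prolong1 X a μ) ν j
    - ∑ κ, j.2 a μ κ * totalDeriv0 (fun z => (X z).1 κ) ν j.1

/-- The prolongation of `X` as a vector field on the second-order jet space. -/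
noncomputable def prolong (X : Z → Z) (j : Jet2) : Jet2 :=
  ((X j.1.1, fun a μ => prolong1 X a μ j.1), fun a μ ν => prolong2 X a μ ν j)

/-- The submanifold of the second-order jet space defined by the system, together with the first
derivatives of its first-order equation; the second derivatives are symmetric. -/
def equationManifold : Set Jet2 :=
  {j | (∀ a μ ν, j.2 a μ ν = j.2 a ν μ) ∧ system j = 0 ∧
    ∀ μ, totalDeriv1 (fun i => mixedProduct i.2) μ j = 0}

/-- `X` is (the generator of) a Lie point symmetry of the system on the open set `U`: a smooth
vector field whose prolongation annihilates the equations along the equation manifold. -/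
def IsInfinitesimalSymmetryOn (U : Set Z) (X : Z → Z) : Prop :=
  ContDiffOn ℝ ∞ X U ∧
    ∀ j ∈ equationManifold, j.1.1 ∈ U → fderiv ℝ system j (prolong X j) = 0

/-! ### The Lie point symmetry group -/

/-- A smooth isotopy of diffeomorphisms that starts at the identity and whose velocity field is an
infinitesimal symmetry at every instant. -/
def IsSymmetryIsotopy (Φ : ℝ → Equiv.Perm Z) : Prop :=
  ContDiff ℝ ∞ (fun y : ℝ × Z => Φ y.1 y.2) ∧
  ContDiff ℝ ∞ (fun y : ℝ × Z => (Φ y.1).symm y.2) ∧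
  Φ 0 = 1 ∧
  ∃ X : ℝ → Z → Z, (∀ s, IsInfinitesimalSymmetryOn Set.univ (X s)) ∧
    ∀ s z, HasDerivAt (fun r => Φ r z) (X s (Φ s z)) s

/-- The Lie point symmetry group: the group of point transformations generated by the
infinitesimal symmetries of the system. -/
def symmetryGroup : Subgroup (Equiv.Perm Z) :=
  Subgroup.closure {Ψ | ∃ Φ : ℝ → Equiv.Perm Z, IsSymmetryIsotopy Φ ∧ ∃ s, Φ s = Ψ}

/-! ### Reparametrizations -/

/-- `σ` is a smooth diffeomorphism of the `(ξ², ξ³)`-plane with unit Jacobian. -/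
def IsUnimodular (σ : Equiv.Perm (ℝ × ℝ)) : Prop :=
  ContDiff ℝ ∞ σ ∧ ContDiff ℝ ∞ σ.symm ∧ ∀ y, (fderiv ℝ σ y).det = 1

/-- `ξ¹ ↦ ξ¹ + a(ξ², ξ³)`, `(ξ², ξ³) ↦ σ(ξ², ξ³)`, all other variables fixed. -/
def reparamMap (a : ℝ × ℝ → ℝ) (σ : ℝ × ℝ → ℝ × ℝ) (z : Z) : Z :=
  (![z.1 0, z.1 1 + a (z.1 2, z.1 3), (σ (z.1 2, z.1 3)).1, (σ (z.1 2, z.1 3)).2], z.2)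

theorem reparamMap_comp (a b : ℝ × ℝ → ℝ) (σ τ : ℝ × ℝ → ℝ × ℝ) (z : Z) :
    reparamMap a σ (reparamMap b τ z) = reparamMap (fun y => b y + a (τ y)) (σ ∘ τ) z := by
  simp [reparamMap, add_assoc]

theorem reparamMap_id (z : Z) : reparamMap (fun _ => 0) id z = z := by
  refine Prod.ext ?_ rfl
  funext i
  fin_cases i <;> simp [reparamMap]

theorem IsUnimodular.one : IsUnimodular 1 := by
  refine ⟨contDiff_id, contDiff_id, fun y => ?_⟩
  have h : fderiv ℝ ((1 : Equiv.Perm (ℝ × ℝ)) : ℝ × ℝ → ℝ × ℝ) y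
      = ContinuousLinearMap.id ℝ (ℝ × ℝ) := fderiv_id
  rw [h]
  simp [ContinuousLinearMap.det]

theorem IsUnimodular.mul {σ τ : Equiv.Perm (ℝ × ℝ)} (hσ : IsUnimodular σ)
    (hτ : IsUnimodular τ) : IsUnimodular (σ * τ) := by
  refine ⟨hσ.1.comp hτ.1, hτ.2.1.comp hσ.2.1, fun y => ?_⟩
  have h : fderiv ℝ ((σ * τ : Equiv.Perm (ℝ × ℝ)) : ℝ × ℝ → ℝ × ℝ) y
      = (fderiv ℝ σ (τ y)).comp (fderiv ℝ τ y) :=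
    fderiv_comp y (hσ.1.differentiable (by simp) _) (hτ.1.differentiable (by simp) _)
  have h1 := hσ.2.2 (τ y)
  have h2 := hτ.2.2 y
  rw [h]
  simp only [ContinuousLinearMap.det] at h1 h2 ⊢
  rw [ContinuousLinearMap.toLinearMap_comp, LinearMap.det_comp, h1, h2, one_mul]

theorem IsUnimodular.inv {σ : Equiv.Perm (ℝ × ℝ)} (hσ : IsUnimodular σ) :
    IsUnimodular σ⁻¹ := by
  refine ⟨hσ.2.1, hσ.1, fun y => ?_⟩
  have h : (fderiv ℝ σ (σ.symm y)).comp (fderiv ℝ σ.symm y)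
      = ContinuousLinearMap.id ℝ (ℝ × ℝ) := by
    rw [← fderiv_comp y (hσ.1.differentiable (by simp) _) (hσ.2.1.differentiable (by simp) _)]
    have e : (σ : ℝ × ℝ → ℝ × ℝ) ∘ σ.symm = id := by
      funext x
      simp
    rw [e, fderiv_id]
  have h1 := hσ.2.2 (σ.symm y)
  have h2 := congrArg ContinuousLinearMap.det h
  change (fderiv ℝ σ.symm y).det = 1
  simp only [ContinuousLinearMap.det] at h1 h2 ⊢
  rw [ContinuousLinearMap.toLinearMap_comp, LinearMap.det_comp, h1, one_mul] at h2
  simpa using h2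

/-- The reparametrization group. -/
def reparamGroup : Subgroup (Equiv.Perm Z) where
  carrier := {Φ | ∃ (a : ℝ × ℝ → ℝ) (σ : Equiv.Perm (ℝ × ℝ)),
    ContDiff ℝ ∞ a ∧ IsUnimodular σ ∧ ∀ z, Φ z = reparamMap a σ z}
  one_mem' := ⟨fun _ => 0, 1, contDiff_const, IsUnimodular.one, fun z => (reparamMap_id z).symm⟩
  mul_mem' := by
    rintro Φ Ψ ⟨a, σ, ha, hσ, hΦ⟩ ⟨b, τ, hb, hτ, hΨ⟩
    refine ⟨fun y => b y + a (τ y), σ * τ, hb.add (ha.comp hτ.1), hσ.mul hτ, fun z => ?_⟩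
    rw [Equiv.Perm.mul_apply, hΨ, hΦ, reparamMap_comp]
    rfl
  inv_mem' := by
    rintro Φ ⟨a, σ, ha, hσ, hΦ⟩
    refine ⟨fun y => -a (σ.symm y), σ⁻¹, (ha.comp hσ.2.1).neg, hσ.inv, fun z => ?_⟩
    rw [Equiv.Perm.inv_eq_iff_eq, hΦ, reparamMap_comp]
    have e : (σ : ℝ × ℝ → ℝ × ℝ) ∘ (σ⁻¹ : Equiv.Perm (ℝ × ℝ)) = id := by
      funext x
      simp
    have e2 : (fun y => -a (σ.symm y) + a ((σ⁻¹ : Equiv.Perm (ℝ × ℝ)) y)) = fun _ => 0 := by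
      funext y
      exact neg_add_cancel _
    rw [e, e2, reparamMap_id]

/-- The values of `(ξ², ξ³)` that occur in `U`. -/
def planeProj (U : Set Z) : Set (ℝ × ℝ) := (fun z : Z => (z.1 2, z.1 3)) '' U

/-- On `U`, the field `X` has the form `a ∂_{ξ¹} + b ∂_{ξ²} + c ∂_{ξ³}` with smooth functions
`a, b, c` of `(ξ², ξ³)` such that `(b, c)` is divergence-free: the infinitesimal
reparametrizations. -/
def IsReparamFieldOn (U : Set Z) (X : Z → Z) : Prop :=
  ∃ a b c : ℝ × ℝ → ℝ,
    ContDiffOn ℝ ∞ a (planeProj U) ∧ ContDiffOn ℝ ∞ b (planeProj U) ∧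
    ContDiffOn ℝ ∞ c (planeProj U) ∧
    (∀ y ∈ planeProj U, fderiv ℝ b y (1, 0) + fderiv ℝ c y (0, 1) = 0) ∧
    Set.EqOn X (fun z => (![0, a (z.1 2, z.1 3), b (z.1 2, z.1 3), c (z.1 2, z.1 3)], 0)) U

/-! ### The generalized Galilean group -/

/-- `T = ∂_t`. -/
def opT : Z → Z := fun _ => (Pi.single 0 1, 0)

/-- `R_i = ∑_{j,k} ε_{ijk} γ^j ∂_{γ^k}`; note `∑_j ε_{ijk} γ^j = (e_i × γ)_k`. -/
def opR (i : Fin 3) : Z → Z := fun z =>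
  (0, Fin.cons 0 ((Pi.single i 1 : Fin 3 → ℝ) ⨯₃ (fun k : Fin 3 => z.2 k.succ)))

/-- `S₁ = t ∂_t + ∑ ξ^j ∂_{ξ^j} + ∑ γ^j ∂_{γ^j}`. -/
def opS1 : Z → Z := fun z => (z.1, ![0, z.2 1, z.2 2, z.2 3])

/-- `S₂ = 3 ξ² ∂_{ξ²} + 3 ξ³ ∂_{ξ³} + 2 ∑ γ^j ∂_{γ^j} + 4 P ∂_P`. -/
def opS2 : Z → Z := fun z =>
  (![0, 0, 3 * z.1 2, 3 * z.1 3], ![4 * z.2 0, 2 * z.2 1, 2 * z.2 2, 2 * z.2 3])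

/-- `G_i(α) = α(t) ∂_{γ^i} - γ^i α''(t) ∂_P`. -/
noncomputable def opG (i : Fin 3) (α : ℝ → ℝ) : Z → Z := fun z =>
  (0, Fin.cons (-(z.2 i.succ * iteratedDeriv 2 α (z.1 0))) (Pi.single i (α (z.1 0))))

/-- `K = β(t) ∂_P`. -/
def opK (β : ℝ → ℝ) : Z → Z := fun z => (0, Pi.single 0 (β (z.1 0)))

/-- The generating operators of the generalized Galilean group. -/
def galileanOperators : Set (Z → Z) :=
  {opT, opS1, opS2} ∪ Set.range opR
    ∪ {X | ∃ (i : Fin 3) (α : ℝ → ℝ), ContDiff ℝ ∞ α ∧ X = opG i α}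
    ∪ {X | ∃ β : ℝ → ℝ, ContDiff ℝ ∞ β ∧ X = opK β}

/-- `Φ` is the one-parameter group of transformations with generator `X`. -/
def IsOneParameterGroupOf (X : Z → Z) (Φ : ℝ → Equiv.Perm Z) : Prop :=
  (∀ r s, Φ (r + s) = Φ r * Φ s) ∧ ∀ s z, HasDerivAt (fun r => Φ r z) (X (Φ s z)) s

/-- The generalized Galilean group: the group generated by the one-parameter groups of the
operators `T, R_i, S₁, S₂, G_i(α), K(β)`. -/
def galileanGroup : Subgroup (Equiv.Perm Z) :=
  Subgroup.closure {Ψ | ∃ X ∈ galileanOperators, ∃ Φ : ℝ → Equiv.Perm Z,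
    IsOneParameterGroupOf X Φ ∧ ∃ s, Φ s = Ψ}

/-- The values of `t` that occur in `U`. -/
def timeProj (U : Set Z) : Set ℝ := (fun z : Z => z.1 0) '' U

/-- On `U`, the field `X` is a linear combination of the operators
`T, R_i, S₁, S₂, G_i(αⁱ), K(β)`, with `αⁱ` and `β` smooth. -/
def IsGalileanFieldOn (U : Set Z) (X : Z → Z) : Prop :=
  ∃ (c : ℝ) (r : Fin 3 → ℝ) (s₁ s₂ : ℝ) (α : Fin 3 → ℝ → ℝ) (β : ℝ → ℝ),
    (∀ i, ContDiffOn ℝ ∞ (α i) (timeProj U)) ∧ ContDiffOn ℝ ∞ β (timeProj U) ∧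
    Set.EqOn X (fun z => c • opT z + ∑ i, r i • opR i z + s₁ • opS1 z + s₂ • opS2 z
      + ∑ i, opG i (α i) z + opK β z) U

end NaturalMHD

namespace NaturalMHD

/-! ### Calculus preliminaries -/

/-! Infinitesimal part. At a fixed point of `Z`, the invariance condition is polynomial in the
derivative coordinates, so it may be tested at well-chosen jets. Every `p` with mixed product 1
extends to a jet of the equation manifold: all second derivatives are zero except `γ_tt`, which
balances the pressure force. The constraint then shows that the `(t, ξ)`-components of a symmetry do
not depend on `(γ, P)`, that the `γ`-components depend neither on `ξ` nor on `P`, and that two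
traces agree (`mixedProductDetermining_of_symmetry`). Second-order jets over the unit matrix show
that `∂_t² - ∂_{ξ¹}²` can only be rescaled (`waveDetermining_of_symmetry`). Varying the velocity,
the signs of a diagonal `∂γ/∂ξ` and the pressure gradient yields the rest: the `γ`-components are
affine in `γ`, with a conformal linear part, and they determine the `γ`-dependence of the pressure
component (`momentumDetermining_of_symmetry`). These equations are also sufficient. On a convex open
set they integrate to the explicit `NormalForm`, whose parameters split into those of a
reparametrization and those of a Galilean field; the bracket statements are computed on this form.

Group part, lower bound. A Galilean one-parameter group is an explicit flow. A reparametrization is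
joined to the identity through reparametrizations because the unimodular diffeomorphisms of the
plane are connected: after translations and linear shears the map is tangent to the identity at the
origin, and the Alexander trick `σ(sx)/s` applies. By Liouville's formula the velocity of such an
isotopy is divergence-free.

Group part, upper bound. The velocity field of a symmetry isotopy is in normal form at each instant,
so the isotopy solves a triangular system of differential equations. Uniqueness of solutions gives
the form of the flow map: an affine time change, a common scaling, a rotation and time-dependent
shifts, together with a plane map of constant Jacobian and a label shift. It is therefore a
reparametrization times a Galilean transformation (`IsSymmetryIsotopy.exists_eq_mul`). Galilean
elements act on `(ξ², ξ³)` by homotheties and so normalize the reparametrizations; hence the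
products form a group, and the factors meet trivially because a unimodular homothety of positive
ratio is the identity. That solutions go to solutions is checked on the two kinds of factor by the
chain rule. -/

theorem two_le_infty : (2 : WithTop ℕ∞) ≤ ∞ := by
  exact ENat.LEInfty.out

/-- Only the derivative along the segment is used, so the lemma also applies to functions that are
constant along some directions only; convexity keeps the segment in `U`. -/
theorem eq_of_fderiv_segment_eq_zero {E F : Type*} [NormedAddCommGroup E] [NormedSpace ℝ E]
    [NormedAddCommGroup F] [NormedSpace ℝ F] {U : Set E} (hU : IsOpen U) (hc : Convex ℝ U)
    {f : E → F} (hf : DifferentiableOn ℝ f U) {x y : E} (hx : x ∈ U) (hy : y ∈ U)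
    (h : ∀ z ∈ U, fderiv ℝ f z (y - x) = 0) : f x = f y := by
  let γ : ℝ → E := fun s => x + s • (y - x)
  have hγU : ∀ s ∈ Set.Icc (0 : ℝ) 1, γ s ∈ U := fun s hs =>
    hc.add_smul_sub_mem hx hy hs
  have hγ : ∀ s, HasDerivAt γ (y - x) s := fun s => by
    have h1 := ((hasDerivAt_id s).smul_const (y - x)).const_add x
    rwa [one_smul] at h1
  have hd : ∀ s ∈ Set.Icc (0 : ℝ) 1, HasDerivAt (f ∘ γ) 0 s := fun s hs => by
    have h1 := ((hf _ (hγU s hs)).differentiableAt (hU.mem_nhds (hγU s hs))).hasFDerivAt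
    have h2 := h1.comp_hasDerivAt s (hγ s)
    rwa [h _ (hγU s hs)] at h2
  have hk := constant_of_has_deriv_right_zero (f := f ∘ γ) (a := 0) (b := 1)
    (fun s hs => (hd s hs).continuousAt.continuousWithinAt)
    (fun s hs => (hd s ⟨hs.1, hs.2.le⟩).hasDerivWithinAt) 1 (by simp)
  simpa [γ] using hk.symm

theorem eq_of_fderiv_eq_zero {E F : Type*} [NormedAddCommGroup E] [NormedSpace ℝ E]
    [NormedAddCommGroup F] [NormedSpace ℝ F] {U : Set E} (hU : IsOpen U) (hc : Convex ℝ U)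
    {f : E → F} (hf : DifferentiableOn ℝ f U)
    (h : ∀ z ∈ U, fderiv ℝ f z = 0) : ∃ c, ∀ z ∈ U, f z = c := by
  rcases U.eq_empty_or_nonempty with rfl | ⟨x, hx⟩
  · exact ⟨0, by simp⟩
  · exact ⟨f x, fun z hz => eq_of_fderiv_segment_eq_zero hU hc hf hz hx (by simp +contextual [h])⟩

/-- A smooth function on a convex open set that is constant along the fibres of a linear projection
descends to a smooth function on the image. -/
theorem exists_factor_of_fderiv_eq_zero {E B F : Type*} [NormedAddCommGroup E] [NormedSpace ℝ E]
    [NormedAddCommGroup B] [NormedSpace ℝ B]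
    [NormedAddCommGroup F] [NormedSpace ℝ F] {U : Set E} (hU : IsOpen U) (hc : Convex ℝ U)
    {f : E → F} (hf : ContDiffOn ℝ ∞ f U) (L : E →L[ℝ] B) (R : B →L[ℝ] E)
    (hLR : ∀ b, L (R b) = b)
    (h : ∀ z ∈ U, ∀ v, L v = 0 → fderiv ℝ f z v = 0) :
    ∃ g : B → F, ContDiffOn ℝ ∞ g (L '' U) ∧ ∀ z ∈ U, f z = g (L z) := by
  classical
  have key : ∀ x ∈ U, ∀ y ∈ U, L x = L y → f x = f y := fun x hx y hy hxy =>
    eq_of_fderiv_segment_eq_zero hU hc (hf.differentiableOn (by simp)) hx hy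
      fun z hz => h z hz _ (by simp [hxy])
  -- A value is picked from each fibre; `key` makes the choice immaterial.
  let g : B → F := fun b => if hb : b ∈ L '' U then f hb.choose else 0
  have hg : ∀ z ∈ U, f z = g (L z) := fun z hz => by
    have hb : L z ∈ L '' U := ⟨z, hz, rfl⟩
    simp only [g, dif_pos hb]
    exact key z hz _ hb.choose_spec.1 hb.choose_spec.2.symm
  refine ⟨g, ?_, hg⟩
  rintro _ ⟨z, hz, rfl⟩
  refine ContDiffAt.contDiffWithinAt ?_
  -- A local affine section of `L` through `z`. Near `L z` the function `g` is `f ∘ σ`, hence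
  -- smooth.
  let σ : B → E := fun b => z + R (b - L z)
  have hσ : ContDiff ℝ ∞ σ := by fun_prop
  have hσz : σ (L z) = z := by simp [σ]
  have h1 : ContDiffAt ℝ ∞ (f ∘ σ) (L z) := by
    refine ContDiffAt.comp _ ?_ hσ.contDiffAt
    rw [hσz]
    exact hf.contDiffAt (hU.mem_nhds hz)
  refine h1.congr_of_eventuallyEq ?_
  have h2 : σ ⁻¹' U ∈ nhds (L z) :=
    hσ.continuous.continuousAt.preimage_mem_nhds (by rw [hσz]; exact hU.mem_nhds hz)
  filter_upwards [h2] with b hb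
  have h3 := hg _ hb
  have h4 : L (σ b) = b := by simp [σ, hLR]
  rw [h4] at h3
  exact h3.symm

/-- A `C¹` field need not be globally Lipschitz. On a bounded time interval both curves stay in a
ball, and on the compact convex product of interval and ball the derivative bound gives a Lipschitz
constant. -/
theorem ode_unique {E : Type*} [NormedAddCommGroup E] [NormedSpace ℝ E] [FiniteDimensional ℝ E]
    {v : ℝ × E → E} (hv : ContDiff ℝ 1 v) {f g : ℝ → E}
    (hf : ∀ s, HasDerivAt f (v (s, f s)) s) (hg : ∀ s, HasDerivAt g (v (s, g s)) s)
    (h0 : f 0 = g 0) : f = g := by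
  funext s
  set T : ℝ := |s| + 1 with hT
  have hT0 : 0 < T := by positivity
  have hfc : Continuous f := continuous_iff_continuousAt.2 fun s => (hf s).continuousAt
  have hgc : Continuous g := continuous_iff_continuousAt.2 fun s => (hg s).continuousAt
  obtain ⟨R1, hR1⟩ := (isCompact_Icc (a := -T) (b := T)).exists_bound_of_continuousOn
    hfc.continuousOn
  obtain ⟨R2, hR2⟩ := (isCompact_Icc (a := -T) (b := T)).exists_bound_of_continuousOn
    hgc.continuousOn
  set R := max R1 R2
  set K : Set (ℝ × E) := Set.Icc (-T) T ×ˢ Metric.closedBall 0 R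
  have hK : IsCompact K := isCompact_Icc.prod (isCompact_closedBall _ _)
  have hKc : Convex ℝ K := (convex_Icc _ _).prod (convex_closedBall _ _)
  obtain ⟨C, hC⟩ := hK.exists_bound_of_continuousOn
    (hv.continuous_fderiv (by simp)).continuousOn
  have hL : LipschitzOnWith (Real.toNNReal C) v K := by
    refine hKc.lipschitzOnWith_of_nnnorm_fderiv_le (𝕜 := ℝ)
      (fun x _ => hv.differentiable (by simp) x) fun x hx => ?_
    rw [← NNReal.coe_le_coe, coe_nnnorm]
    exact (hC x hx).trans (Real.le_coe_toNNReal C)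
  have hL' : ∀ t ∈ Set.Ioo (-T) T,
      LipschitzOnWith (Real.toNNReal C) (fun y => v (t, y)) (Metric.closedBall 0 R) := by
    intro t ht
    have h1 := hL.comp (f := fun y : E => (t, y)) (s := Metric.closedBall 0 R)
      ((LipschitzWith.prodMk_left t).lipschitzOnWith) (fun y hy => ⟨⟨ht.1.le, ht.2.le⟩, hy⟩)
    simpa [Function.comp_def] using h1
  have hs : s ∈ Set.Ioo (-T) T := by
    constructor <;> cases abs_cases s <;> linarith
  refine ODE_solution_unique_of_mem_Ioo (v := fun t y => v (t, y))
    (s := fun _ => Metric.closedBall 0 R) (t₀ := 0) hL' ⟨by linarith, hT0⟩ (fun t ht => ⟨hf t, ?_⟩)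
    (fun t ht => ⟨hg t, ?_⟩) h0 hs
  · exact mem_closedBall_zero_iff.2 ((hR1 t ⟨ht.1.le, ht.2.le⟩).trans (le_max_left _ _))
  · exact mem_closedBall_zero_iff.2 ((hR2 t ⟨ht.1.le, ht.2.le⟩).trans (le_max_right _ _))

/-- Smoothness of parametric integrals over the unit interval. -/
theorem contDiff_integral_unitInterval {P F : Type*} [NormedAddCommGroup P] [NormedSpace ℝ P]
    [NormedAddCommGroup F] [NormedSpace ℝ F] [CompleteSpace F]
    {G : P × ℝ → F} (hG : ContDiff ℝ ∞ G) :
    ContDiff ℝ ∞ (fun p => ∫ t in (0 : ℝ)..1, G (p, t)) := by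
  obtain ⟨χ, hχ1, hχs, hχ⟩ : ∃ χ : ℝ → ℝ, (∀ t ∈ Set.Icc (0 : ℝ) 1, χ t = 1) ∧
      (∀ t, t ∉ Metric.closedBall (0 : ℝ) 2 → χ t = 0) ∧ ContDiff ℝ ∞ χ := by
    let b : ContDiffBump (0 : ℝ) := ⟨1, 2, by norm_num, by norm_num⟩
    refine ⟨b, fun t ht => b.one_of_mem_closedBall ?_, fun t ht => b.zero_of_le_dist ?_,
      b.contDiff⟩
    · simp only [Metric.mem_closedBall, dist_zero_right, Real.norm_eq_abs]
      exact abs_le.2 ⟨by linarith [ht.1], ht.2⟩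
    · simp only [Metric.mem_closedBall, not_le] at ht
      exact ht.le
  -- With the reflected argument, the convolution of the indicator of `(0, 1]` with `g p`, taken at
  -- `0`, is the desired integral. The cutoff `χ`, equal to 1 on `[0, 1]`, supplies the compact
  -- support needed to differentiate a convolution in the parameter.
  let g : P → ℝ → F := fun p x => χ (-x) • G (p, -x)
  have hg : ContDiff ℝ ∞ (fun q : P × ℝ => g q.1 q.2) := by
    have h1 : ContDiff ℝ ∞ (fun q : P × ℝ => χ (-q.2)) := hχ.comp contDiff_snd.neg
    exact h1.smul (hG.comp (contDiff_fst.prodMk contDiff_snd.neg))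
  let f : ℝ → ℝ := Set.indicator (Set.Ioc 0 1) 1
  have hf : MeasureTheory.LocallyIntegrable f MeasureTheory.volume := by
    refine MeasureTheory.Integrable.locallyIntegrable ?_
    refine (MeasureTheory.integrable_indicator_iff measurableSet_Ioc).2 ?_
    exact MeasureTheory.integrableOn_const (by simp)
  have h := MeasureTheory.contDiffOn_convolution_right_with_param_comp
    (μ := MeasureTheory.volume) (n := ⊤) (s := Set.univ)
    (ContinuousLinearMap.lsmul ℝ ℝ : ℝ →L[ℝ] F →L[ℝ] F) (v := fun _ : P => (0 : ℝ)) contDiffOn_const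
    (f := f) (g := g) (k := Metric.closedBall (0 : ℝ) 2) isOpen_univ (isCompact_closedBall _ _)
    (fun p x _ hx => by
      have : χ (-x) = 0 := hχs _ (by simpa using hx)
      simp [g, this]) hf hg.contDiffOn
  rw [contDiffOn_univ] at h
  convert h using 2 with p
  rw [MeasureTheory.convolution_def, intervalIntegral.integral_of_le zero_le_one,
    ← MeasureTheory.integral_indicator measurableSet_Ioc]
  congr 1
  funext t
  by_cases ht : t ∈ Set.Ioc (0 : ℝ) 1
  · simp [f, ht, g, hχ1 t ⟨ht.1.le, ht.2⟩]
  · simp [f, ht]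

/-- The difference quotient `f (s x) / s`, extended by the derivative at `s = 0`, is jointly
smooth. -/
theorem exists_contDiff_scaling {E F : Type*} [NormedAddCommGroup E] [NormedSpace ℝ E]
    [NormedAddCommGroup F] [NormedSpace ℝ F] [CompleteSpace F]
    {f : E → F} (hf : ContDiff ℝ ∞ f) (h0 : f 0 = 0) :
    ∃ g : ℝ × E → F, ContDiff ℝ ∞ g ∧ (∀ s x, s • g (s, x) = f (s • x)) ∧
      ∀ x, g (0, x) = fderiv ℝ f 0 x := by
  -- Hadamard's formula `f(sx) = s ∫₀¹ f'(tsx) x dt`, valid since `f 0 = 0`; the integral makes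
  -- sense at `s = 0` too.
  refine ⟨fun q => ∫ t in (0 : ℝ)..1, fderiv ℝ f ((t * q.1) • q.2) q.2, ?_, ?_, ?_⟩
  · refine contDiff_integral_unitInterval
      (G := fun r : (ℝ × E) × ℝ => fderiv ℝ f ((r.2 * r.1.1) • r.1.2) r.1.2) ?_
    have h1 : ContDiff ℝ ∞ (fderiv ℝ f) := hf.fderiv_right (by simp)
    fun_prop
  · intro s x
    have h1 : ∀ t : ℝ, HasDerivAt (fun t : ℝ => f ((t * s) • x))
        (s • fderiv ℝ f ((t * s) • x) x) t := by
      intro t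
      have h2 : HasDerivAt (fun t : ℝ => (t * s) • x) (s • x) t := by
        simpa using ((hasDerivAt_id t).mul_const s).smul_const x
      have h3 := ((hf.differentiable (by simp) _).hasFDerivAt (x := (t * s) • x)).comp_hasDerivAt
        t h2
      rwa [map_smul] at h3
    have h1c : Continuous (fun t : ℝ => s • fderiv ℝ f ((t * s) • x) x) := by
      have : Continuous (fderiv ℝ f) := hf.continuous_fderiv (by simp)
      fun_prop
    have h2 := intervalIntegral.integral_eq_sub_of_hasDerivAt (a := 0) (b := 1)
      (fun t _ => h1 t) (h1c.intervalIntegrable _ _)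
    rw [intervalIntegral.integral_smul] at h2
    simpa [h0] using h2
  · intro x
    simp

/-- Schwarz: if `∂ₛ g = h` then `∂ₛ ∂_v g = ∂_v h`. -/
theorem hasDerivAt_fderiv_param {E F : Type*} [NormedAddCommGroup E] [NormedSpace ℝ E]
    [NormedAddCommGroup F] [NormedSpace ℝ F] {g h : ℝ × E → F} (hg : ContDiff ℝ ∞ g)
    (hgh : ∀ s x, HasDerivAt (fun r => g (r, x)) (h (s, x)) s) (s : ℝ) (x v : E) :
    HasDerivAt (fun r => fderiv ℝ (fun y => g (r, y)) x v)
      (fderiv ℝ (fun y => h (s, y)) x v) s := by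
  have hd : Differentiable ℝ g := hg.differentiable (by simp)
  have hd2 : ContDiff ℝ ∞ (fderiv ℝ g) := hg.fderiv_right (by simp)
  have e1 : ∀ r, fderiv ℝ (fun y => g (r, y)) x v = fderiv ℝ g (r, x) (0, v) := fun r => by
    have h1 := (hd (r, x)).hasFDerivAt.comp x (hasFDerivAt_prodMk_right r x)
    have h2 := h1.fderiv
    simp only [Function.comp_def] at h2
    rw [h2]
    simp
  have e2 : ∀ y, h (s, y) = fderiv ℝ g (s, y) (1, 0) := fun y => by
    have h1 := (hd (s, y)).hasFDerivAt.comp_hasDerivAt s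
      ((hasDerivAt_id s).prodMk (hasDerivAt_const s y))
    exact (hgh s y).unique h1
  simp only [e1, e2]
  have h3 := (hd2.differentiable (by simp) (s, x)).hasFDerivAt
  have h4 : HasDerivAt (fun r => fderiv ℝ g (r, x) (0, v))
      (fderiv ℝ (fderiv ℝ g) (s, x) (1, 0) (0, v)) s := by
    have h5 := h3.comp_hasDerivAt s ((hasDerivAt_id s).prodMk (hasDerivAt_const s x))
    have h7 := (ContinuousLinearMap.apply ℝ F ((0 : ℝ), v)).hasFDerivAt.comp_hasDerivAt s h5
    exact h7
  have h6 : HasFDerivAt (fun y => fderiv ℝ g (s, y) (1, 0))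
      (((ContinuousLinearMap.apply ℝ F ((1 : ℝ), (0 : E))).comp (fderiv ℝ (fderiv ℝ g) (s, x))).comp
        (ContinuousLinearMap.inr ℝ ℝ E)) x := by
    exact ((ContinuousLinearMap.apply ℝ F ((1 : ℝ), (0 : E))).hasFDerivAt.comp _ h3).comp x
      (hasFDerivAt_prodMk_right s x)
  rw [h6.fderiv]
  convert h4 using 1
  simpa using (hg.contDiffAt.isSymmSndFDerivAt (by simpa using two_le_infty)) (0, v) (1, 0)

/-! ### Coordinate derivatives and the prolongation formulas -/

/-- The coordinate vector of `x^μ`. -/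
def ex (μ : Fin 4) : Z := (Pi.single μ 1, 0)

/-- The coordinate vector of `u^a`. -/
def eu (a : Fin 4) : Z := (0, Pi.single a 1)

/-- The partial derivative in `x^μ`. -/
noncomputable def dx (f : Z → ℝ) (μ : Fin 4) (z : Z) : ℝ := fderiv ℝ f z (ex μ)

/-- The partial derivative in `u^a`. -/
noncomputable def du (f : Z → ℝ) (a : Fin 4) (z : Z) : ℝ := fderiv ℝ f z (eu a)

theorem Z_eq_sum (v : Z) : v = ∑ μ, v.1 μ • ex μ + ∑ a, v.2 a • eu a := by
  refine Prod.ext ?_ ?_ <;> funext i <;> fin_cases i <;>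
    simp [ex, eu, Fin.sum_univ_four]

theorem fderiv_apply_eq_sum (f : Z → ℝ) (z v : Z) :
    fderiv ℝ f z v = ∑ μ, v.1 μ * dx f μ z + ∑ a, v.2 a * du f a z := by
  conv_lhs => rw [Z_eq_sum v]
  simp [dx, du, map_sum]

theorem totalDeriv0_eq (f : Z → ℝ) (μ : Fin 4) (j : Jet1) :
    totalDeriv0 f μ j = dx f μ j.1 + ∑ b, j.2 b μ * du f b j.1 := by
  simp only [totalDeriv0, fderiv_apply_eq_sum, totalVec]
  simp [Pi.single_apply]

theorem prolong1_eq (X : Z → Z) (a μ : Fin 4) (j : Jet1) :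
    prolong1 X a μ j = dx (fun z => (X z).2 a) μ j.1
      + ∑ b, j.2 b μ * du (fun z => (X z).2 a) b j.1
      - ∑ ν, j.2 a ν * (dx (fun z => (X z).1 ν) μ j.1
        + ∑ b, j.2 b μ * du (fun z => (X z).1 ν) b j.1) := by
  simp only [prolong1, totalDeriv0_eq]

theorem contDiffOn_dx {U : Set Z} (hU : IsOpen U) {f : Z → ℝ} (hf : ContDiffOn ℝ ∞ f U)
    (μ : Fin 4) : ContDiffOn ℝ ∞ (dx f μ) U :=
  (hf.fderiv_of_isOpen hU (by simp)).clm_apply contDiffOn_const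

theorem contDiffOn_du {U : Set Z} (hU : IsOpen U) {f : Z → ℝ} (hf : ContDiffOn ℝ ∞ f U)
    (a : Fin 4) : ContDiffOn ℝ ∞ (du f a) U :=
  (hf.fderiv_of_isOpen hU (by simp)).clm_apply contDiffOn_const

theorem contDiffOn_comp1 {U : Set Z} {X : Z → Z} (hX : ContDiffOn ℝ ∞ X U) (μ : Fin 4) :
    ContDiffOn ℝ ∞ (fun z => (X z).1 μ) U := by fun_prop

theorem contDiffOn_comp2 {U : Set Z} {X : Z → Z} (hX : ContDiffOn ℝ ∞ X U) (a : Fin 4) :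
    ContDiffOn ℝ ∞ (fun z => (X z).2 a) U := by fun_prop

theorem differentiableAt_of_contDiffOn {E F : Type*} [NormedAddCommGroup E] [NormedSpace ℝ E]
    [NormedAddCommGroup F] [NormedSpace ℝ F] {U : Set E} (hU : IsOpen U) {f : E → F}
    (hf : ContDiffOn ℝ ∞ f U) {z : E} (hz : z ∈ U) : DifferentiableAt ℝ f z :=
  (hf.contDiffAt (hU.mem_nhds hz)).differentiableAt (by simp)

theorem differentiableAt_prolong1 {U : Set Z} (hU : IsOpen U) {X : Z → Z}
    (hX : ContDiffOn ℝ ∞ X U) (a μ : Fin 4) (j : Jet1) (hj : j.1 ∈ U) :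
    DifferentiableAt ℝ (prolong1 X a μ) j := by
  have e : prolong1 X a μ = fun j => dx (fun z => (X z).2 a) μ j.1
      + ∑ b, j.2 b μ * du (fun z => (X z).2 a) b j.1
      - ∑ ν, j.2 a ν * (dx (fun z => (X z).1 ν) μ j.1
        + ∑ b, j.2 b μ * du (fun z => (X z).1 ν) b j.1) := funext fun j => prolong1_eq X a μ j
  have h1 : ∀ f : Z → ℝ, ContDiffOn ℝ ∞ f U → ∀ μ,
      DifferentiableAt ℝ (fun j : Jet1 => dx f μ j.1) j := fun f hf μ =>
    (differentiableAt_of_contDiffOn hU (contDiffOn_dx hU hf μ) hj).comp j differentiableAt_fst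
  have h2 : ∀ f : Z → ℝ, ContDiffOn ℝ ∞ f U → ∀ μ,
      DifferentiableAt ℝ (fun j : Jet1 => du f μ j.1) j := fun f hf μ =>
    (differentiableAt_of_contDiffOn hU (contDiffOn_du hU hf μ) hj).comp j differentiableAt_fst
  have h3 : ∀ b μ, DifferentiableAt ℝ (fun j : Jet1 => j.2 b μ) j := fun b μ => by fun_prop
  rw [e]
  refine ((h1 _ (contDiffOn_comp2 hX a) μ).add (DifferentiableAt.fun_sum fun b _ =>
    (h3 b μ).mul (h2 _ (contDiffOn_comp2 hX a) b))).sub (DifferentiableAt.fun_sum fun ν _ =>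
    (h3 a ν).mul ((h1 _ (contDiffOn_comp1 hX ν) μ).add (DifferentiableAt.fun_sum fun b _ =>
    (h3 b μ).mul (h2 _ (contDiffOn_comp1 hX ν) b))))

theorem prolong2_eq {U : Set Z} (hU : IsOpen U) {X : Z → Z}
    (hX : ContDiffOn ℝ ∞ X U) (a μ ν : Fin 4) (j : Jet2) (hj : j.1.1 ∈ U) :
    prolong2 X a μ ν j = totalDeriv0 (dx (fun z => (X z).2 a) μ) ν j.1
      + ∑ b, (j.2 b μ ν * du (fun z => (X z).2 a) b j.1.1
        + j.1.2 b μ * totalDeriv0 (du (fun z => (X z).2 a) b) ν j.1)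
      - ∑ κ, (j.2 a κ ν * (dx (fun z => (X z).1 κ) μ j.1.1
            + ∑ b, j.1.2 b μ * du (fun z => (X z).1 κ) b j.1.1)
          + j.1.2 a κ * (totalDeriv0 (dx (fun z => (X z).1 κ) μ) ν j.1
            + ∑ b, (j.2 b μ ν * du (fun z => (X z).1 κ) b j.1.1
              + j.1.2 b μ * totalDeriv0 (du (fun z => (X z).1 κ) b) ν j.1)))
      - ∑ κ, j.2 a μ κ * totalDeriv0 (fun z => (X z).1 κ) ν j.1 := by
  rw [prolong2]
  congr 1
  -- The total derivative is the directional derivative along `w`, so it suffices to differentiate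
  -- the explicit formula of `prolong1` along the line `j.1 + s • w`.
  set w : Jet1 := (totalVec j.1.2 ν, fun a κ => j.2 a κ ν) with hw
  have hline : HasDerivAt (fun s : ℝ => j.1 + s • w) w 0 := by
    have h1 := ((hasDerivAt_id (0 : ℝ)).smul_const w).const_add j.1
    rwa [one_smul] at h1
  have h0 : j.1 + (0 : ℝ) • w = j.1 := by simp
  have hd := (differentiableAt_prolong1 hU hX a μ j.1 hj).hasFDerivAt
  rw [← h0] at hd
  have hd' := hd.comp_hasDerivAt (0 : ℝ) hline
  rw [h0] at hd'
  have g1 : ∀ g : Z → ℝ, ContDiffOn ℝ ∞ g U →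
      HasDerivAt (fun s : ℝ => g (j.1 + s • w).1) (totalDeriv0 g ν j.1) 0 := by
    intro g hg
    have h2 := (differentiableAt_of_contDiffOn hU hg hj).hasFDerivAt
    have h3 : HasFDerivAt (fun i : Jet1 => g i.1)
        ((fderiv ℝ g j.1.1).comp (ContinuousLinearMap.fst ℝ Z D1)) (j.1 + (0 : ℝ) • w) := by
      rw [h0]
      exact h2.comp j.1 hasFDerivAt_fst
    exact HasFDerivAt.comp_hasDerivAt (l := fun i : Jet1 => g i.1) (0 : ℝ) h3 hline
  have g2 : ∀ b κ, HasDerivAt (fun s : ℝ => (j.1 + s • w).2 b κ) (j.2 b κ ν) 0 := by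
    intro b κ
    have h3 := ((hasDerivAt_id (0 : ℝ)).mul_const (w.2 b κ)).const_add (j.1.2 b κ)
    rw [one_mul] at h3
    exact h3
  have f1 := fun κ => contDiffOn_comp1 hX κ
  have f2 := fun κ => contDiffOn_comp2 hX κ
  have k1 := ((g1 _ (contDiffOn_dx hU (f2 a) μ)).add (HasDerivAt.fun_sum (u := Finset.univ)
    fun b _ => (g2 b μ).mul (g1 _ (contDiffOn_du hU (f2 a) b)))).sub
    (HasDerivAt.fun_sum (u := Finset.univ) fun κ _ =>
      (g2 a κ).mul ((g1 _ (contDiffOn_dx hU (f1 κ) μ)).add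
        (HasDerivAt.fun_sum (u := Finset.univ) fun b _ =>
          (g2 b μ).mul (g1 _ (contDiffOn_du hU (f1 κ) b)))))
  have k2 : (prolong1 X a μ ∘ fun s : ℝ => j.1 + s • w) = fun s : ℝ =>
      dx (fun z => (X z).2 a) μ (j.1 + s • w).1
      + ∑ b, (j.1 + s • w).2 b μ * du (fun z => (X z).2 a) b (j.1 + s • w).1
      - ∑ κ, (j.1 + s • w).2 a κ * (dx (fun z => (X z).1 κ) μ (j.1 + s • w).1
        + ∑ b, (j.1 + s • w).2 b μ * du (fun z => (X z).1 κ) b (j.1 + s • w).1) :=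
    funext fun s => prolong1_eq X a μ _
  rw [k2] at hd'
  have k3 := hd'.unique k1
  rw [totalDeriv1, k3]
  simp

/-! ### The linearized equations -/

/-- The linearization of the mixed product. -/
def mixedProductLin (p p' : D1) : ℝ :=
  gradγ p' 1 ⬝ᵥ (gradγ p 2 ⨯₃ gradγ p 3) + gradγ p 1 ⬝ᵥ (gradγ p' 2 ⨯₃ gradγ p 3)
    + gradγ p 1 ⬝ᵥ (gradγ p 2 ⨯₃ gradγ p' 3)

/-- The linearization of the left-hand side of the momentum equation. -/
def momentumLin (p p' : D1) (q' : D2) : Fin 3 → ℝ :=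
  momentum p q' - momentum p 0
    + p' 0 1 • (gradγ p 2 ⨯₃ gradγ p 3) + p' 0 2 • (gradγ p 3 ⨯₃ gradγ p 1)
    + p' 0 3 • (gradγ p 1 ⨯₃ gradγ p 2)
    + p 0 1 • (gradγ p' 2 ⨯₃ gradγ p 3 + gradγ p 2 ⨯₃ gradγ p' 3)
    + p 0 2 • (gradγ p' 3 ⨯₃ gradγ p 1 + gradγ p 3 ⨯₃ gradγ p' 1)
    + p 0 3 • (gradγ p' 1 ⨯₃ gradγ p 2 + gradγ p 1 ⨯₃ gradγ p' 2)

theorem mixedProduct_eq (p : D1) : mixedProduct p =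
    p 1 1 * (p 2 2 * p 3 3 - p 3 2 * p 2 3) + p 2 1 * (p 3 2 * p 1 3 - p 1 2 * p 3 3)
      + p 3 1 * (p 1 2 * p 2 3 - p 2 2 * p 1 3) := by
  simp [mixedProduct, gradγ, cross_apply, dotProduct, Fin.sum_univ_three]

theorem hasDerivAt_cross {f g : ℝ → Fin 3 → ℝ} {f' g' : Fin 3 → ℝ} {s : ℝ}
    (hf : HasDerivAt f f' s) (hg : HasDerivAt g g' s) :
    HasDerivAt (fun r => f r ⨯₃ g r) (f' ⨯₃ g s + f s ⨯₃ g') s := by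
  rw [hasDerivAt_pi] at hf hg ⊢
  intro i
  fin_cases i <;> simp only [cross_apply]
  · refine HasDerivAt.congr_deriv (((hf 1).mul (hg 2)).sub ((hf 2).mul (hg 1))) ?_
    simp; ring
  · refine HasDerivAt.congr_deriv (((hf 2).mul (hg 0)).sub ((hf 0).mul (hg 2))) ?_
    simp; ring
  · refine HasDerivAt.congr_deriv (((hf 0).mul (hg 1)).sub ((hf 1).mul (hg 0))) ?_
    simp; ring

theorem hasDerivAt_dotProduct {n : Type*} [Fintype n] {f g : ℝ → n → ℝ} {f' g' : n → ℝ} {s : ℝ}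
    (hf : HasDerivAt f f' s) (hg : HasDerivAt g g' s) :
    HasDerivAt (fun r => f r ⬝ᵥ g r) (f' ⬝ᵥ g s + f s ⬝ᵥ g') s := by
  rw [hasDerivAt_pi] at hf hg
  have h := HasDerivAt.fun_sum (u := Finset.univ) fun i _ => (hf i).mul (hg i)
  simpa [dotProduct, Finset.sum_add_distrib] using h

theorem differentiable_cross {E : Type*} [NormedAddCommGroup E] [NormedSpace ℝ E]
    {f g : E → Fin 3 → ℝ} (hf : Differentiable ℝ f) (hg : Differentiable ℝ g) :
    Differentiable ℝ (fun x => f x ⨯₃ g x) := by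
  rw [differentiable_pi] at hf hg ⊢
  intro i
  fin_cases i <;> simp only [cross_apply]
  · exact ((hf 1).mul (hg 2)).sub ((hf 2).mul (hg 1))
  · exact ((hf 2).mul (hg 0)).sub ((hf 0).mul (hg 2))
  · exact ((hf 0).mul (hg 1)).sub ((hf 1).mul (hg 0))

theorem differentiable_mixedProduct : Differentiable ℝ mixedProduct := by
  have e : mixedProduct = fun p : D1 => _ := funext mixedProduct_eq
  rw [e]
  fun_prop

theorem differentiable_system : Differentiable ℝ system := by
  have h1 : ∀ μ, Differentiable ℝ (fun j : Jet2 => gradγ j.1.2 μ) := fun μ => by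
    unfold gradγ
    fun_prop
  have h2 : ∀ μ, Differentiable ℝ (fun j : Jet2 => j.1.2 0 μ) := fun μ => by fun_prop
  have h3 : Differentiable ℝ (fun j : Jet2 => ((fun k => j.2 k.succ 0 0) : Fin 3 → ℝ)) := by
    fun_prop
  have h4 : Differentiable ℝ (fun j : Jet2 => ((fun k => j.2 k.succ 1 1) : Fin 3 → ℝ)) := by
    fun_prop
  refine Differentiable.prodMk ?_ ?_
  · exact (((h3.sub h4).add ((h2 1).smul (differentiable_cross (h1 2) (h1 3)))).add
      ((h2 2).smul (differentiable_cross (h1 3) (h1 1)))).add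
      ((h2 3).smul (differentiable_cross (h1 1) (h1 2)))
  · exact (differentiable_mixedProduct.comp (differentiable_snd.comp differentiable_fst)).sub_const 1

theorem hasDerivAt_line {E : Type*} [NormedAddCommGroup E] [NormedSpace ℝ E] (x v : E) :
    HasDerivAt (fun s : ℝ => x + s • v) v 0 := by
  have h1 := ((hasDerivAt_id (0 : ℝ)).smul_const v).const_add x
  rwa [one_smul] at h1

theorem fderiv_eq_of_hasDerivAt_line {E F : Type*} [NormedAddCommGroup E] [NormedSpace ℝ E]
    [NormedAddCommGroup F] [NormedSpace ℝ F] {f : E → F} {x v : E} {f' : F}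
    (hf : DifferentiableAt ℝ f x) (h : HasDerivAt (fun s : ℝ => f (x + s • v)) f' 0) :
    fderiv ℝ f x v = f' := by
  have h1 : HasFDerivAt f (fderiv ℝ f x) (x + (0 : ℝ) • v) := by
    simpa using hf.hasFDerivAt
  exact (h1.comp_hasDerivAt (0 : ℝ) (hasDerivAt_line x v)).unique h

theorem hasDerivAt_mixedProduct_line (p p' : D1) :
    HasDerivAt (fun s : ℝ => mixedProduct (p + s • p')) (mixedProductLin p p') 0 := by
  have h0 : ∀ μ, HasDerivAt (fun s : ℝ => gradγ (p + s • p') μ) (gradγ p' μ) 0 := fun μ =>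
    hasDerivAt_line (gradγ p μ) (gradγ p' μ)
  refine (hasDerivAt_dotProduct (h0 1) (hasDerivAt_cross (h0 2) (h0 3))).congr_deriv ?_
  simp [mixedProductLin, add_assoc, dotProduct_add]

theorem fderiv_system (j v : Jet2) : fderiv ℝ system j v =
    (momentumLin j.1.2 v.1.2 v.2, mixedProductLin j.1.2 v.1.2) := by
  refine fderiv_eq_of_hasDerivAt_line differentiable_system.differentiableAt ?_
  have h0 : ∀ μ, HasDerivAt (fun s : ℝ => gradγ (j + s • v).1.2 μ) (gradγ v.1.2 μ) 0 := fun μ =>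
    hasDerivAt_line (gradγ j.1.2 μ) (gradγ v.1.2 μ)
  have h1 : ∀ μ, HasDerivAt (fun s : ℝ => (j + s • v).1.2 0 μ) (v.1.2 0 μ) 0 := fun μ =>
    hasDerivAt_line (j.1.2 0 μ) (v.1.2 0 μ)
  have h2 : ∀ μ, HasDerivAt (fun s : ℝ => ((fun k => (j + s • v).2 k.succ μ μ) : Fin 3 → ℝ))
      (fun k => v.2 k.succ μ μ) 0 := fun μ =>
    hasDerivAt_line (fun k : Fin 3 => j.2 k.succ μ μ) (fun k => v.2 k.succ μ μ)
  refine HasDerivAt.prodMk ?_ ?_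
  · have h := ((((h2 0).sub (h2 1)).add ((h1 1).smul (hasDerivAt_cross (h0 2) (h0 3)))).add
      ((h1 2).smul (hasDerivAt_cross (h0 3) (h0 1)))).add
      ((h1 3).smul (hasDerivAt_cross (h0 1) (h0 2)))
    refine h.congr_deriv ?_
    have e : j + (0 : ℝ) • v = j := by simp
    simp only [momentumLin, momentum, e]
    ext k
    simp
    ring
  · exact (hasDerivAt_mixedProduct_line j.1.2 v.1.2).sub_const 1

theorem totalDeriv1_mixedProduct (μ : Fin 4) (j : Jet2) :
    totalDeriv1 (fun i => mixedProduct i.2) μ j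
      = mixedProductLin j.1.2 (fun a ν => j.2 a ν μ) := by
  rw [totalDeriv1]
  refine fderiv_eq_of_hasDerivAt_line ?_ ?_
  · exact differentiable_mixedProduct.differentiableAt.comp _ differentiableAt_snd
  · exact hasDerivAt_mixedProduct_line j.1.2 _

/-- The form in which symmetry is tested below: `p` and `q` are free parameters subject to algebraic
conditions, and can be specialized at will. -/
theorem isInfinitesimalSymmetryOn_iff {U : Set Z} {X : Z → Z} :
    IsInfinitesimalSymmetryOn U X ↔ ContDiffOn ℝ ∞ X U ∧
      ∀ z ∈ U, ∀ p : D1, ∀ q : D2, (∀ a μ ν, q a μ ν = q a ν μ) → momentum p q = 0 →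
        mixedProduct p = 1 → (∀ μ, mixedProductLin p (fun a ν => q a ν μ) = 0) →
        momentumLin p (fun a μ => prolong1 X a μ (z, p))
            (fun a μ ν => prolong2 X a μ ν ((z, p), q)) = 0 ∧
          mixedProductLin p (fun a μ => prolong1 X a μ (z, p)) = 0 := by
  simp only [IsInfinitesimalSymmetryOn, equationManifold, fderiv_system, totalDeriv1_mixedProduct,
    prolong, system, Set.mem_ofPred_eq, Prod.mk_eq_zero, sub_eq_zero]
  refine and_congr_right fun _ => ⟨fun h z hz p q h1 h2 h3 h4 => ?_, fun h j hj hjU => ?_⟩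
  · exact h ((z, p), q) ⟨h1, ⟨h2, h3⟩, h4⟩ hz
  · exact h j.1.1 hjU j.1.2 j.2 hj.1 hj.2.1.1 hj.2.1.2 hj.2.2

/-! ### The determining equations -/

theorem mixedProductLin_eq (p r : D1) : mixedProductLin p r =
    r 1 1 * (p 2 2 * p 3 3 - p 3 2 * p 2 3) + r 2 1 * (p 3 2 * p 1 3 - p 1 2 * p 3 3)
      + r 3 1 * (p 1 2 * p 2 3 - p 2 2 * p 1 3)
    + (r 1 2 * (p 2 3 * p 3 1 - p 3 3 * p 2 1) + r 2 2 * (p 3 3 * p 1 1 - p 1 3 * p 3 1)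
      + r 3 2 * (p 1 3 * p 2 1 - p 2 3 * p 1 1))
    + (r 1 3 * (p 2 1 * p 3 2 - p 3 1 * p 2 2) + r 2 3 * (p 3 1 * p 1 2 - p 1 1 * p 3 2)
      + r 3 3 * (p 1 1 * p 2 2 - p 2 1 * p 1 2)) := by
  simp [mixedProductLin, gradγ, cross_apply, dotProduct, Fin.sum_univ_three]
  ring

/-- The pointwise consequences of the invariance of the mixed product equation. -/
theorem mixedProduct_determining {F Fu G Gu : Fin 4 → Fin 4 → ℝ}
    (H : ∀ p : D1, mixedProduct p = 1 → mixedProductLin p (fun a μ => F a μ + ∑ b, p b μ * Fu a b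
      - ∑ ν, p a ν * (G ν μ + ∑ b, p b μ * Gu ν b)) = 0) :
    (∀ ν b, Gu ν b = 0) ∧ (∀ i : Fin 3, G 0 i.succ = 0) ∧ (∀ k i : Fin 3, F k.succ i.succ = 0) ∧
      (∀ k : Fin 3, Fu k.succ 0 = 0) ∧ Fu 1 1 + Fu 2 2 + Fu 3 3 = G 1 1 + G 2 2 + G 3 3 := by
  have E : ∀ p : D1, _ → _ := fun p hp => by
    have := H p ((mixedProduct_eq p).trans hp)
    simp only [mixedProductLin_eq, Fin.sum_univ_four] at this
    exact this
  -- Writing `A` for the block `∂γ/∂ξ`, the linearization at `det A = 1` is `r ↦ tr (A⁻¹ r)`, so the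
  -- hypothesis is an identity on the unimodular matrices. Here `a1 a2 a3` is the pressure gradient,
  -- and the entries with index 0 form the velocity; `P_t` plays no role and is set to zero.
  have E' := fun (a1 a2 a3 b0 b1 b2 b3 c0 c1 c2 c3 d0 d1 d2 d3 : ℝ) => E ![![0, a1, a2, a3], ![b0, b1, b2, b3], ![c0, c1, c2, c3], ![d0, d1, d2, d3]]
  simp only [Matrix.cons_val, Matrix.cons_val', Matrix.cons_val_zero, Matrix.cons_val_one] at E'
  clear E H
  -- The identity is linear in the unknown coefficients, so finitely many test matrices suffice:
  -- diagonal ones, ones with a single off-diagonal entry, and ones with one component of velocity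
  -- or pressure gradient. The last sample `h31` has one of each, to reach `Gu 0 0`. The numerical
  -- coefficients below solve the resulting linear system.
  have h0 := E' 0 0 0 0 1 0 0 0 0 1 0 0 0 0 1 (by norm_num)
  have h1 := E' 0 0 0 0 1 0 0 0 0 (-1) 0 0 0 0 (-1) (by norm_num)
  have h2 := E' 0 0 0 0 (-1) 0 0 0 0 1 0 0 0 0 (-1) (by norm_num)
  have h3 := E' 0 0 0 0 (-1) 0 0 0 0 (-1) 0 0 0 0 1 (by norm_num)
  have h4 := E' 0 0 0 0 2 0 0 0 0 (1/2) 0 0 0 0 1 (by norm_num)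
  have h5 := E' 0 0 0 0 2 0 0 0 0 1 0 0 0 0 (1/2) (by norm_num)
  have h6 := E' 0 0 0 0 2 0 0 0 0 2 0 0 0 0 (1/4) (by norm_num)
  have h7 := E' 0 0 0 0 1 1 0 0 0 1 0 0 0 0 1 (by norm_num)
  have h8 := E' 0 0 0 0 1 1 0 0 0 (1/2) 0 0 0 0 2 (by norm_num)
  have h9 := E' 0 0 0 0 1 0 1 0 0 1 0 0 0 0 1 (by norm_num)
  have h10 := E' 0 0 0 0 1 0 1 0 0 2 0 0 0 0 (1/2) (by norm_num)
  have h11 := E' 0 0 0 0 1 0 0 0 1 1 0 0 0 0 1 (by norm_num)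
  have h12 := E' 0 0 0 0 (1/2) 0 0 0 1 1 0 0 0 0 2 (by norm_num)
  have h13 := E' 0 0 0 0 1 0 0 0 0 1 1 0 0 0 1 (by norm_num)
  have h14 := E' 0 0 0 0 2 0 0 0 0 1 1 0 0 0 (1/2) (by norm_num)
  have h15 := E' 0 0 0 0 1 0 0 0 0 1 0 0 1 0 1 (by norm_num)
  have h16 := E' 0 0 0 0 (1/2) 0 0 0 0 2 0 0 1 0 1 (by norm_num)
  have h17 := E' 0 0 0 0 1 0 0 0 0 1 0 0 0 1 1 (by norm_num)
  have h18 := E' 0 0 0 0 2 0 0 0 0 (1/2) 0 0 0 1 1 (by norm_num)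
  have h19 := E' 1 0 0 0 1 0 0 0 0 1 0 0 0 0 1 (by norm_num)
  have h20 := E' 0 0 0 1 1 0 0 0 0 1 0 0 0 0 1 (by norm_num)
  have h21 := E' 1 0 0 0 (-1) 0 0 0 0 1 0 0 0 0 (-1) (by norm_num)
  have h22 := E' 0 0 0 1 (-1) 0 0 0 0 1 0 0 0 0 (-1) (by norm_num)
  have h23 := E' 0 1 0 0 1 0 0 0 0 1 0 0 0 0 1 (by norm_num)
  have h24 := E' 0 0 0 0 1 0 0 1 0 1 0 0 0 0 1 (by norm_num)
  have h25 := E' 0 1 0 0 (-1) 0 0 0 0 (-1) 0 0 0 0 1 (by norm_num)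
  have h26 := E' 0 0 0 0 (-1) 0 0 1 0 (-1) 0 0 0 0 1 (by norm_num)
  have h27 := E' 0 0 1 0 1 0 0 0 0 1 0 0 0 0 1 (by norm_num)
  have h28 := E' 0 0 0 0 1 0 0 0 0 1 0 1 0 0 1 (by norm_num)
  have h29 := E' 0 0 1 0 1 0 0 0 0 (-1) 0 0 0 0 (-1) (by norm_num)
  have h30 := E' 0 0 0 0 1 0 0 0 0 (-1) 0 1 0 0 (-1) (by norm_num)
  have h31 := E' 1 0 0 1 1 0 0 0 0 1 0 0 0 0 1 (by norm_num)
  clear E'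
  norm_num only [mul_zero, zero_mul, add_zero, zero_add, sub_zero, zero_sub, mul_one, one_mul] at *
  refine ⟨fun ν b => ?_, fun i => ?_, fun k i => ?_, fun k => ?_, ?_⟩
  · fin_cases ν <;> fin_cases b
    · show Gu 0 0 = 0
      linear_combination (-1) * h0 + 1 * h19 + 1 * h20 + (-1) * h31
    · show Gu 0 1 = 0
      linear_combination (1/2) * h0 + (1/2) * h2 + (-1/2) * h20 + (-1/2) * h22
    · show Gu 0 2 = 0
      linear_combination (1/2) * h0 + (1/2) * h3 + (-1/2) * h24 + (-1/2) * h26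
    · show Gu 0 3 = 0
      linear_combination (1/2) * h0 + (1/2) * h1 + (-1/2) * h28 + (-1/2) * h30
    · show Gu 1 0 = 0
      linear_combination (1/2) * h0 + (1/2) * h2 + (-1/2) * h19 + (-1/2) * h21
    · show Gu 1 1 = 0
      linear_combination (1/4) * h0 + (1/4) * h1 + (1/12) * h2 + (1/12) * h3 + (4/3) * h4 + (-10/3) * h5 + (4/3) * h6
    · show Gu 1 2 = 0
      linear_combination (-1/4) * h0 + (1/4) * h2 + 1 * h5 + (-2) * h11 + 1 * h12
    · show Gu 1 3 = 0
      linear_combination (-1/4) * h0 + (1/4) * h3 + 1 * h4 + (-2) * h15 + 1 * h16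
    · show Gu 2 0 = 0
      linear_combination (1/2) * h0 + (1/2) * h3 + (-1/2) * h23 + (-1/2) * h25
    · show Gu 2 1 = 0
      linear_combination (7/8) * h0 + (1/8) * h1 + (1/8) * h2 + (-1/8) * h3 + (-1) * h4 + 1 * h5 + (-2) * h7 + 1 * h8
    · show Gu 2 2 = 0
      linear_combination (-1/2) * h0 + (1/2) * h1 + (-1/6) * h2 + (1/6) * h3 + 2 * h4 + (-10/3) * h5 + (4/3) * h6
    · show Gu 2 3 = 0
      linear_combination 2 * h0 + (-1) * h4 + (-2) * h17 + 1 * h18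
    · show Gu 3 0 = 0
      linear_combination (1/2) * h0 + (1/2) * h1 + (-1/2) * h27 + (-1/2) * h29
    · show Gu 3 1 = 0
      linear_combination (7/8) * h0 + (1/8) * h1 + (-1/8) * h2 + (1/8) * h3 + 1 * h4 + (-1) * h5 + (-2) * h9 + 1 * h10
    · show Gu 3 2 = 0
      linear_combination 2 * h0 + (-1) * h5 + (-2) * h13 + 1 * h14
    · show Gu 3 3 = 0
      linear_combination (-1/2) * h0 + (1/2) * h1 + (1/6) * h2 + (-1/6) * h3 + (4/3) * h4 + (-8/3) * h5 + (4/3) * h6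
  · fin_cases i
    · show G 0 1 = 0
      linear_combination (1/2) * h0 + (-1/2) * h2 + (-1/2) * h20 + (1/2) * h22
    · show G 0 2 = 0
      linear_combination (1/2) * h0 + (-1/2) * h3 + (-1/2) * h24 + (1/2) * h26
    · show G 0 3 = 0
      linear_combination (1/2) * h0 + (-1/2) * h1 + (-1/2) * h28 + (1/2) * h30
  · fin_cases k <;> fin_cases i
    · show F 1 1 = 0
      linear_combination (1/2) * h0 + (1/2) * h1 + (-1/6) * h2 + (-1/6) * h3 + (4/3) * h4 + (-10/3) * h5 + (4/3) * h6
    · show F 1 2 = 0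
      linear_combination (5/4) * h0 + (-1/4) * h2 + (-1) * h5 + 1 * h11 + (-1) * h12
    · show F 1 3 = 0
      linear_combination (5/4) * h0 + (-1/4) * h3 + (-1) * h4 + 1 * h15 + (-1) * h16
    · show F 2 1 = 0
      linear_combination (1/8) * h0 + (-1/8) * h1 + (-1/8) * h2 + (1/8) * h3 + 1 * h4 + (-1) * h5 + 1 * h7 + (-1) * h8
    · show F 2 2 = 0
      linear_combination (-1/4) * h0 + (1/4) * h1 + (1/12) * h2 + (-1/12) * h3 + 2 * h4 + (-10/3) * h5 + (4/3) * h6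
    · show F 2 3 = 0
      linear_combination (-1) * h0 + 1 * h4 + 1 * h17 + (-1) * h18
    · show F 3 1 = 0
      linear_combination (1/8) * h0 + (-1/8) * h1 + (1/8) * h2 + (-1/8) * h3 + (-1) * h4 + 1 * h5 + 1 * h9 + (-1) * h10
    · show F 3 2 = 0
      linear_combination (-1) * h0 + 1 * h5 + 1 * h13 + (-1) * h14
    · show F 3 3 = 0
      linear_combination (-1/4) * h0 + (1/4) * h1 + (-1/12) * h2 + (1/12) * h3 + (4/3) * h4 + (-8/3) * h5 + (4/3) * h6
  · fin_cases k
    · show Fu 1 0 = 0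
      linear_combination (-1/2) * h0 + (1/2) * h2 + (1/2) * h19 + (-1/2) * h21
    · show Fu 2 0 = 0
      linear_combination (-1/2) * h0 + (1/2) * h3 + (1/2) * h23 + (-1/2) * h25
    · show Fu 3 0 = 0
      linear_combination (-1/2) * h0 + (1/2) * h1 + (1/2) * h27 + (-1/2) * h29
  · linear_combination (1/4) * h0 + (1/4) * h1 + (1/4) * h2 + (1/4) * h3

theorem dx_congr {U : Set Z} (hU : IsOpen U) {f g : Z → ℝ} (h : ∀ z ∈ U, f z = g z) (μ : Fin 4)
    {z : Z} (hz : z ∈ U) : dx f μ z = dx g μ z := by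
  rw [dx, dx, Filter.EventuallyEq.fderiv_eq (Filter.eventuallyEq_of_mem (hU.mem_nhds hz) h)]

theorem du_congr {U : Set Z} (hU : IsOpen U) {f g : Z → ℝ} (h : ∀ z ∈ U, f z = g z) (a : Fin 4)
    {z : Z} (hz : z ∈ U) : du f a z = du g a z := by
  rw [du, du, Filter.EventuallyEq.fderiv_eq (Filter.eventuallyEq_of_mem (hU.mem_nhds hz) h)]

theorem dx_const (c : ℝ) (μ : Fin 4) (z : Z) : dx (fun _ => c) μ z = 0 := by simp [dx]

theorem du_const (c : ℝ) (a : Fin 4) (z : Z) : du (fun _ => c) a z = 0 := by simp [du]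

theorem fderiv_fderiv_comm {U : Set Z} (hU : IsOpen U) {f : Z → ℝ} (hf : ContDiffOn ℝ ∞ f U)
    {z : Z} (hz : z ∈ U) (v w : Z) :
    fderiv ℝ (fun y => fderiv ℝ f y v) z w = fderiv ℝ (fun y => fderiv ℝ f y w) z v := by
  have h1 : DifferentiableAt ℝ (fderiv ℝ f) z :=
    differentiableAt_of_contDiffOn hU (hf.fderiv_of_isOpen hU (by simp)) hz
  have h2 := (hf.contDiffAt (hU.mem_nhds hz)).isSymmSndFDerivAt (by simpa using two_le_infty)
  rw [fderiv_clm_apply h1 (differentiableAt_const v), fderiv_clm_apply h1 (differentiableAt_const w)]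
  simpa using h2 w v

theorem dx_dx_comm {U : Set Z} (hU : IsOpen U) {f : Z → ℝ} (hf : ContDiffOn ℝ ∞ f U)
    {z : Z} (hz : z ∈ U) (μ ν : Fin 4) : dx (dx f μ) ν z = dx (dx f ν) μ z :=
  fderiv_fderiv_comm hU hf hz _ _

theorem dx_du_comm {U : Set Z} (hU : IsOpen U) {f : Z → ℝ} (hf : ContDiffOn ℝ ∞ f U)
    {z : Z} (hz : z ∈ U) (μ a : Fin 4) : dx (du f a) μ z = du (dx f μ) a z :=
  fderiv_fderiv_comm hU hf hz _ _

theorem du_du_comm {U : Set Z} (hU : IsOpen U) {f : Z → ℝ} (hf : ContDiffOn ℝ ∞ f U)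
    {z : Z} (hz : z ∈ U) (a b : Fin 4) : du (du f a) b z = du (du f b) a z :=
  fderiv_fderiv_comm hU hf hz _ _

/-- The determining equations that follow from the mixed product equation. -/
structure MixedProductDetermining (U : Set Z) (X : Z → Z) : Prop where
  du_x : ∀ z ∈ U, ∀ ν b, du (fun z => (X z).1 ν) b z = 0
  dx_t : ∀ z ∈ U, ∀ i ≠ 0, dx (fun z => (X z).1 0) i z = 0
  dx_γ : ∀ z ∈ U, ∀ k ≠ 0, ∀ i ≠ 0, dx (fun z => (X z).2 k) i z = 0
  dP_γ : ∀ z ∈ U, ∀ k ≠ 0, du (fun z => (X z).2 k) 0 z = 0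
  trace : ∀ z ∈ U, du (fun z => (X z).2 1) 1 z + du (fun z => (X z).2 2) 2 z
    + du (fun z => (X z).2 3) 3 z = dx (fun z => (X z).1 1) 1 z + dx (fun z => (X z).1 2) 2 z
    + dx (fun z => (X z).1 3) 3 z

theorem momentum_sub_zero (p : D1) (q : D2) :
    momentum p q = (fun k => q k.succ 0 0 - q k.succ 1 1) + momentum p 0 := by
  ext k
  simp [momentum]
  ring

/-- Each `p` with mixed product 1 is completed to a jet on the equation manifold by a `q` supported
at `(t, t)`: there `γ_tt` is forced by the momentum equation, and the differentiated constraint does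
not see it, since each of its second derivatives has a spatial index. The first-order condition thus
holds for all such `p`. -/
theorem mixedProductDetermining_of_symmetry {U : Set Z} {X : Z → Z}
    (h : IsInfinitesimalSymmetryOn U X) : MixedProductDetermining U X := by
  rw [isInfinitesimalSymmetryOn_iff] at h
  have key := fun z hz => mixedProduct_determining
    (F := fun a μ => dx (fun z => (X z).2 a) μ z) (Fu := fun a b => du (fun z => (X z).2 a) b z)
    (G := fun ν μ => dx (fun z => (X z).1 ν) μ z) (Gu := fun ν b => du (fun z => (X z).1 ν) b z)
    fun p hp => by
      let q : D2 := fun a μ ν =>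
        if μ = 0 ∧ ν = 0 then (Fin.cons 0 (-momentum p 0) : Fin 4 → ℝ) a else 0
      have h1 := (h.2 z hz p q (fun a μ ν => by simp [q, and_comm]) ?_ hp ?_).2
      · simpa only [prolong1_eq] using h1
      · rw [momentum_sub_zero]
        ext k
        simp [q]
      · intro μ
        simp [mixedProductLin_eq, q]
  refine ⟨fun z hz => (key z hz).1, fun z hz i hi => ?_, fun z hz k hk i hi => ?_,
    fun z hz k hk => ?_, fun z hz => (key z hz).2.2.2.2⟩
  · obtain ⟨i, rfl⟩ := Fin.exists_succ_eq.2 hi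
    exact (key z hz).2.1 i
  · obtain ⟨k, rfl⟩ := Fin.exists_succ_eq.2 hk
    obtain ⟨i, rfl⟩ := Fin.exists_succ_eq.2 hi
    exact (key z hz).2.2.1 k i
  · obtain ⟨k, rfl⟩ := Fin.exists_succ_eq.2 hk
    exact (key z hz).2.2.2.1 k

theorem MixedProductDetermining.mixedProductLin_prolong1 {U : Set Z} {X : Z → Z}
    (h : MixedProductDetermining U X) {z : Z} (hz : z ∈ U) {p : D1} (hp : mixedProduct p = 1) :
    mixedProductLin p (fun a μ => prolong1 X a μ (z, p)) = 0 := by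
  have h1 := h.du_x z hz
  have h2 := h.dx_t z hz
  have h3 := h.dx_γ z hz
  have h4 := h.dP_γ z hz
  have h5 := h.trace z hz
  rw [mixedProduct_eq] at hp
  simp only [mixedProductLin_eq, prolong1_eq, Fin.sum_univ_four, h1, h2 _ Fin.zero_ne_one.symm,
    h2 2 (by decide), h2 3 (by decide), h3 1 (by decide) 1 (by decide), h3 1 (by decide) 2 (by decide),
    h3 1 (by decide) 3 (by decide), h3 2 (by decide) 1 (by decide), h3 2 (by decide) 2 (by decide),
    h3 2 (by decide) 3 (by decide), h3 3 (by decide) 1 (by decide), h3 3 (by decide) 2 (by decide),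
    h3 3 (by decide) 3 (by decide), h4 1 (by decide), h4 2 (by decide), h4 3 (by decide)]
  linear_combination (du (fun z => (X z).2 1) 1 z + du (fun z => (X z).2 2) 2 z
    + du (fun z => (X z).2 3) 3 z - dx (fun z => (X z).1 1) 1 z - dx (fun z => (X z).1 2) 2 z
    - dx (fun z => (X z).1 3) 3 z) * hp + h5

/-- The momentum equation contains second derivatives only through `γ_tt - γ_{ξ¹ξ¹}`, so only this
difference is needed. The equations from the constraint remove all terms in which a `(t,
ξ)`-component is differentiated in `u`, or a `γ`-component in `ξ¹`. -/
theorem MixedProductDetermining.prolong2_sub {U : Set Z} (hU : IsOpen U) {X : Z → Z}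
    (hX : ContDiffOn ℝ ∞ X U) (h : MixedProductDetermining U X) {z : Z} (hz : z ∈ U)
    (p : D1) {q : D2} (hq : ∀ a μ ν, q a μ ν = q a ν μ) {k : Fin 4} (hk : k ≠ 0) :
    prolong2 X k 0 0 ((z, p), q) - prolong2 X k 1 1 ((z, p), q) =
      dx (dx (fun z => (X z).2 k) 0) 0 z
        + ∑ b, 2 * p b 0 * dx (du (fun z => (X z).2 k) b) 0 z
        + ∑ b, ∑ c, (p b 0 * p c 0 - p b 1 * p c 1) * du (du (fun z => (X z).2 k) b) c z
        + ∑ b, (q b 0 0 - q b 1 1) * du (fun z => (X z).2 k) b z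
        - ∑ κ, 2 * (q k κ 0 * dx (fun z => (X z).1 κ) 0 z - q k κ 1 * dx (fun z => (X z).1 κ) 1 z)
        - ∑ κ, p k κ * (dx (dx (fun z => (X z).1 κ) 0) 0 z - dx (dx (fun z => (X z).1 κ) 1) 1 z) := by
  have f1 := fun κ => contDiffOn_comp1 hX κ
  have f2 := fun κ => contDiffOn_comp2 hX κ
  have z1 : ∀ μ, dx (dx (fun z => (X z).2 k) 1) μ z = 0 := fun μ => by
    rw [dx_congr hU (fun y hy => h.dx_γ y hy k hk 1 (by decide)) μ hz, dx_const]
  have z2 : ∀ b, du (dx (fun z => (X z).2 k) 1) b z = 0 := fun b => by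
    rw [du_congr hU (fun y hy => h.dx_γ y hy k hk 1 (by decide)) b hz, du_const]
  have z3 : ∀ b, dx (du (fun z => (X z).2 k) b) 1 z = 0 := fun b => by
    rw [dx_du_comm hU (f2 k) hz, z2]
  have z4 : ∀ κ b μ, dx (du (fun z => (X z).1 κ) b) μ z = 0 := fun κ b μ => by
    rw [dx_congr hU (fun y hy => h.du_x y hy κ b) μ hz, dx_const]
  have z5 : ∀ κ b c, du (du (fun z => (X z).1 κ) b) c z = 0 := fun κ b c => by
    rw [du_congr hU (fun y hy => h.du_x y hy κ b) c hz, du_const]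
  have z6 : ∀ κ b μ, du (dx (fun z => (X z).1 κ) μ) b z = 0 := fun κ b μ => by
    rw [← dx_du_comm hU (f1 κ) hz, z4]
  have z7 : ∀ b, du (dx (fun z => (X z).2 k) 0) b z = dx (du (fun z => (X z).2 k) b) 0 z :=
    fun b => (dx_du_comm hU (f2 k) hz 0 b).symm
  rw [prolong2_eq hU hX k 0 0 _ hz, prolong2_eq hU hX k 1 1 _ hz]
  simp only [totalDeriv0_eq, z1, z2, z3, z4, z5, z6, z7, h.du_x z hz, Fin.sum_univ_four,
    hq k 0 1, hq k 0 2, hq k 0 3, hq k 1 2, hq k 1 3]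
  ring

theorem momentumLin_apply (p r : D1) (q : D2) (k : Fin 3) :
    momentumLin p r q k = q k.succ 0 0 - q k.succ 1 1 + momentumLin p r 0 k := by
  simp only [momentumLin, momentum_sub_zero p q, Pi.add_apply, Pi.sub_apply]
  ring

theorem momentumLin_zero_eq (p r : D1) : momentumLin p r 0 =
    ![r 0 1 * (p 2 2 * p 3 3 - p 3 2 * p 2 3) + r 0 2 * (p 2 3 * p 3 1 - p 3 3 * p 2 1)
        + r 0 3 * (p 2 1 * p 3 2 - p 3 1 * p 2 2)
        + p 0 1 * (r 2 2 * p 3 3 - r 3 2 * p 2 3 + (p 2 2 * r 3 3 - p 3 2 * r 2 3))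
        + p 0 2 * (r 2 3 * p 3 1 - r 3 3 * p 2 1 + (p 2 3 * r 3 1 - p 3 3 * r 2 1))
        + p 0 3 * (r 2 1 * p 3 2 - r 3 1 * p 2 2 + (p 2 1 * r 3 2 - p 3 1 * r 2 2)),
      r 0 1 * (p 3 2 * p 1 3 - p 1 2 * p 3 3) + r 0 2 * (p 3 3 * p 1 1 - p 1 3 * p 3 1)
        + r 0 3 * (p 3 1 * p 1 2 - p 1 1 * p 3 2)
        + p 0 1 * (r 3 2 * p 1 3 - r 1 2 * p 3 3 + (p 3 2 * r 1 3 - p 1 2 * r 3 3))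
        + p 0 2 * (r 3 3 * p 1 1 - r 1 3 * p 3 1 + (p 3 3 * r 1 1 - p 1 3 * r 3 1))
        + p 0 3 * (r 3 1 * p 1 2 - r 1 1 * p 3 2 + (p 3 1 * r 1 2 - p 1 1 * r 3 2)),
      r 0 1 * (p 1 2 * p 2 3 - p 2 2 * p 1 3) + r 0 2 * (p 1 3 * p 2 1 - p 2 3 * p 1 1)
        + r 0 3 * (p 1 1 * p 2 2 - p 2 1 * p 1 2)
        + p 0 1 * (r 1 2 * p 2 3 - r 2 2 * p 1 3 + (p 1 2 * r 2 3 - p 2 2 * r 1 3))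
        + p 0 2 * (r 1 3 * p 2 1 - r 2 3 * p 1 1 + (p 1 3 * r 2 1 - p 2 3 * r 1 1))
        + p 0 3 * (r 1 1 * p 2 2 - r 2 1 * p 1 2 + (p 1 1 * r 2 2 - p 2 1 * r 1 2))] := by
  ext k
  fin_cases k <;> simp [momentumLin, gradγ, cross_apply]

theorem momentum_zero_eq (p : D1) : momentum p 0 =
    ![p 0 1 * (p 2 2 * p 3 3 - p 3 2 * p 2 3) + p 0 2 * (p 2 3 * p 3 1 - p 3 3 * p 2 1)
        + p 0 3 * (p 2 1 * p 3 2 - p 3 1 * p 2 2),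
      p 0 1 * (p 3 2 * p 1 3 - p 1 2 * p 3 3) + p 0 2 * (p 3 3 * p 1 1 - p 1 3 * p 3 1)
        + p 0 3 * (p 3 1 * p 1 2 - p 1 1 * p 3 2),
      p 0 1 * (p 1 2 * p 2 3 - p 2 2 * p 1 3) + p 0 2 * (p 1 3 * p 2 1 - p 2 3 * p 1 1)
        + p 0 3 * (p 1 1 * p 2 2 - p 2 1 * p 1 2)] := by
  ext k
  fin_cases k <;> simp [momentum, gradγ, cross_apply]

/-- The jet coordinates with `∂γ/∂t = v` and `∂γ/∂ξ` the identity. -/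
def unitJet (v : Fin 4 → ℝ) : D1 := fun a μ =>
  if a = 0 then 0 else if μ = 0 then v a else if a = μ then 1 else 0

/-- The symmetric elementary second-order coordinates. -/
def elemJet (a μ ν : Fin 4) : D2 := fun a' μ' ν' =>
  if a' = a ∧ (μ' = μ ∧ ν' = ν ∨ μ' = ν ∧ ν' = μ) then 1 else 0

theorem elemJet_symm (a μ ν : Fin 4) (a' μ' ν' : Fin 4) :
    elemJet a μ ν a' μ' ν' = elemJet a μ ν a' ν' μ' := by
  unfold elemJet
  congr 1
  apply propext
  tauto

theorem mixedProduct_unitJet (v : Fin 4 → ℝ) : mixedProduct (unitJet v) = 1 := by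
  simp [mixedProduct_eq, unitJet]

theorem momentum_unitJet (v : Fin 4 → ℝ) : momentum (unitJet v) 0 = 0 := by
  ext k
  fin_cases k <;> simp [momentum_zero_eq, unitJet]

/-- The determining equations in the second-order part of the momentum equation. -/
structure WaveDetermining (U : Set Z) (X : Z → Z) : Prop where
  dt_ξ : ∀ z ∈ U, ∀ i ≠ 0, dx (fun z => (X z).1 i) 0 z = 0
  d1_ξ1 : ∀ z ∈ U, dx (fun z => (X z).1 1) 1 z = dx (fun z => (X z).1 0) 0 z
  d1_ξ2 : ∀ z ∈ U, dx (fun z => (X z).1 2) 1 z = 0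
  d1_ξ3 : ∀ z ∈ U, dx (fun z => (X z).1 3) 1 z = 0

/-- At `unitJet 0` the momentum vanishes, so the admissible `q` form a linear space. Subtracting the
condition at `q = 0` cancels everything independent of `q`, and leaves in `key` a linear condition
on the derivatives of the `(t, ξ)`-components in `t` and `ξ¹`. Elementary `q` whose component and
indices avoid the trace constraint isolate them one at a time. -/
theorem waveDetermining_of_symmetry {U : Set Z} (hU : IsOpen U) {X : Z → Z}
    (h : IsInfinitesimalSymmetryOn U X) : WaveDetermining U X := by
  have hX := h.1
  have hm := mixedProductDetermining_of_symmetry h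
  rw [isInfinitesimalSymmetryOn_iff] at h
  have key : ∀ z ∈ U, ∀ q : D2, (∀ a μ ν, q a μ ν = q a ν μ) → (∀ k, q k 0 0 = q k 1 1) →
      (∀ ν, q 1 1 ν + q 2 2 ν + q 3 3 ν = 0) → ∀ k ≠ 0,
      ∑ κ, (q k κ 0 * dx (fun z => (X z).1 κ) 0 z - q k κ 1 * dx (fun z => (X z).1 κ) 1 z) = 0 := by
    intro z hz q h1 h2 h3 k hk
    obtain ⟨k, rfl⟩ := Fin.exists_succ_eq.2 hk
    have e := fun (q : D2) (h1 : ∀ a μ ν, q a μ ν = q a ν μ) (h2 : ∀ k, q k 0 0 = q k 1 1)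
      (h3 : ∀ ν, q 1 1 ν + q 2 2 ν + q 3 3 ν = 0) =>
      congrFun (h.2 z hz (unitJet 0) q h1 (by
        rw [momentum_sub_zero, momentum_unitJet]; ext k; simp [h2]) (mixedProduct_unitJet 0)
        (fun ν => by
          have := h3 ν
          simp [mixedProductLin_eq, unitJet]
          linarith)).1 k
    have e1 := e q h1 h2 h3
    have e2 := e 0 (by simp) (by simp) (by simp)
    rw [momentumLin_apply, hm.prolong2_sub hU hX hz _ h1 (Fin.succ_ne_zero k)] at e1
    rw [momentumLin_apply, hm.prolong2_sub hU hX hz _ (by simp) (Fin.succ_ne_zero k)] at e2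
    simp only [h2, sub_self, zero_mul, Finset.sum_const_zero, ← Finset.mul_sum,
      mul_assoc (2 : ℝ)] at e1
    simp only [Pi.zero_apply, zero_mul, sub_self, mul_zero, Finset.sum_const_zero,
      ← Finset.mul_sum, mul_assoc (2 : ℝ)] at e1 e2
    linarith
  have s1 : ∀ z ∈ U, ∀ (a μ ν : Fin 4), a ≠ 0 → (∀ k, elemJet a μ ν k 0 0 = elemJet a μ ν k 1 1) →
      (∀ κ, elemJet a μ ν 1 1 κ + elemJet a μ ν 2 2 κ + elemJet a μ ν 3 3 κ = 0) → _ :=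
    fun z hz a μ ν ha h1 h2 => key z hz (elemJet a μ ν) (elemJet_symm a μ ν) h1 h2 a ha
  refine ⟨fun z hz i hi => ?_, fun z hz => ?_, fun z hz => ?_, fun z hz => ?_⟩
  · have hi' : i = 1 ∨ i = 2 ∨ i = 3 := by fin_cases i <;> simp_all
    rcases hi' with rfl | rfl | rfl
    · simpa [elemJet, Fin.sum_univ_four, hm.dx_t z hz] using s1 z hz 2 0 1 (by decide)
        (by intro k; fin_cases k <;> simp [elemJet]) (by intro k; fin_cases k <;> simp [elemJet])
    · simpa [elemJet, Fin.sum_univ_four] using s1 z hz 1 0 2 (by decide)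
        (by intro k; fin_cases k <;> simp [elemJet]) (by intro k; fin_cases k <;> simp [elemJet])
    · simpa [elemJet, Fin.sum_univ_four] using s1 z hz 1 0 3 (by decide)
        (by intro k; fin_cases k <;> simp [elemJet]) (by intro k; fin_cases k <;> simp [elemJet])
  -- The only test jet with nonzero `γ_tt`, balanced by an equal `γ_{ξ¹ξ¹}`; it compares the
  -- scalings of `t` and `ξ¹`.
  · have := key z hz (elemJet 2 0 0 + elemJet 2 1 1)
      (fun a μ ν => by simp only [Pi.add_apply]; rw [elemJet_symm, elemJet_symm 2 1 1])
      (by intro k; fin_cases k <;> simp [elemJet]) (by intro k; fin_cases k <;> simp [elemJet])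
      2 (by decide)
    simp [elemJet] at this
    linarith
  · simpa [elemJet, Fin.sum_univ_four] using s1 z hz 3 1 2 (by decide)
        (by intro k; fin_cases k <;> simp [elemJet]) (by intro k; fin_cases k <;> simp [elemJet])
  · simpa [elemJet, Fin.sum_univ_four] using s1 z hz 2 1 3 (by decide)
        (by intro k; fin_cases k <;> simp [elemJet]) (by intro k; fin_cases k <;> simp [elemJet])

/-- The difference of the second-order prolongation coefficients that enters the momentum
equation. -/
theorem prolong2_sub_of_waveDetermining {U : Set Z} (hU : IsOpen U) {X : Z → Z}
    (hX : ContDiffOn ℝ ∞ X U) (hm : MixedProductDetermining U X) (hw : WaveDetermining U X)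
    {z : Z} (hz : z ∈ U)
    (p : D1) {q : D2} (hq : ∀ a μ ν, q a μ ν = q a ν μ) {k : Fin 4} (hk : k ≠ 0) :
    prolong2 X k 0 0 ((z, p), q) - prolong2 X k 1 1 ((z, p), q) =
      dx (dx (fun z => (X z).2 k) 0) 0 z
        + ∑ b, 2 * p b 0 * dx (du (fun z => (X z).2 k) b) 0 z
        + ∑ b, ∑ c, (p b 0 * p c 0 - p b 1 * p c 1) * du (du (fun z => (X z).2 k) b) c z
        + ∑ b, (q b 0 0 - q b 1 1) * du (fun z => (X z).2 k) b z
        - 2 * (q k 0 0 - q k 1 1) * dx (fun z => (X z).1 0) 0 z := by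
  have f1 := fun κ => contDiffOn_comp1 hX κ
  -- For `κ = 0`: `∂_t² X⁰ = ∂_t ∂_1 X¹ = ∂_1 ∂_t X¹ = 0`. The bound for `∂_1² X¹` in `c2` is the
  -- mirror image.
  have c1 : ∀ κ, dx (dx (fun z => (X z).1 κ) 0) 0 z = 0 := fun κ => by
    by_cases hκ : κ = 0
    · subst hκ
      rw [← dx_congr hU (fun y hy => hw.d1_ξ1 y hy) 0 hz, dx_dx_comm hU (f1 1) hz,
        dx_congr hU (fun y hy => hw.dt_ξ y hy 1 (by decide)) 1 hz, dx_const]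
    · rw [dx_congr hU (fun y hy => hw.dt_ξ y hy κ hκ) 0 hz, dx_const]
  have c2 : ∀ κ, dx (dx (fun z => (X z).1 κ) 1) 1 z = 0 := fun κ => by
    have hκ : κ = 0 ∨ κ = 1 ∨ κ = 2 ∨ κ = 3 := by fin_cases κ <;> simp
    rcases hκ with rfl | rfl | rfl | rfl
    · rw [dx_congr hU (fun y hy => hm.dx_t y hy 1 (by decide)) 1 hz, dx_const]
    · rw [dx_congr hU (fun y hy => hw.d1_ξ1 y hy) 1 hz, dx_dx_comm hU (f1 0) hz,
        dx_congr hU (fun y hy => hm.dx_t y hy 1 (by decide)) 0 hz, dx_const]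
    · rw [dx_congr hU (fun y hy => hw.d1_ξ2 y hy) 1 hz, dx_const]
    · rw [dx_congr hU (fun y hy => hw.d1_ξ3 y hy) 1 hz, dx_const]
  rw [hm.prolong2_sub hU hX hz p hq hk]
  simp only [c1, c2, sub_self, mul_zero, Finset.sum_const_zero, sub_zero]
  congr 1
  simp only [Fin.sum_univ_four, hw.dt_ξ z hz 1 (by decide), hw.dt_ξ z hz 2 (by decide),
    hw.dt_ξ z hz 3 (by decide), hm.dx_t z hz 1 (by decide), hw.d1_ξ1 z hz, hw.d1_ξ2 z hz,
    hw.d1_ξ3 z hz]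
  ring

/-- The remaining determining equations. -/
structure MomentumDetermining (U : Set Z) (X : Z → Z) : Prop where
  dγ_dγ : ∀ z ∈ U, ∀ k ≠ 0, ∀ b c, du (du (fun z => (X z).2 k) b) c z = 0
  dt_dγ : ∀ z ∈ U, ∀ k ≠ 0, ∀ b, dx (du (fun z => (X z).2 k) b) 0 z = 0
  dx_P : ∀ z ∈ U, ∀ i ≠ 0, dx (fun z => (X z).2 0) i z = 0
  dγ_P : ∀ z ∈ U, ∀ k ≠ 0, du (fun z => (X z).2 0) k z = -dx (dx (fun z => (X z).2 k) 0) 0 z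
  conformal : ∀ z ∈ U, ∀ k ≠ 0, ∀ l ≠ 0, du (fun z => (X z).2 k) l z + du (fun z => (X z).2 l) k z
    = if k = l then 2 * dx (fun z => (X z).1 0) 0 z + du (fun z => (X z).2 0) 0 z else 0

/-- Evaluation at `0` removes `w`, the vectors `±e_b` separate the linear from the square terms, and
`e_b + e_c` gives the mixed ones. The argument `v` will be the velocity `γ_t`, so index 0, that of
the pressure, is excluded. -/
theorem quadratic_vanish {w : ℝ} {V : Fin 4 → ℝ} {S : Fin 4 → Fin 4 → ℝ}
    (hS : ∀ b c, S b c = S c b)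
    (h : ∀ v : Fin 4 → ℝ, v 0 = 0 → w + ∑ b, 2 * v b * V b + ∑ b, ∑ c, v b * v c * S b c = 0) :
    (∀ b ≠ 0, V b = 0) ∧ ∀ b ≠ 0, ∀ c ≠ 0, S b c = 0 := by
  have h0 := h 0 rfl
  simp at h0
  subst h0
  have hV : ∀ b ≠ 0, V b = 0 ∧ S b b = 0 := fun b hb => by
    have h1 := h (Pi.single b 1) (by simp [hb.symm])
    have h2 := h (-Pi.single b 1) (by simp [hb.symm])
    simp [Pi.single_apply, mul_ite, ite_mul] at h1 h2
    constructor <;> linarith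
  refine ⟨fun b hb => (hV b hb).1, fun b hb c hc => ?_⟩
  have h1 := h (Pi.single b 1 + Pi.single c 1) (by simp [hb.symm, hc.symm])
  simp [Pi.single_apply, add_mul, mul_add, Finset.sum_add_distrib, (hV b hb).1, (hV b hb).2,
    (hV c hc).1, (hV c hc).2, hS c b] at h1
  linarith

/-- Second derivatives are eliminated by the completion with only `γ_tt ≠ 0`, equal to `-momentum p
0`; what is left is an identity in `p` alone. -/
theorem symmetry_momentum_equation {U : Set Z} (hU : IsOpen U) {X : Z → Z}
    (h : IsInfinitesimalSymmetryOn U X) {z : Z} (hz : z ∈ U) {p : D1} (hp : mixedProduct p = 1)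
    (k : Fin 3) :
    dx (dx (fun z => (X z).2 k.succ) 0) 0 z
        + ∑ b, 2 * p b 0 * dx (du (fun z => (X z).2 k.succ) b) 0 z
        + ∑ b, ∑ c, (p b 0 * p c 0 - p b 1 * p c 1) * du (du (fun z => (X z).2 k.succ) b) c z
        - ∑ l : Fin 3, momentum p 0 l * du (fun z => (X z).2 k.succ) l.succ z
        + 2 * momentum p 0 k * dx (fun z => (X z).1 0) 0 z
        + momentumLin p (fun a μ => prolong1 X a μ (z, p)) 0 k = 0 := by
  have hm := mixedProductDetermining_of_symmetry h
  have hw := waveDetermining_of_symmetry hU h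
  let q : D2 := fun a μ ν =>
    if μ = 0 ∧ ν = 0 then (Fin.cons 0 (-momentum p 0) : Fin 4 → ℝ) a else 0
  have hq : ∀ a μ ν, q a μ ν = q a ν μ := fun a μ ν => by simp [q, and_comm]
  have h1 := congrFun (((isInfinitesimalSymmetryOn_iff.1 h).2 z hz p q hq (by
    rw [momentum_sub_zero]; ext k; simp [q]) hp (by intro μ; simp [mixedProductLin_eq, q])).1) k
  rw [momentumLin_apply, prolong2_sub_of_waveDetermining hU h.1 hm hw hz p hq
    (Fin.succ_ne_zero k)] at h1
  rw [Fin.sum_univ_succ (f := fun b => (q b 0 0 - q b 1 1) * _)] at h1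
  simp [q] at h1
  linarith

/-- At `∂γ/∂ξ = 1` with zero pressure derivatives, the invariance identity is a quadratic polynomial
in the velocity, because the first-order part of the prolongation does not involve `v` there. Its
coefficients vanish; those with a pressure index vanish already because the `γ`-components do not
depend on `P`. -/
theorem symmetry_quadratic {U : Set Z} (hU : IsOpen U) {X : Z → Z}
    (h : IsInfinitesimalSymmetryOn U X) {z : Z} (hz : z ∈ U) {k : Fin 4} (hk : k ≠ 0) :
    (∀ b, dx (du (fun z => (X z).2 k) b) 0 z = 0) ∧
      ∀ b c, du (du (fun z => (X z).2 k) b) c z = 0 := by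
  have hm := mixedProductDetermining_of_symmetry h
  have hsym : ∀ b c, du (du (fun z => (X z).2 k) b) c z = du (du (fun z => (X z).2 k) c) b z :=
    fun b c => du_du_comm hU (contDiffOn_comp2 h.1 k) hz b c
  have h0 : dx (du (fun z => (X z).2 k) 0) 0 z = 0 := by
    rw [dx_congr hU (fun y hy => hm.dP_γ y hy k hk) 0 hz, dx_const]
  have h1 : ∀ c, du (du (fun z => (X z).2 k) 0) c z = 0 := fun c => by
    rw [du_congr hU (fun y hy => hm.dP_γ y hy k hk) c hz, du_const]
  obtain ⟨k, rfl⟩ := Fin.exists_succ_eq.2 hk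
  have key := quadratic_vanish (V := fun b => dx (du (fun z => (X z).2 k.succ) b) 0 z)
    (S := fun b c => du (du (fun z => (X z).2 k.succ) b) c z)
    (w := dx (dx (fun z => (X z).2 k.succ) 0) 0 z + (dx (fun z => (X z).2 0) k.succ z
      + du (fun z => (X z).2 0) k.succ z) - du (du (fun z => (X z).2 k.succ) 1) 1 z) hsym
    (fun v hv => by
      have e := symmetry_momentum_equation hU h hz (mixedProduct_unitJet v) k
      have e1 : ∀ b, unitJet v b 0 = v b := fun b => by
        by_cases hb : b = 0 <;> simp [unitJet, hb, hv]
      have e2 : ∑ b, ∑ c, unitJet v b 1 * unitJet v c 1 *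
          du (du (fun z => (X z).2 k.succ) b) c z = du (du (fun z => (X z).2 k.succ) 1) 1 z := by
        simp [Fin.sum_univ_four, unitJet]
      have e3 : momentumLin (unitJet v) (fun a μ => prolong1 X a μ (z, unitJet v)) 0 k
          = dx (fun z => (X z).2 0) k.succ z + du (fun z => (X z).2 0) k.succ z := by
        rw [momentumLin_zero_eq]
        fin_cases k <;> simp [unitJet, prolong1_eq, Fin.sum_univ_four]
      rw [e3, momentum_unitJet] at e
      simp only [sub_mul, Finset.sum_sub_distrib, e1, e2, Pi.zero_apply, zero_mul,
        Finset.sum_const_zero, mul_zero] at e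
      linarith)
  refine ⟨fun b => ?_, fun b c => ?_⟩
  · by_cases hb : b = 0
    · rw [hb, h0]
    · exact key.1 b hb
  · by_cases hb : b = 0
    · rw [hb, h1]
    · by_cases hc : c = 0
      · rw [hc, hsym, h1]
      · exact key.2 b hb c hc

/-- The change of the momentum equation under the first-order part of the prolongation. -/
theorem momentumLin_prolong1 {U : Set Z} {X : Z → Z} (hm : MixedProductDetermining U X)
    (hw : WaveDetermining U X) {z : Z} (hz : z ∈ U) {p : D1} (hp : mixedProduct p = 1)
    (k : Fin 3) :
    momentumLin p (fun a μ => prolong1 X a μ (z, p)) 0 k =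
      momentumLin p (fun a μ => if a = 0 then dx (fun z => (X z).2 0) μ z else 0) 0 k
        + du (fun z => (X z).2 0) k.succ z + du (fun z => (X z).2 0) 0 z * momentum p 0 k
        - ∑ l : Fin 3, momentum p 0 l * du (fun z => (X z).2 l.succ) k.succ z := by
  have h1 := hm.du_x z hz
  have h2 := hm.dx_t z hz
  have h3 := hm.dx_γ z hz
  have h4 := hm.dP_γ z hz
  have h5 := hm.trace z hz
  have h6 := hw.dt_ξ z hz
  have h7 := hw.d1_ξ2 z hz
  have h8 := hw.d1_ξ3 z hz
  rw [mixedProduct_eq] at hp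
  simp only [momentumLin_zero_eq, momentum_zero_eq, prolong1_eq, Fin.sum_univ_four, h1,
    h2 _ Fin.zero_ne_one.symm,
    h2 2 (by decide), h2 3 (by decide), h3 1 (by decide) 1 (by decide), h3 1 (by decide) 2 (by decide),
    h3 1 (by decide) 3 (by decide), h3 2 (by decide) 1 (by decide), h3 2 (by decide) 2 (by decide),
    h3 2 (by decide) 3 (by decide), h3 3 (by decide) 1 (by decide), h3 3 (by decide) 2 (by decide),
    h3 3 (by decide) 3 (by decide), h4 1 (by decide), h4 2 (by decide), h4 3 (by decide), h7, h8]
  have e : du (fun z => (X z).2 1) 1 z = dx (fun z => (X z).1 1) 1 z + dx (fun z => (X z).1 2) 2 z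
    + dx (fun z => (X z).1 3) 3 z - du (fun z => (X z).2 2) 2 z - du (fun z => (X z).2 3) 3 z := by
    linarith
  fin_cases k <;> simp [Fin.sum_univ_three] <;> rw [e]
  -- Contracting the gradients of `γ` with their cofactors reproduces the mixed product, here 1, by
  -- Cramer's rule.
  · linear_combination (du (fun z => (X z).2 0) 1 z) * hp
  · linear_combination (du (fun z => (X z).2 0) 2 z) * hp
  · linear_combination (du (fun z => (X z).2 0) 3 z) * hp

/-- First-order jet coordinates with diagonal `∂γ/∂ξ`. -/
def diagJet (π d : Fin 4 → ℝ) : D1 := fun a μ => if a = 0 then π μ else if a = μ then d a else 0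

/-- A diagonal sign matrix of determinant 1 equals its own cofactor matrix, so at these jets the
pressure force has components `π_l d_l` and the identity becomes affine in `π`. -/
theorem momentumDetermining_of_symmetry {U : Set Z} (hU : IsOpen U) {X : Z → Z}
    (h : IsInfinitesimalSymmetryOn U X) : MomentumDetermining U X := by
  have hm := mixedProductDetermining_of_symmetry h
  have hw := waveDetermining_of_symmetry hU h
  have key : ∀ z ∈ U, ∀ π d : Fin 4 → ℝ, (∀ a, d a * d a = 1) → d 1 * d 2 * d 3 = 1 → ∀ k : Fin 3,
      dx (dx (fun z => (X z).2 k.succ) 0) 0 z + du (fun z => (X z).2 0) k.succ z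
        + dx (fun z => (X z).2 0) k.succ z * d k.succ
        - ∑ l : Fin 3, π l.succ * d l.succ * (du (fun z => (X z).2 k.succ) l.succ z
          + du (fun z => (X z).2 l.succ) k.succ z)
        + (2 * dx (fun z => (X z).1 0) 0 z + du (fun z => (X z).2 0) 0 z)
          * (π k.succ * d k.succ) = 0 := by
    intro z hz π d hd hd1 k
    have hp : mixedProduct (diagJet π d) = 1 := by
      simp [mixedProduct_eq, diagJet]
      linarith
    have hc : d 2 * d 3 = d 1 ∧ d 3 * d 1 = d 2 ∧ d 1 * d 2 = d 3 := by
      refine ⟨?_, ?_, ?_⟩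
      · linear_combination d 1 * hd1 - d 2 * d 3 * hd 1
      · linear_combination d 2 * hd1 - d 1 * d 3 * hd 2
      · linear_combination d 3 * hd1 - d 1 * d 2 * hd 3
    have hmom : ∀ l : Fin 3, momentum (diagJet π d) 0 l = π l.succ * d l.succ := by
      intro l
      fin_cases l <;> simp [momentum_zero_eq, diagJet, hc.1, hc.2.1, hc.2.2]
    have e := symmetry_momentum_equation hU h hz hp k
    obtain ⟨q1, q2⟩ := symmetry_quadratic hU h hz (Fin.succ_ne_zero k)
    have e2 : momentumLin (diagJet π d)
        (fun a μ => if a = 0 then dx (fun z => (X z).2 0) μ z else 0) 0 k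
        = dx (fun z => (X z).2 0) k.succ z * d k.succ := by
      rw [momentumLin_zero_eq]
      fin_cases k <;> simp [diagJet, hc.1, hc.2.1, hc.2.2]
    rw [momentumLin_prolong1 hm hw hz hp, e2] at e
    simp only [q1, q2, hmom, mul_zero, Finset.sum_const_zero] at e
    simp only [mul_add, Finset.sum_add_distrib]
    linear_combination e
  have kf : ∀ z ∈ U, ∀ k : Fin 3, dx (fun z => (X z).2 0) k.succ z = 0 ∧
      dx (dx (fun z => (X z).2 k.succ) 0) 0 z + du (fun z => (X z).2 0) k.succ z = 0 := by
    intro z hz k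
    have e1 := key z hz 0 1 (by simp) (by simp) k
    -- Reversing the sign of the `k`-th diagonal entry at zero pressure gradient changes only the
    -- sign of the term with `∂_{ξ^k}` of the pressure component. Both this term and the remainder
    -- therefore vanish.
    have e2 : ∃ d : Fin 4 → ℝ, (∀ a, d a * d a = 1) ∧ d 1 * d 2 * d 3 = 1 ∧ d k.succ = -1 := by
      fin_cases k
      · exact ⟨![1, -1, -1, 1], by intro a; fin_cases a <;> simp, by simp, by simp⟩
      · exact ⟨![1, -1, -1, 1], by intro a; fin_cases a <;> simp, by simp, by simp⟩
      · exact ⟨![1, -1, 1, -1], by intro a; fin_cases a <;> simp, by simp, by simp⟩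
    obtain ⟨d, d1, d2, d3⟩ := e2
    have e3 := key z hz 0 d d1 d2 k
    rw [d3] at e3
    simp at e1 e3
    constructor <;> linarith
  refine ⟨fun z hz k hk => (symmetry_quadratic hU h hz hk).2,
    fun z hz k hk => (symmetry_quadratic hU h hz hk).1, fun z hz i hi => ?_, fun z hz k hk => ?_,
    fun z hz k hk l hl => ?_⟩
  · obtain ⟨i, rfl⟩ := Fin.exists_succ_eq.2 hi
    exact (kf z hz i).1
  · obtain ⟨k, rfl⟩ := Fin.exists_succ_eq.2 hk
    linarith [(kf z hz k).2]
  · obtain ⟨k, rfl⟩ := Fin.exists_succ_eq.2 hk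
    obtain ⟨l, rfl⟩ := Fin.exists_succ_eq.2 hl
    have e := key z hz (Pi.single l.succ 1) 1 (by simp) (by simp) k
    simp [(kf z hz k).1, (kf z hz k).2, Pi.single_apply] at e
    by_cases hkl : k = l
    · simp [hkl] at e ⊢
      linarith
    · simp [hkl] at e ⊢
      linarith

/-- With `m = momentum p 0`, the second-order part contributes `-∑ m_l ∂X^k/∂γ^l` and the pressure
force contributes `-∑ m_l ∂X^l/∂γ^k`. Together they contain the symmetrized Jacobian, which the
conformal equation replaces by a multiple of `m_k` that cancels the scaling terms. -/
theorem isInfinitesimalSymmetryOn_of_determining {U : Set Z} (hU : IsOpen U) {X : Z → Z}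
    (hX : ContDiffOn ℝ ∞ X U) (hm : MixedProductDetermining U X) (hw : WaveDetermining U X)
    (h : MomentumDetermining U X) : IsInfinitesimalSymmetryOn U X := by
  refine isInfinitesimalSymmetryOn_iff.2 ⟨hX, fun z hz p q hq h1 hp _ =>
    ⟨?_, hm.mixedProductLin_prolong1 hz hp⟩⟩
  ext k
  have hk := Fin.succ_ne_zero k
  have hqm : ∀ l : Fin 3, q l.succ 0 0 - q l.succ 1 1 = -momentum p 0 l := fun l => by
    rw [momentum_sub_zero] at h1
    have := congrFun h1 l
    simp at this
    linarith
  have e0 : momentumLin p (fun a μ => if a = 0 then dx (fun z => (X z).2 0) μ z else 0) 0 k = 0 := by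
    rw [momentumLin_zero_eq]
    fin_cases k <;> simp [h.dx_P z hz 1 (by decide), h.dx_P z hz 2 (by decide),
      h.dx_P z hz 3 (by decide)]
  have e1 : ∑ l : Fin 3, momentum p 0 l * (du (fun z => (X z).2 k.succ) l.succ z
      + du (fun z => (X z).2 l.succ) k.succ z) = momentum p 0 k *
        (2 * dx (fun z => (X z).1 0) 0 z + du (fun z => (X z).2 0) 0 z) := by
    simp [h.conformal z hz k.succ hk _ (Fin.succ_ne_zero _), mul_ite]
  rw [momentumLin_apply, prolong2_sub_of_waveDetermining hU hX hm hw hz p hq hk,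
    momentumLin_prolong1 hm hw hz hp, e0, Fin.sum_univ_succ (f := fun b => (q b 0 0 - q b 1 1) * _)]
  simp only [h.dt_dγ z hz k.succ hk, h.dγ_dγ z hz k.succ hk, hqm, hm.dP_γ z hz k.succ hk,
    h.dγ_P z hz k.succ hk, mul_zero, Finset.sum_const_zero, Pi.zero_apply]
  simp only [mul_add, Finset.sum_add_distrib] at e1
  simp only [neg_mul, Finset.sum_neg_distrib]
  linear_combination -e1

theorem isInfinitesimalSymmetryOn_iff_determining {U : Set Z} (hU : IsOpen U) {X : Z → Z} :
    IsInfinitesimalSymmetryOn U X ↔ ContDiffOn ℝ ∞ X U ∧ MixedProductDetermining U X ∧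
      WaveDetermining U X ∧ MomentumDetermining U X :=
  ⟨fun h => ⟨h.1, mixedProductDetermining_of_symmetry h, waveDetermining_of_symmetry hU h,
    momentumDetermining_of_symmetry hU h⟩,
    fun h => isInfinitesimalSymmetryOn_of_determining hU h.1 h.2.1 h.2.2.1 h.2.2.2⟩

/-! ### Normal form of the infinitesimal symmetries -/

/-- The coordinate `x^μ` as a continuous linear map. -/
noncomputable def cx (μ : Fin 4) : Z →L[ℝ] ℝ :=
  (ContinuousLinearMap.proj (R := ℝ) (φ := fun _ : Fin 4 => ℝ) μ).comp
    (ContinuousLinearMap.fst ℝ Indep Dep)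

/-- The coordinate `u^a` as a continuous linear map. -/
noncomputable def cu (a : Fin 4) : Z →L[ℝ] ℝ :=
  (ContinuousLinearMap.proj (R := ℝ) (φ := fun _ : Fin 4 => ℝ) a).comp
    (ContinuousLinearMap.snd ℝ Indep Dep)

/-- The projection to the `(ξ², ξ³)`-plane. -/
noncomputable def projY : Z →L[ℝ] ℝ × ℝ := (cx 2).prod (cx 3)

@[simp] theorem cx_apply (μ : Fin 4) (z : Z) : cx μ z = z.1 μ := rfl
@[simp] theorem cu_apply (a : Fin 4) (z : Z) : cu a z = z.2 a := rfl
@[simp] theorem projY_apply (z : Z) : projY z = (z.1 2, z.1 3) := rfl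

theorem dx_eq_of_hasFDerivAt {f : Z → ℝ} {L : Z →L[ℝ] ℝ} {z : Z} (h : HasFDerivAt f L z)
    (μ : Fin 4) : dx f μ z = L (ex μ) := by rw [dx, h.fderiv]

theorem du_eq_of_hasFDerivAt {f : Z → ℝ} {L : Z →L[ℝ] ℝ} {z : Z} (h : HasFDerivAt f L z)
    (a : Fin 4) : du f a z = L (eu a) := by rw [du, h.fderiv]

/-- Normal form of the infinitesimal symmetries on an open set. -/
structure NormalForm (U : Set Z) (X : Z → Z) (c s₁ s₂ : ℝ) (M : Fin 3 → Fin 3 → ℝ)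
    (α : Fin 3 → ℝ → ℝ) (β : ℝ → ℝ) (a b d : ℝ × ℝ → ℝ) : Prop where
  conformal : ∀ k l, M k l + M l k = if k = l then 2 * (s₁ + 2 * s₂) else 0
  smooth_α : ∀ k, ContDiffOn ℝ ∞ (α k) (timeProj U)
  smooth_β : ContDiffOn ℝ ∞ β (timeProj U)
  smooth_a : ContDiffOn ℝ ∞ a (planeProj U)
  smooth_b : ContDiffOn ℝ ∞ b (planeProj U)
  smooth_d : ContDiffOn ℝ ∞ d (planeProj U)
  div : ∀ y ∈ planeProj U, fderiv ℝ b y (1, 0) + fderiv ℝ d y (0, 1) = 0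
  x0 : ∀ z ∈ U, (X z).1 0 = c + s₁ * z.1 0
  x1 : ∀ z ∈ U, (X z).1 1 = s₁ * z.1 1 + a (z.1 2, z.1 3)
  x2 : ∀ z ∈ U, (X z).1 2 = (s₁ + 3 * s₂) * z.1 2 + b (z.1 2, z.1 3)
  x3 : ∀ z ∈ U, (X z).1 3 = (s₁ + 3 * s₂) * z.1 3 + d (z.1 2, z.1 3)
  u0 : ∀ z ∈ U, (X z).2 0 = 4 * s₂ * z.2 0
    - ∑ k : Fin 3, z.2 k.succ * iteratedDeriv 2 (α k) (z.1 0) + β (z.1 0)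
  uγ : ∀ z ∈ U, ∀ k : Fin 3, (X z).2 k.succ = ∑ l : Fin 3, M k l * z.2 l.succ + α k (z.1 0)

theorem isOpen_timeProj {U : Set Z} (hU : IsOpen U) : IsOpen (timeProj U) := by
  have h : Function.Surjective (cx 0) := fun t => ⟨t • ex 0, by simp [ex]⟩
  exact (cx 0).isOpenMap h U hU

theorem isOpen_planeProj {U : Set Z} (hU : IsOpen U) : IsOpen (planeProj U) := by
  have h : Function.Surjective projY := fun t => ⟨t.1 • ex 2 + t.2 • ex 3, by simp [ex]⟩
  exact projY.isOpenMap h U hU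

theorem mem_timeProj {U : Set Z} {z : Z} (hz : z ∈ U) : z.1 0 ∈ timeProj U := ⟨z, hz, rfl⟩

theorem mem_planeProj {U : Set Z} {z : Z} (hz : z ∈ U) : (z.1 2, z.1 3) ∈ planeProj U :=
  ⟨z, hz, rfl⟩

theorem contDiffOn_iteratedDeriv {V : Set ℝ} (hV : IsOpen V) {f : ℝ → ℝ} (hf : ContDiffOn ℝ ∞ f V)
    (n : ℕ) : ContDiffOn ℝ ∞ (iteratedDeriv n f) V := by
  induction n with
  | zero => simpa using hf
  | succ n ih =>
    rw [iteratedDeriv_succ]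
    exact ih.deriv_of_isOpen hV (by simp)

theorem hasFDerivAt_time {U : Set Z} (hU : IsOpen U) {f : ℝ → ℝ} (hf : ContDiffOn ℝ ∞ f (timeProj U))
    {z : Z} (hz : z ∈ U) : HasFDerivAt (fun z : Z => f (z.1 0)) (deriv f (z.1 0) • cx 0) z := by
  have h1 := (differentiableAt_of_contDiffOn (isOpen_timeProj hU) hf (mem_timeProj hz)).hasDerivAt
  exact h1.comp_hasFDerivAt z (cx 0).hasFDerivAt

theorem hasFDerivAt_plane {U : Set Z} (hU : IsOpen U) {f : ℝ × ℝ → ℝ}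
    (hf : ContDiffOn ℝ ∞ f (planeProj U)) {z : Z} (hz : z ∈ U) :
    HasFDerivAt (fun z : Z => f (z.1 2, z.1 3)) ((fderiv ℝ f (z.1 2, z.1 3)).comp projY) z := by
  have h1 := (differentiableAt_of_contDiffOn (isOpen_planeProj hU) hf (mem_planeProj hz)).hasFDerivAt
  exact h1.comp z projY.hasFDerivAt

theorem hasFDerivAt_congr_on {U : Set Z} (hU : IsOpen U) {f g : Z → ℝ} {z : Z} {L : Z →L[ℝ] ℝ}
    (hz : z ∈ U) (hfg : ∀ z ∈ U, f z = g z) (h : HasFDerivAt g L z) : HasFDerivAt f L z :=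
  h.congr_of_eventuallyEq (Filter.eventuallyEq_of_mem (hU.mem_nhds hz) hfg)

namespace NormalForm

variable {U : Set Z} {X : Z → Z} {c s₁ s₂ : ℝ} {M : Fin 3 → Fin 3 → ℝ}
    {α : Fin 3 → ℝ → ℝ} {β : ℝ → ℝ} {a b d : ℝ × ℝ → ℝ}

theorem hasFDerivAt_x0 (hU : IsOpen U) (h : NormalForm U X c s₁ s₂ M α β a b d) {z : Z} (hz : z ∈ U) :
    HasFDerivAt (fun z => (X z).1 0) (s₁ • cx 0) z :=
  hasFDerivAt_congr_on hU hz h.x0 (((cx 0).hasFDerivAt.const_mul s₁).const_add c)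

theorem hasFDerivAt_x1 (hU : IsOpen U) (h : NormalForm U X c s₁ s₂ M α β a b d) {z : Z} (hz : z ∈ U) :
    HasFDerivAt (fun z => (X z).1 1) (s₁ • cx 1 + (fderiv ℝ a (z.1 2, z.1 3)).comp projY) z :=
  hasFDerivAt_congr_on hU hz h.x1
    (((cx 1).hasFDerivAt.const_mul s₁).add (hasFDerivAt_plane hU h.smooth_a hz))

theorem hasFDerivAt_x2 (hU : IsOpen U) (h : NormalForm U X c s₁ s₂ M α β a b d) {z : Z} (hz : z ∈ U) :
    HasFDerivAt (fun z => (X z).1 2)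
      ((s₁ + 3 * s₂) • cx 2 + (fderiv ℝ b (z.1 2, z.1 3)).comp projY) z :=
  hasFDerivAt_congr_on hU hz h.x2
    (((cx 2).hasFDerivAt.const_mul _).add (hasFDerivAt_plane hU h.smooth_b hz))

theorem hasFDerivAt_x3 (hU : IsOpen U) (h : NormalForm U X c s₁ s₂ M α β a b d) {z : Z} (hz : z ∈ U) :
    HasFDerivAt (fun z => (X z).1 3)
      ((s₁ + 3 * s₂) • cx 3 + (fderiv ℝ d (z.1 2, z.1 3)).comp projY) z :=
  hasFDerivAt_congr_on hU hz h.x3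
    (((cx 3).hasFDerivAt.const_mul _).add (hasFDerivAt_plane hU h.smooth_d hz))

theorem hasFDerivAt_uγ (hU : IsOpen U) (h : NormalForm U X c s₁ s₂ M α β a b d) {z : Z} (hz : z ∈ U)
    (k : Fin 3) : HasFDerivAt (fun z => (X z).2 k.succ)
      (∑ l : Fin 3, M k l • cu l.succ + deriv (α k) (z.1 0) • cx 0) z :=
  hasFDerivAt_congr_on hU hz (fun z hz => h.uγ z hz k)
    ((HasFDerivAt.fun_sum fun l _ => (cu (Fin.succ l)).hasFDerivAt.const_mul (M k l)).add
      (hasFDerivAt_time hU (h.smooth_α k) hz))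

theorem hasFDerivAt_u0 (hU : IsOpen U) (h : NormalForm U X c s₁ s₂ M α β a b d) {z : Z} (hz : z ∈ U) :
    HasFDerivAt (fun z => (X z).2 0)
      ((4 * s₂) • cu 0 - ∑ k : Fin 3, (z.2 k.succ • (deriv (iteratedDeriv 2 (α k)) (z.1 0) • cx 0)
        + iteratedDeriv 2 (α k) (z.1 0) • cu k.succ) + deriv β (z.1 0) • cx 0) z :=
  hasFDerivAt_congr_on hU hz h.u0
    ((((cu 0).hasFDerivAt.const_mul (4 * s₂)).sub (HasFDerivAt.fun_sum fun k _ =>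
      (cu (Fin.succ k)).hasFDerivAt.mul (hasFDerivAt_time hU
        (contDiffOn_iteratedDeriv (isOpen_timeProj hU) (h.smooth_α k) 2) hz))).add
      (hasFDerivAt_time hU h.smooth_β hz))

theorem dx_uγ_zero (hU : IsOpen U) (h : NormalForm U X c s₁ s₂ M α β a b d) {z : Z} (hz : z ∈ U)
    (k : Fin 3) : dx (fun z => (X z).2 k.succ) 0 z = deriv (α k) (z.1 0) := by
  rw [dx_eq_of_hasFDerivAt (h.hasFDerivAt_uγ hU hz k)]
  simp [ex]

theorem du_uγ (hU : IsOpen U) (h : NormalForm U X c s₁ s₂ M α β a b d) {z : Z} (hz : z ∈ U)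
    (k l : Fin 3) : du (fun z => (X z).2 k.succ) l.succ z = M k l := by
  rw [du_eq_of_hasFDerivAt (h.hasFDerivAt_uγ hU hz k)]
  simp [eu, Pi.single_apply]

theorem contDiffOn (h : NormalForm U X c s₁ s₂ M α β a b d) (hU : IsOpen U) :
    ContDiffOn ℝ ∞ X U := by
  have ht : ∀ f : ℝ → ℝ, ContDiffOn ℝ ∞ f (timeProj U) →
      ContDiffOn ℝ ∞ (fun z : Z => f (z.1 0)) U := fun f hf =>
    hf.comp (cx 0).contDiff.contDiffOn fun z hz => mem_timeProj hz
  have hy : ∀ f : ℝ × ℝ → ℝ, ContDiffOn ℝ ∞ f (planeProj U) →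
      ContDiffOn ℝ ∞ (fun z : Z => f (z.1 2, z.1 3)) U := fun f hf =>
    hf.comp projY.contDiff.contDiffOn fun z hz => mem_planeProj hz
  have c1 : ∀ μ, ContDiffOn ℝ ∞ (fun z : Z => z.1 μ) U := fun μ => (cx μ).contDiff.contDiffOn
  have c2 : ∀ μ, ContDiffOn ℝ ∞ (fun z : Z => z.2 μ) U := fun μ => (cu μ).contDiff.contDiffOn
  have e1 : ContDiffOn ℝ ∞ (fun z => (X z).1) U := by
    rw [contDiffOn_pi]
    intro i
    have hi : i = 0 ∨ i = 1 ∨ i = 2 ∨ i = 3 := by fin_cases i <;> simp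
    rcases hi with rfl | rfl | rfl | rfl
    · exact (contDiffOn_const.add (contDiffOn_const.mul (c1 0))).congr h.x0
    · exact ((contDiffOn_const.mul (c1 1)).add (hy _ h.smooth_a)).congr h.x1
    · exact ((contDiffOn_const.mul (c1 2)).add (hy _ h.smooth_b)).congr h.x2
    · exact ((contDiffOn_const.mul (c1 3)).add (hy _ h.smooth_d)).congr h.x3
  have e2 : ContDiffOn ℝ ∞ (fun z => (X z).2) U := by
    rw [contDiffOn_pi]
    intro i
    rcases Fin.eq_zero_or_eq_succ i with rfl | ⟨k, rfl⟩
    · exact (((contDiffOn_const.mul (c2 0)).sub (ContDiffOn.sum fun k _ => (c2 _).mul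
        (ht _ (contDiffOn_iteratedDeriv (isOpen_timeProj hU) (h.smooth_α k) 2)))).add
        (ht _ h.smooth_β)).congr h.u0
    · exact ((ContDiffOn.sum fun l _ => contDiffOn_const.mul (c2 _)).add
        (ht _ (h.smooth_α k))).congr fun z hz => h.uγ z hz k
  exact e1.prodMk e2

theorem isInfinitesimalSymmetryOn (h : NormalForm U X c s₁ s₂ M α β a b d) (hU : IsOpen U) :
    IsInfinitesimalSymmetryOn U X := by
  refine isInfinitesimalSymmetryOn_of_determining hU (h.contDiffOn hU) ?_ ?_ ?_
  · refine ⟨fun z hz ν a => ?_, fun z hz i hi => ?_, fun z hz k hk i hi => ?_, fun z hz k hk => ?_,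
      fun z hz => ?_⟩
    · have hi : ν = 0 ∨ ν = 1 ∨ ν = 2 ∨ ν = 3 := by fin_cases ν <;> simp
      rcases hi with rfl | rfl | rfl | rfl
      · simp [du_eq_of_hasFDerivAt (h.hasFDerivAt_x0 hU hz), eu]
      · simp [du_eq_of_hasFDerivAt (h.hasFDerivAt_x1 hU hz), eu, Prod.mk_zero_zero]
      · simp [du_eq_of_hasFDerivAt (h.hasFDerivAt_x2 hU hz), eu, Prod.mk_zero_zero]
      · simp [du_eq_of_hasFDerivAt (h.hasFDerivAt_x3 hU hz), eu, Prod.mk_zero_zero]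
    · simp [dx_eq_of_hasFDerivAt (h.hasFDerivAt_x0 hU hz), ex, hi]
    · obtain ⟨k, rfl⟩ := Fin.exists_succ_eq.2 hk
      simp [dx_eq_of_hasFDerivAt (h.hasFDerivAt_uγ hU hz k), ex, hi]
    · obtain ⟨k, rfl⟩ := Fin.exists_succ_eq.2 hk
      simp [du_eq_of_hasFDerivAt (h.hasFDerivAt_uγ hU hz k), eu]
    · have e1 := h.du_uγ hU hz 0 0
      have e2 := h.du_uγ hU hz 1 1
      have e3 := h.du_uγ hU hz 2 2
      have m := fun k => h.conformal k k
      have hd := h.div _ (mem_planeProj hz)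
      simp at m
      change du (fun z => (X z).2 1) 1 z = _ at e1
      change du (fun z => (X z).2 2) 2 z = _ at e2
      change du (fun z => (X z).2 3) 3 z = _ at e3
      rw [e1, e2, e3, dx_eq_of_hasFDerivAt (h.hasFDerivAt_x1 hU hz),
        dx_eq_of_hasFDerivAt (h.hasFDerivAt_x2 hU hz), dx_eq_of_hasFDerivAt (h.hasFDerivAt_x3 hU hz)]
      have p1 : projY (ex 1) = 0 := by simp [ex]
      have p2 : projY (ex 2) = (1, 0) := by simp [ex]
      have p3 : projY (ex 3) = (0, 1) := by simp [ex]
      have p4 : ∀ μ, cx μ (ex μ) = 1 := fun μ => by simp [ex]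
      simp only [add_apply, smul_apply, ContinuousLinearMap.comp_apply, p1, p2, p3, p4, map_zero,
        smul_eq_mul]
      linarith [m 0, m 1, m 2]
  · refine ⟨fun z hz i hi => ?_, fun z hz => ?_, fun z hz => ?_, fun z hz => ?_⟩
    · have hi' : i = 1 ∨ i = 2 ∨ i = 3 := by fin_cases i <;> simp_all
      rcases hi' with rfl | rfl | rfl
      · simp [dx_eq_of_hasFDerivAt (h.hasFDerivAt_x1 hU hz), ex, Prod.mk_zero_zero]
      · simp [dx_eq_of_hasFDerivAt (h.hasFDerivAt_x2 hU hz), ex, Prod.mk_zero_zero]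
      · simp [dx_eq_of_hasFDerivAt (h.hasFDerivAt_x3 hU hz), ex, Prod.mk_zero_zero]
    · simp [dx_eq_of_hasFDerivAt (h.hasFDerivAt_x0 hU hz),
        dx_eq_of_hasFDerivAt (h.hasFDerivAt_x1 hU hz), ex, Prod.mk_zero_zero]
    · simp [dx_eq_of_hasFDerivAt (h.hasFDerivAt_x2 hU hz), ex, Prod.mk_zero_zero]
    · simp [dx_eq_of_hasFDerivAt (h.hasFDerivAt_x3 hU hz), ex, Prod.mk_zero_zero]
  · have hdu : ∀ z ∈ U, ∀ k : Fin 3, ∀ b, du (fun z => (X z).2 k.succ) b z =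
        (Fin.cons 0 (M k) : Fin 4 → ℝ) b := fun z hz k b => by
      rcases Fin.eq_zero_or_eq_succ b with rfl | ⟨l, rfl⟩
      · simp [du_eq_of_hasFDerivAt (h.hasFDerivAt_uγ hU hz k), eu]
      · simp [h.du_uγ hU hz k l]
    refine ⟨fun z hz k hk b c => ?_, fun z hz k hk b => ?_, fun z hz i hi => ?_,
      fun z hz k hk => ?_, fun z hz k hk l hl => ?_⟩
    · obtain ⟨k, rfl⟩ := Fin.exists_succ_eq.2 hk
      rw [du_congr hU (fun y hy => hdu y hy k b) c hz, du_const]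
    · obtain ⟨k, rfl⟩ := Fin.exists_succ_eq.2 hk
      rw [dx_congr hU (fun y hy => hdu y hy k b) 0 hz, dx_const]
    · rw [dx_eq_of_hasFDerivAt (h.hasFDerivAt_u0 hU hz)]
      simp [ex, hi]
    · obtain ⟨k, rfl⟩ := Fin.exists_succ_eq.2 hk
      rw [dx_congr hU (fun y hy => h.dx_uγ_zero hU hy k) 0 hz,
        dx_eq_of_hasFDerivAt (hasFDerivAt_time hU
          ((h.smooth_α k).deriv_of_isOpen (isOpen_timeProj hU) (by simp)) hz),
        du_eq_of_hasFDerivAt (h.hasFDerivAt_u0 hU hz)]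
      simp [ex, eu, Pi.single_apply, iteratedDeriv_succ]
    · obtain ⟨k, rfl⟩ := Fin.exists_succ_eq.2 hk
      obtain ⟨l, rfl⟩ := Fin.exists_succ_eq.2 hl
      rw [h.du_uγ hU hz k l, h.du_uγ hU hz l k, h.conformal,
        dx_eq_of_hasFDerivAt (h.hasFDerivAt_x0 hU hz), du_eq_of_hasFDerivAt (h.hasFDerivAt_u0 hU hz)]
      simp [ex, eu]
      congr 1
      ring

end NormalForm

theorem fderiv_eq_zero_of_partials {f : Z → ℝ} {z : Z} (h1 : ∀ μ, dx f μ z = 0)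
    (h2 : ∀ a, du f a z = 0) : fderiv ℝ f z = 0 := by
  ext v <;> simp [fderiv_apply_eq_sum, h1, h2]

theorem exists_const_of_partials {U : Set Z} (hU : IsOpen U) (hc : Convex ℝ U) {f : Z → ℝ}
    (hf : ContDiffOn ℝ ∞ f U) (h1 : ∀ z ∈ U, ∀ μ, dx f μ z = 0)
    (h2 : ∀ z ∈ U, ∀ a, du f a z = 0) : ∃ c, ∀ z ∈ U, f z = c :=
  eq_of_fderiv_eq_zero hU hc (hf.differentiableOn (by simp)) fun z hz =>
    fderiv_eq_zero_of_partials (h1 z hz) (h2 z hz)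

theorem exists_time_factor {U : Set Z} (hU : IsOpen U) (hc : Convex ℝ U) {f : Z → ℝ}
    (hf : ContDiffOn ℝ ∞ f U) (h1 : ∀ z ∈ U, ∀ i ≠ 0, dx f i z = 0)
    (h2 : ∀ z ∈ U, ∀ a, du f a z = 0) :
    ∃ g : ℝ → ℝ, ContDiffOn ℝ ∞ g (timeProj U) ∧ ∀ z ∈ U, f z = g (z.1 0) := by
  refine exists_factor_of_fderiv_eq_zero hU hc hf (cx 0)
    (ContinuousLinearMap.toSpanSingleton ℝ (ex 0)) (fun b => by simp [ex]) fun z hz v hv => ?_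
  have hv' : v.1 0 = 0 := hv
  rw [fderiv_apply_eq_sum, Fin.sum_univ_succ]
  simp [hv', h2 z hz, h1 z hz _ (Fin.succ_ne_zero _)]

theorem exists_plane_factor {U : Set Z} (hU : IsOpen U) (hc : Convex ℝ U) {f : Z → ℝ}
    (hf : ContDiffOn ℝ ∞ f U) (h0 : ∀ z ∈ U, dx f 0 z = 0) (h1 : ∀ z ∈ U, dx f 1 z = 0)
    (h2 : ∀ z ∈ U, ∀ a, du f a z = 0) :
    ∃ g : ℝ × ℝ → ℝ, ContDiffOn ℝ ∞ g (planeProj U) ∧ ∀ z ∈ U, f z = g (z.1 2, z.1 3) := by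
  refine exists_factor_of_fderiv_eq_zero hU hc hf projY
    ((ContinuousLinearMap.toSpanSingleton ℝ (ex 2)).comp (ContinuousLinearMap.fst ℝ ℝ ℝ)
      + (ContinuousLinearMap.toSpanSingleton ℝ (ex 3)).comp (ContinuousLinearMap.snd ℝ ℝ ℝ))
    (fun b => by simp [ex]) fun z hz v hv => ?_
  have hv' : v.1 2 = 0 ∧ v.1 3 = 0 := by simpa using hv
  rw [fderiv_apply_eq_sum, Fin.sum_univ_four]
  simp [hv', h2 z hz, h1 z hz, h0 z hz]

theorem hasFDerivAt_of_contDiffOn {U : Set Z} (hU : IsOpen U) {f : Z → ℝ}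
    (hf : ContDiffOn ℝ ∞ f U) {z : Z} (hz : z ∈ U) : HasFDerivAt f (fderiv ℝ f z) z :=
  (differentiableAt_of_contDiffOn hU hf hz).hasFDerivAt

/-- Partial derivatives after subtracting a linear function. -/
theorem partials_sub_linear {U : Set Z} (hU : IsOpen U) {f : Z → ℝ}
    (hf : ContDiffOn ℝ ∞ f U) (L : Z →L[ℝ] ℝ) {z : Z} (hz : z ∈ U) :
    (∀ μ, dx (fun z => f z - L z) μ z = dx f μ z - L (ex μ)) ∧
      ∀ a, du (fun z => f z - L z) a z = du f a z - L (eu a) := by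
  have h := (hasFDerivAt_of_contDiffOn hU hf hz).sub L.hasFDerivAt
  exact ⟨fun μ => dx_eq_of_hasFDerivAt h μ, fun a => du_eq_of_hasFDerivAt h a⟩

/-- The derivatives `∂_t X⁰` and `∂X^k/∂γ^l` have vanishing partial derivatives, hence are constant
on the convex set. After subtraction of the linear parts, each component depends on `t` alone or on
`(ξ², ξ³)` alone, or is constant, and descends to a smooth function of these variables. -/
theorem exists_normalForm {U : Set Z} (hU : IsOpen U) (hc : Convex ℝ U) {X : Z → Z}
    (h : IsInfinitesimalSymmetryOn U X) :
    ∃ c s₁ s₂ M α β a b d, NormalForm U X c s₁ s₂ M α β a b d := by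
  rcases U.eq_empty_or_nonempty with rfl | ⟨z₀, hz₀⟩
  · refine ⟨0, 0, 0, 0, 0, 0, 0, 0, 0, ?_⟩
    constructor <;> simp [timeProj, planeProj]
  obtain ⟨hX, hm, hw, hp⟩ := (isInfinitesimalSymmetryOn_iff_determining hU).1 h
  have f1 := fun κ => contDiffOn_comp1 hX κ
  have f2 := fun κ => contDiffOn_comp2 hX κ
  obtain ⟨s₁, hs₁⟩ := exists_const_of_partials hU hc (contDiffOn_dx hU (f1 0) 0)
    (fun z hz μ => by
      by_cases hμ : μ = 0
      · subst hμ
        rw [← dx_congr hU (fun y hy => hw.d1_ξ1 y hy) 0 hz, dx_dx_comm hU (f1 1) hz,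
          dx_congr hU (fun y hy => hw.dt_ξ y hy 1 (by decide)) 1 hz, dx_const]
      · rw [dx_dx_comm hU (f1 0) hz, dx_congr hU (fun y hy => hm.dx_t y hy μ hμ) 0 hz, dx_const])
    (fun z hz a => by
      rw [← dx_du_comm hU (f1 0) hz, dx_congr hU (fun y hy => hm.du_x y hy 0 a) 0 hz, dx_const])
  have hM : ∀ k l : Fin 3, ∃ m, ∀ z ∈ U, du (fun z => (X z).2 k.succ) l.succ z = m := fun k l =>
    exists_const_of_partials hU hc (contDiffOn_du hU (f2 k.succ) l.succ)
      (fun z hz μ => by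
        by_cases hμ : μ = 0
        · rw [hμ, hp.dt_dγ z hz k.succ (Fin.succ_ne_zero k)]
        · rw [dx_du_comm hU (f2 k.succ) hz,
            du_congr hU (fun y hy => hm.dx_γ y hy k.succ (Fin.succ_ne_zero k) μ hμ) _ hz, du_const])
      (fun z hz a => hp.dγ_dγ z hz k.succ (Fin.succ_ne_zero k) l.succ a)
  choose M hM using hM
  -- Chosen so that the diagonal entries of `M` are `s₁ + 2 s₂`; the conformal equation then gives
  -- `∂X^P/∂P = 4 s₂`.
  set s₂ : ℝ := (M 0 0 - s₁) / 2 with hs₂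
  have hP : ∀ z ∈ U, du (fun z => (X z).2 0) 0 z = 4 * s₂ := fun z hz => by
    have e := hp.conformal z hz 1 (by decide) 1 (by decide)
    rw [if_pos rfl, hs₁ z hz] at e
    have e1 : du (fun z => (X z).2 1) 1 z = M 0 0 := hM 0 0 z hz
    rw [e1] at e
    rw [hs₂]
    linarith
  have hMc : ∀ k l, M k l + M l k = if k = l then 2 * (s₁ + 2 * s₂) else 0 := fun k l => by
    have e := hp.conformal z₀ hz₀ k.succ (Fin.succ_ne_zero k) l.succ (Fin.succ_ne_zero l)
    rw [hM k l z₀ hz₀, hM l k z₀ hz₀, hs₁ z₀ hz₀, hP z₀ hz₀] at e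
    rw [e]
    simp only [Fin.succ_inj]
    congr 1
    ring
  -- time component
  have hs := fun (f : Z → ℝ) (hf : ContDiffOn ℝ ∞ f U) (L : Z →L[ℝ] ℝ) =>
    hf.sub L.contDiff.contDiffOn
  obtain ⟨c, hcc⟩ := exists_const_of_partials hU hc (hs _ (f1 0) (s₁ • cx 0))
    (fun z hz μ => by
      rw [(partials_sub_linear hU (f1 0) (s₁ • cx 0) hz).1]
      by_cases hμ : μ = 0
      · subst hμ
        simp [hs₁ z hz, ex]
      · simp [hm.dx_t z hz μ hμ, ex, hμ])
    (fun z hz a => by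
      rw [(partials_sub_linear hU (f1 0) (s₁ • cx 0) hz).2]
      simp [hm.du_x z hz, eu])
  obtain ⟨a, ha, ha'⟩ := exists_plane_factor hU hc (hs _ (f1 1) (s₁ • cx 1))
    (fun z hz => by
      rw [(partials_sub_linear hU (f1 1) (s₁ • cx 1) hz).1]
      simp [hw.dt_ξ z hz, ex])
    (fun z hz => by
      rw [(partials_sub_linear hU (f1 1) (s₁ • cx 1) hz).1]
      simp [hw.d1_ξ1 z hz, hs₁ z hz, ex])
    (fun z hz a => by
      rw [(partials_sub_linear hU (f1 1) (s₁ • cx 1) hz).2]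
      simp [hm.du_x z hz, eu])
  -- The factor `s₁ + 3 s₂` makes the remainder `(b, d)` divergence-free: the trace of `M` is `3 (s₁
  -- + 2 s₂) = s₁ + 2 (s₁ + 3 s₂)`.
  obtain ⟨b, hb, hb'⟩ := exists_plane_factor hU hc (hs _ (f1 2) ((s₁ + 3 * s₂) • cx 2))
    (fun z hz => by
      rw [(partials_sub_linear hU (f1 2) _ hz).1]
      simp [hw.dt_ξ z hz, ex])
    (fun z hz => by
      rw [(partials_sub_linear hU (f1 2) _ hz).1]
      simp [hw.d1_ξ2 z hz, ex])
    (fun z hz a => by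
      rw [(partials_sub_linear hU (f1 2) _ hz).2]
      simp [hm.du_x z hz, eu])
  obtain ⟨d, hd, hd'⟩ := exists_plane_factor hU hc (hs _ (f1 3) ((s₁ + 3 * s₂) • cx 3))
    (fun z hz => by
      rw [(partials_sub_linear hU (f1 3) _ hz).1]
      simp [hw.dt_ξ z hz, ex])
    (fun z hz => by
      rw [(partials_sub_linear hU (f1 3) _ hz).1]
      simp [hw.d1_ξ3 z hz, ex])
    (fun z hz a => by
      rw [(partials_sub_linear hU (f1 3) _ hz).2]
      simp [hm.du_x z hz, eu])
  have hα : ∀ k : Fin 3, ∃ α : ℝ → ℝ, ContDiffOn ℝ ∞ α (timeProj U) ∧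
      ∀ z ∈ U, (X z).2 k.succ - (∑ l : Fin 3, M k l • cu l.succ : Z →L[ℝ] ℝ) z = α (z.1 0) := by
    intro k
    refine exists_time_factor hU hc (hs _ (f2 k.succ) _) (fun z hz i hi => ?_) (fun z hz a => ?_)
    · rw [(partials_sub_linear hU (f2 k.succ) _ hz).1]
      simp [hm.dx_γ z hz k.succ (Fin.succ_ne_zero k) i hi, ex]
    · rw [(partials_sub_linear hU (f2 k.succ) _ hz).2]
      rcases Fin.eq_zero_or_eq_succ a with rfl | ⟨l, rfl⟩
      · simp [hm.dP_γ z hz k.succ (Fin.succ_ne_zero k), eu]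
      · simp [hM k l z hz, eu, Pi.single_apply]
  choose α hα hα' using hα
  have hγ : ∀ z ∈ U, ∀ k : Fin 3,
      (X z).2 k.succ = ∑ l : Fin 3, M k l * z.2 l.succ + α k (z.1 0) := fun z hz k => by
    have e := hα' k z hz
    simp at e
    linarith
  have hdt : ∀ z ∈ U, ∀ k : Fin 3, dx (fun z => (X z).2 k.succ) 0 z = deriv (α k) (z.1 0) := by
    intro z hz k
    have e := hasFDerivAt_congr_on hU hz (fun z hz => hγ z hz k)
      ((HasFDerivAt.fun_sum fun l _ => (cu (Fin.succ l)).hasFDerivAt.const_mul (M k l)).add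
        (hasFDerivAt_time hU (hα k) hz))
    rw [dx_eq_of_hasFDerivAt e]
    simp [ex]
  have hdtt : ∀ z ∈ U, ∀ k : Fin 3,
      dx (dx (fun z => (X z).2 k.succ) 0) 0 z = iteratedDeriv 2 (α k) (z.1 0) := by
    intro z hz k
    rw [dx_congr hU (fun y hy => hdt y hy k) 0 hz, dx_eq_of_hasFDerivAt (hasFDerivAt_time hU
      ((hα k).deriv_of_isOpen (isOpen_timeProj hU) (by simp)) hz)]
    simp [ex, iteratedDeriv_succ]
  have hβ : ∃ β : ℝ → ℝ, ContDiffOn ℝ ∞ β (timeProj U) ∧ ∀ z ∈ U, (X z).2 0 - (4 * s₂ * z.2 0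
      - ∑ k : Fin 3, z.2 k.succ * iteratedDeriv 2 (α k) (z.1 0)) = β (z.1 0) := by
    have e : ∀ z ∈ U, HasFDerivAt (fun z => (X z).2 0 - (4 * s₂ * z.2 0
        - ∑ k : Fin 3, z.2 k.succ * iteratedDeriv 2 (α k) (z.1 0)))
        (fderiv ℝ (fun z => (X z).2 0) z - ((4 * s₂) • cu 0 - ∑ k : Fin 3,
          (z.2 k.succ • (deriv (iteratedDeriv 2 (α k)) (z.1 0) • cx 0)
          + iteratedDeriv 2 (α k) (z.1 0) • cu k.succ))) z := fun z hz =>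
      (hasFDerivAt_of_contDiffOn hU (f2 0) hz).sub
        (((cu 0).hasFDerivAt.const_mul (4 * s₂)).sub (HasFDerivAt.fun_sum fun k _ =>
        (cu (Fin.succ k)).hasFDerivAt.mul (hasFDerivAt_time hU
        (contDiffOn_iteratedDeriv (isOpen_timeProj hU) (hα k) 2) hz)))
    refine exists_time_factor hU hc ?_ (fun z hz i hi => ?_) (fun z hz a => ?_)
    · refine (f2 0).sub ((contDiffOn_const.mul (cu 0).contDiff.contDiffOn).sub
        (ContDiffOn.sum fun k _ => (cu (Fin.succ k)).contDiff.contDiffOn.mul ?_))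
      exact (contDiffOn_iteratedDeriv (isOpen_timeProj hU) (hα k) 2).comp
        (cx 0).contDiff.contDiffOn fun z hz => mem_timeProj hz
    · rw [dx_eq_of_hasFDerivAt (e z hz)]
      have := hp.dx_P z hz i hi
      rw [dx] at this
      simp [this]
      simp [ex, hi]
    · rw [du_eq_of_hasFDerivAt (e z hz)]
      rcases Fin.eq_zero_or_eq_succ a with rfl | ⟨l, rfl⟩
      · have := hP z hz
        rw [du] at this
        simp [this]
        simp [eu]
      · have := hp.dγ_P z hz l.succ (Fin.succ_ne_zero l)
        rw [du, hdtt z hz] at this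
        simp [this]
        simp [eu, Pi.single_apply]
  obtain ⟨β, hβ, hβ'⟩ := hβ
  have h2 : ∀ z ∈ U, (X z).1 2 = (s₁ + 3 * s₂) * z.1 2 + b (z.1 2, z.1 3) := fun z hz => by
    have e := hb' z hz
    simp at e
    linarith
  have h3 : ∀ z ∈ U, (X z).1 3 = (s₁ + 3 * s₂) * z.1 3 + d (z.1 2, z.1 3) := fun z hz => by
    have e := hd' z hz
    simp at e
    linarith
  refine ⟨c, s₁, s₂, M, α, β, a, b, d, hMc, hα, hβ, ha, hb, hd, ?_, fun z hz => ?_, fun z hz => ?_,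
    h2, h3, fun z hz => ?_, hγ⟩
  · rintro _ ⟨z, hz, rfl⟩
    have e2 := hasFDerivAt_congr_on hU hz h2
      (((cx 2).hasFDerivAt.const_mul _).add (hasFDerivAt_plane hU hb hz))
    have e3 := hasFDerivAt_congr_on hU hz h3
      (((cx 3).hasFDerivAt.const_mul _).add (hasFDerivAt_plane hU hd hz))
    have p2 : projY (ex 2) = (1, 0) := by simp [ex]
    have p3 : projY (ex 3) = (0, 1) := by simp [ex]
    have p4 : ∀ μ, cx μ (ex μ) = 1 := fun μ => by simp [ex]
    have e4 := hm.trace z hz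
    rw [dx_eq_of_hasFDerivAt e2, dx_eq_of_hasFDerivAt e3, hw.d1_ξ1 z hz, hs₁ z hz] at e4
    have m0 : du (fun z => (X z).2 1) 1 z = M 0 0 := hM 0 0 z hz
    have m1 : du (fun z => (X z).2 2) 2 z = M 1 1 := hM 1 1 z hz
    have m2 : du (fun z => (X z).2 3) 3 z = M 2 2 := hM 2 2 z hz
    simp only [add_apply, smul_apply, ContinuousLinearMap.comp_apply, p2, p3, p4, m0, m1, m2,
      smul_eq_mul] at e4
    have m := fun k => hMc k k
    simp only [if_true] at m
    linarith [m 0, m 1, m 2]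
  · have e := hcc z hz
    simp at e
    linarith
  · have e := ha' z hz
    simp at e
    linarith
  · linarith [hβ' z hz]

/-! ### The Lie algebra of infinitesimal symmetries -/

/-- The general linear combination of the Galilean operators. -/
noncomputable def galileanField (c : ℝ) (r : Fin 3 → ℝ) (s₁ s₂ : ℝ) (α : Fin 3 → ℝ → ℝ)
    (β : ℝ → ℝ) : Z → Z := fun z =>
  c • opT z + ∑ i, r i • opR i z + s₁ • opS1 z + s₂ • opS2 z + ∑ i, opG i (α i) z + opK β z

theorem galileanField_fst (c : ℝ) (r : Fin 3 → ℝ) (s₁ s₂ : ℝ) (α : Fin 3 → ℝ → ℝ)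
    (β : ℝ → ℝ) (z : Z) : (galileanField c r s₁ s₂ α β z).1 =
      ![c + s₁ * z.1 0, s₁ * z.1 1, (s₁ + 3 * s₂) * z.1 2, (s₁ + 3 * s₂) * z.1 3] := by
  ext i
  simp only [galileanField, Prod.fst_add, Pi.add_apply, Prod.smul_fst, Pi.smul_apply, Prod.fst_sum,
    Finset.sum_apply]
  fin_cases i <;> simp [opT, opR, opS1, opS2, opG, opK] <;> ring

theorem galileanField_snd_zero (c : ℝ) (r : Fin 3 → ℝ) (s₁ s₂ : ℝ) (α : Fin 3 → ℝ → ℝ)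
    (β : ℝ → ℝ) (z : Z) : (galileanField c r s₁ s₂ α β z).2 0 = 4 * s₂ * z.2 0
      - ∑ k : Fin 3, z.2 k.succ * iteratedDeriv 2 (α k) (z.1 0) + β (z.1 0) := by
  simp only [galileanField, Prod.snd_add, Pi.add_apply, Prod.smul_snd, Pi.smul_apply, Prod.snd_sum,
    Finset.sum_apply]
  simp [opT, opR, opS1, opS2, opG, opK]
  ring

theorem galileanField_snd_succ (c : ℝ) (r : Fin 3 → ℝ) (s₁ s₂ : ℝ) (α : Fin 3 → ℝ → ℝ)
    (β : ℝ → ℝ) (z : Z) (k : Fin 3) : (galileanField c r s₁ s₂ α β z).2 k.succ =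
      (r ⨯₃ (fun l : Fin 3 => z.2 l.succ)) k + (s₁ + 2 * s₂) * z.2 k.succ + α k (z.1 0) := by
  simp only [galileanField, Prod.snd_add, Pi.add_apply, Prod.smul_snd, Pi.smul_apply, Prod.snd_sum,
    Finset.sum_apply]
  simp only [opT, opR, opS1, opS2, opG, opK, Fin.cons_succ, Fin.sum_univ_three]
  fin_cases k <;> simp [cross_apply] <;> ring

/-- The matrix of `γ ↦ r × γ + κ γ`. -/
def crossMatrix (r : Fin 3 → ℝ) (κ : ℝ) : Fin 3 → Fin 3 → ℝ :=
  ![![κ, -r 2, r 1], ![r 2, κ, -r 0], ![-r 1, r 0, κ]]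

theorem crossMatrix_apply (r : Fin 3 → ℝ) (κ : ℝ) (v : Fin 3 → ℝ) (k : Fin 3) :
    ∑ l, crossMatrix r κ k l * v l = (r ⨯₃ v) k + κ * v k := by
  fin_cases k <;> simp [crossMatrix, cross_apply, Fin.sum_univ_three] <;> ring

/-- The antisymmetric part of a 3×3 matrix acts as a cross product, which accounts for the three
operators `R_i`. -/
theorem exists_eq_crossMatrix {M : Fin 3 → Fin 3 → ℝ} {κ : ℝ}
    (h : ∀ k l, M k l + M l k = if k = l then 2 * κ else 0) : ∃ r, M = crossMatrix r κ := by
  refine ⟨![M 2 1, M 0 2, M 1 0], ?_⟩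
  ext k l
  have h1 := h k l
  fin_cases k <;> fin_cases l <;> simp [crossMatrix] at h1 ⊢ <;> linarith

/-- Both kinds of field are normal forms, with the parameters `a, b, d` zero here and all the others
zero for reparametrizations, so decomposing a symmetry amounts to splitting the parameters of its
normal form. -/
theorem isGalileanFieldOn_iff {U : Set Z} {X : Z → Z} : IsGalileanFieldOn U X ↔
    ∃ c s₁ s₂ M α β, NormalForm U X c s₁ s₂ M α β 0 0 0 := by
  constructor
  · rintro ⟨c, r, s₁, s₂, α, β, hα, hβ, h⟩
    refine ⟨c, s₁, s₂, crossMatrix r (s₁ + 2 * s₂), α, β, ?_, hα, hβ, contDiffOn_const,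
      contDiffOn_const, contDiffOn_const, fun _ _ => by simp, fun z hz => ?_, fun z hz => ?_,
      fun z hz => ?_, fun z hz => ?_, fun z hz => ?_, fun z hz k => ?_⟩
    · intro k l
      fin_cases k <;> fin_cases l <;> simp [crossMatrix] <;> ring
    · rw [h hz]
      change (galileanField c r s₁ s₂ α β z).1 0 = _
      simp [galileanField_fst]
    · rw [h hz]
      change (galileanField c r s₁ s₂ α β z).1 1 = _
      simp [galileanField_fst]
    · rw [h hz]
      change (galileanField c r s₁ s₂ α β z).1 2 = _
      simp [galileanField_fst]
    · rw [h hz]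
      change (galileanField c r s₁ s₂ α β z).1 3 = _
      simp [galileanField_fst]
    · rw [h hz]
      exact galileanField_snd_zero c r s₁ s₂ α β z
    · rw [h hz, crossMatrix_apply r (s₁ + 2 * s₂) (fun l => z.2 l.succ)]
      exact galileanField_snd_succ c r s₁ s₂ α β z k
  · rintro ⟨c, s₁, s₂, M, α, β, h⟩
    obtain ⟨r, rfl⟩ := exists_eq_crossMatrix h.conformal
    refine ⟨c, r, s₁, s₂, α, β, h.smooth_α, h.smooth_β, fun z hz => ?_⟩
    change X z = galileanField c r s₁ s₂ α β z
    refine Prod.ext (funext fun i => ?_) (funext fun i => ?_)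
    · rw [galileanField_fst]
      have hi : i = 0 ∨ i = 1 ∨ i = 2 ∨ i = 3 := by fin_cases i <;> simp
      rcases hi with rfl | rfl | rfl | rfl
      · simp [h.x0 z hz]
      · simp [h.x1 z hz]
      · simp [h.x2 z hz]
      · simp [h.x3 z hz]
    · rcases Fin.eq_zero_or_eq_succ i with rfl | ⟨k, rfl⟩
      · rw [galileanField_snd_zero, h.u0 z hz]
      · rw [galileanField_snd_succ, h.uγ z hz, crossMatrix_apply r _ (fun l => z.2 l.succ)]

theorem isReparamFieldOn_iff {U : Set Z} {X : Z → Z} : IsReparamFieldOn U X ↔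
    ∃ a b d, NormalForm U X 0 0 0 0 0 0 a b d := by
  constructor
  · rintro ⟨a, b, d, ha, hb, hd, hdiv, h⟩
    refine ⟨a, b, d, by simp, fun _ => contDiffOn_const, contDiffOn_const, ha, hb, hd, hdiv,
      fun z hz => ?_, fun z hz => ?_, fun z hz => ?_, fun z hz => ?_, fun z hz => ?_,
      fun z hz k => ?_⟩ <;> simp [h hz]
  · rintro ⟨a, b, d, h⟩
    refine ⟨a, b, d, h.smooth_a, h.smooth_b, h.smooth_d, h.div, fun z hz => ?_⟩
    refine Prod.ext (funext fun i => ?_) (funext fun i => ?_)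
    · have hi : i = 0 ∨ i = 1 ∨ i = 2 ∨ i = 3 := by fin_cases i <;> simp
      rcases hi with rfl | rfl | rfl | rfl
      · simp [h.x0 z hz]
      · simp [h.x1 z hz]
      · simp [h.x2 z hz]
      · simp [h.x3 z hz]
    · rcases Fin.eq_zero_or_eq_succ i with rfl | ⟨k, rfl⟩
      · simp [h.u0 z hz]
      · simp [h.uγ z hz]

theorem isInfinitesimalSymmetryOn_iff_decomposition {U : Set Z} (hU : IsOpen U) (hc : Convex ℝ U)
    (X : Z → Z) : IsInfinitesimalSymmetryOn U X ↔ ∃ Y W : Z → Z,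
      IsReparamFieldOn U Y ∧ IsGalileanFieldOn U W ∧ Set.EqOn X (Y + W) U := by
  constructor
  · intro h
    obtain ⟨c, s₁, s₂, M, α, β, a, b, d, h⟩ := exists_normalForm hU hc h
    obtain ⟨r, rfl⟩ := exists_eq_crossMatrix h.conformal
    refine ⟨_, galileanField c r s₁ s₂ α β,
      ⟨a, b, d, h.smooth_a, h.smooth_b, h.smooth_d, h.div, fun z _ => rfl⟩,
      ⟨c, r, s₁, s₂, α, β, h.smooth_α, h.smooth_β, fun z _ => rfl⟩, fun z hz => ?_⟩
    refine Prod.ext (funext fun i => ?_) (funext fun i => ?_)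
    · simp only [Pi.add_apply, Prod.fst_add]
      rw [galileanField_fst]
      have hi : i = 0 ∨ i = 1 ∨ i = 2 ∨ i = 3 := by fin_cases i <;> simp
      rcases hi with rfl | rfl | rfl | rfl
      · simp [h.x0 z hz]
      · simp [h.x1 z hz, add_comm]
      · simp [h.x2 z hz, add_comm]
      · simp [h.x3 z hz, add_comm]
    · simp only [Pi.add_apply, Prod.snd_add]
      rcases Fin.eq_zero_or_eq_succ i with rfl | ⟨k, rfl⟩
      · rw [galileanField_snd_zero, h.u0 z hz]
        simp
      · rw [galileanField_snd_succ, h.uγ z hz, crossMatrix_apply r _ (fun l => z.2 l.succ)]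
        simp
  · rintro ⟨Y, W, hY, hW, h⟩
    obtain ⟨a, b, d, hY⟩ := isReparamFieldOn_iff.1 hY
    obtain ⟨c, s₁, s₂, M, α, β, hW⟩ := isGalileanFieldOn_iff.1 hW
    refine NormalForm.isInfinitesimalSymmetryOn (c := c) (s₁ := s₁) (s₂ := s₂) (M := M) (α := α)
      (β := β) (a := a) (b := b) (d := d) ⟨hW.conformal, hW.smooth_α, hW.smooth_β, hY.smooth_a,
      hY.smooth_b, hY.smooth_d, hY.div, fun z hz => ?_, fun z hz => ?_, fun z hz => ?_,
      fun z hz => ?_, fun z hz => ?_, fun z hz k => ?_⟩ hU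
    · simp [h hz, hY.x0 z hz, hW.x0 z hz]
    · simp [h hz, hY.x1 z hz, hW.x1 z hz, add_comm]
    · simp [h hz, hY.x2 z hz, hW.x2 z hz, add_comm]
    · simp [h hz, hY.x3 z hz, hW.x3 z hz, add_comm]
    · simp [h hz, hY.u0 z hz, hW.u0 z hz, iteratedDeriv_succ]
    · simp [h hz, hY.uγ z hz, hW.uγ z hz]

/-- Comparing derivatives of the two normal forms at a point gives `s₁ = 0` and `M 0 0 = 0`, hence
`s₂ = 0`. Then the Galilean form annihilates the `ξ`-components and the reparametrization form all
the others. -/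
theorem eqOn_zero_of_reparam_of_galilean {U : Set Z} (hU : IsOpen U) {X : Z → Z}
    (hY : IsReparamFieldOn U X) (hW : IsGalileanFieldOn U X) : Set.EqOn X 0 U := by
  obtain ⟨a, b, d, hY⟩ := isReparamFieldOn_iff.1 hY
  obtain ⟨c, s₁, s₂, M, α, β, hW⟩ := isGalileanFieldOn_iff.1 hW
  intro z hz
  have hs : s₁ = 0 := by
    have e1 := dx_eq_of_hasFDerivAt (hY.hasFDerivAt_x0 hU hz) 0
    have e2 := dx_eq_of_hasFDerivAt (hW.hasFDerivAt_x0 hU hz) 0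
    rw [e1] at e2
    simpa [ex] using e2.symm
  have hM : M 0 0 = 0 := (hW.du_uγ hU hz 0 0).symm.trans (hY.du_uγ hU hz 0 0)
  have hs2 : s₂ = 0 := by
    have := hW.conformal 0 0
    simp [hM, hs] at this
    exact this
  subst hs hs2
  refine Prod.ext (funext fun i => ?_) (funext fun i => ?_)
  · have hi : i = 0 ∨ i = 1 ∨ i = 2 ∨ i = 3 := by fin_cases i <;> simp
    rcases hi with rfl | rfl | rfl | rfl
    · simp [hY.x0 z hz]
    · simp [hW.x1 z hz]
    · simp [hW.x2 z hz]
    · simp [hW.x3 z hz]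
  · rcases Fin.eq_zero_or_eq_succ i with rfl | ⟨k, rfl⟩
    · simp [hY.u0 z hz]
    · simp [hY.uγ z hz]

/-! ### Lie brackets -/

theorem fderiv_comp1 {X : Z → Z} {z : Z} (h : DifferentiableAt ℝ X z) (v : Z) (μ : Fin 4) :
    (fderiv ℝ X z v).1 μ = fderiv ℝ (fun z => (X z).1 μ) z v := by
  have h1 := (cx μ).hasFDerivAt.comp z h.hasFDerivAt
  exact (congrArg (fun L => L v) h1.fderiv).symm

theorem fderiv_comp2 {X : Z → Z} {z : Z} (h : DifferentiableAt ℝ X z) (v : Z) (a : Fin 4) :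
    (fderiv ℝ X z v).2 a = fderiv ℝ (fun z => (X z).2 a) z v := by
  have h1 := (cu a).hasFDerivAt.comp z h.hasFDerivAt
  exact (congrArg (fun L => L v) h1.fderiv).symm

/-- The trace of a linear map of the plane. -/
noncomputable def planeTrace : ((ℝ × ℝ) →L[ℝ] (ℝ × ℝ)) →L[ℝ] ℝ :=
  (ContinuousLinearMap.fst ℝ ℝ ℝ).comp (ContinuousLinearMap.apply ℝ (ℝ × ℝ) ((1, 0) : ℝ × ℝ))
    + (ContinuousLinearMap.snd ℝ ℝ ℝ).comp (ContinuousLinearMap.apply ℝ (ℝ × ℝ) ((0, 1) : ℝ × ℝ))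

theorem planeTrace_apply (A : (ℝ × ℝ) →L[ℝ] (ℝ × ℝ)) :
    planeTrace A = (A (1, 0)).1 + (A (0, 1)).2 := rfl

theorem plane_map_eq (A : (ℝ × ℝ) →L[ℝ] (ℝ × ℝ)) (v : ℝ × ℝ) :
    A v = v.1 • A (1, 0) + v.2 • A (0, 1) := by
  rw [← map_smul, ← map_smul, ← map_add]
  simp

theorem planeTrace_comp_comm (A B : (ℝ × ℝ) →L[ℝ] (ℝ × ℝ)) :
    planeTrace (A.comp B) = planeTrace (B.comp A) := by
  simp only [planeTrace_apply, ContinuousLinearMap.comp_apply]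
  rw [plane_map_eq A (B _), plane_map_eq A (B (0, 1)), plane_map_eq B (A _),
    plane_map_eq B (A (0, 1))]
  simp
  ring

/-- The bracket of planar fields of constant divergence is divergence-free. -/
theorem planeTrace_lieBracket {V : Set (ℝ × ℝ)} (hV : IsOpen V) {F G : ℝ × ℝ → ℝ × ℝ}
    (hF : ContDiffOn ℝ ∞ F V) (hG : ContDiffOn ℝ ∞ G V) {f g : ℝ}
    (hf : ∀ y ∈ V, planeTrace (fderiv ℝ F y) = f) (hg : ∀ y ∈ V, planeTrace (fderiv ℝ G y) = g)
    {y : ℝ × ℝ} (hy : y ∈ V) :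
    planeTrace (fderiv ℝ (fun y => fderiv ℝ G y (F y) - fderiv ℝ F y (G y)) y) = 0 := by
  have dF := (differentiableAt_of_contDiffOn hV hF hy).hasFDerivAt
  have dG := (differentiableAt_of_contDiffOn hV hG hy).hasFDerivAt
  have dF2 := (differentiableAt_of_contDiffOn hV (hF.fderiv_of_isOpen hV (by simp)) hy).hasFDerivAt
  have dG2 := (differentiableAt_of_contDiffOn hV (hG.fderiv_of_isOpen hV (by simp)) hy).hasFDerivAt
  have sF := (hF.contDiffAt (hV.mem_nhds hy)).isSymmSndFDerivAt (by simpa using two_le_infty)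
  have sG := (hG.contDiffAt (hV.mem_nhds hy)).isSymmSndFDerivAt (by simpa using two_le_infty)
  -- Differentiating a constant divergence gives zero.
  have key : ∀ {A : ℝ × ℝ → ℝ × ℝ} {c : ℝ}, (∀ y ∈ V, planeTrace (fderiv ℝ A y) = c) →
      HasFDerivAt (fderiv ℝ A) (fderiv ℝ (fderiv ℝ A) y) y → ∀ w,
      planeTrace (fderiv ℝ (fderiv ℝ A) y w) = 0 := by
    intro A c hA h w
    have h1 := planeTrace.hasFDerivAt.comp y h
    have h2 : HasFDerivAt (planeTrace ∘ fderiv ℝ A) (0 : ℝ × ℝ →L[ℝ] ℝ) y :=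
      (hasFDerivAt_const c y).congr_of_eventuallyEq
        (Filter.eventuallyEq_of_mem (hV.mem_nhds hy) hA)
    exact congrArg (fun L => L w) (h1.unique h2)
  have e := ((dG2.clm_apply dF).sub (dF2.clm_apply dG)).fderiv
  change fderiv ℝ (fun y => fderiv ℝ G y (F y) - fderiv ℝ F y (G y)) y = _ at e
  have flipF : (fderiv ℝ (fderiv ℝ F) y).flip (G y) = fderiv ℝ (fderiv ℝ F) y (G y) := by
    refine ContinuousLinearMap.ext fun v => ?_
    exact sF v (G y)
  have flipG : (fderiv ℝ (fderiv ℝ G) y).flip (F y) = fderiv ℝ (fderiv ℝ G) y (F y) := by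
    refine ContinuousLinearMap.ext fun v => ?_
    exact sG v (F y)
  -- By symmetry of second derivatives `D[F, G] = D²G(F) - D²F(G) + DG DF - DF DG`. The first two
  -- terms have trace zero by `key`, and the commutator is traceless.
  rw [e, flipF, flipG, map_sub, map_add, map_add, key hf dF2, key hg dG2, planeTrace_comp_comm]
  ring

/-- The `(ξ², ξ³)`-part of the bracket is the planar bracket of `F`, of constant divergence `2κ`,
and the divergence-free `G`. The other variables enter only through the scaling `s₁` of `ξ¹`. -/
theorem isReparamFieldOn_lieBracket {U : Set Z} (hU : IsOpen U) (hc : Convex ℝ U) {X Y : Z → Z}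
    (hX : IsInfinitesimalSymmetryOn U X) (hY : IsReparamFieldOn U Y) :
    IsReparamFieldOn U (VectorField.lieBracket ℝ X Y) := by
  obtain ⟨c, s₁, s₂, M, α, β, a, b, d, hX⟩ := exists_normalForm hU hc hX
  obtain ⟨a', b', d', hY⟩ := isReparamFieldOn_iff.1 hY
  set κ := s₁ + 3 * s₂ with hκ
  let F : ℝ × ℝ → ℝ × ℝ := fun y => (κ * y.1 + b y, κ * y.2 + d y)
  let G : ℝ × ℝ → ℝ × ℝ := fun y => (b' y, d' y)
  have hV := isOpen_planeProj hU
  have hF : ContDiffOn ℝ ∞ F (planeProj U) :=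
    ((contDiff_const.mul contDiff_fst).contDiffOn.add hX.smooth_b).prodMk
      ((contDiff_const.mul contDiff_snd).contDiffOn.add hX.smooth_d)
  have hG : ContDiffOn ℝ ∞ G (planeProj U) := hY.smooth_b.prodMk hY.smooth_d
  have dat : ∀ {f : ℝ × ℝ → ℝ}, ContDiffOn ℝ ∞ f (planeProj U) → ∀ y ∈ planeProj U,
      HasFDerivAt f (fderiv ℝ f y) y := fun hf y hy =>
    (differentiableAt_of_contDiffOn hV hf hy).hasFDerivAt
  have eF : ∀ y ∈ planeProj U, fderiv ℝ F y =
      (κ • ContinuousLinearMap.fst ℝ ℝ ℝ + fderiv ℝ b y).prod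
        (κ • ContinuousLinearMap.snd ℝ ℝ ℝ + fderiv ℝ d y) := fun y hy =>
    (((hasFDerivAt_fst.const_mul κ).add (dat hX.smooth_b y hy)).prodMk
      ((hasFDerivAt_snd.const_mul κ).add (dat hX.smooth_d y hy))).fderiv
  have eG : ∀ y ∈ planeProj U, fderiv ℝ G y = (fderiv ℝ b' y).prod (fderiv ℝ d' y) := fun y hy =>
    ((dat hY.smooth_b y hy).prodMk (dat hY.smooth_d y hy)).fderiv
  let B : ℝ × ℝ → ℝ × ℝ := fun y => fderiv ℝ G y (F y) - fderiv ℝ F y (G y)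
  have hB : ContDiffOn ℝ ∞ B (planeProj U) :=
    ((hG.fderiv_of_isOpen hV (by simp)).clm_apply hF).sub
      ((hF.fderiv_of_isOpen hV (by simp)).clm_apply hG)
  refine ⟨fun y => fderiv ℝ a' y (F y) - s₁ * a' y - fderiv ℝ a y (G y), fun y => (B y).1,
    fun y => (B y).2, ?_, hB.fst, hB.snd, fun y hy => ?_, fun z hz => ?_⟩
  · exact (((hY.smooth_a.fderiv_of_isOpen hV (by simp)).clm_apply hF).sub
      (contDiffOn_const.mul hY.smooth_a)).sub
      ((hX.smooth_a.fderiv_of_isOpen hV (by simp)).clm_apply hG)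
  · have h1 := planeTrace_lieBracket hV hF hG (f := 2 * κ) (g := 0) (fun y hy => by
      rw [planeTrace_apply, eF y hy]
      have := hX.div y hy
      simp
      linarith) (fun y hy => by
      rw [planeTrace_apply, eG y hy]
      exact hY.div y hy) hy
    rw [planeTrace_apply] at h1
    have h2 := (differentiableAt_of_contDiffOn hV hB hy).hasFDerivAt
    rw [h2.fst.fderiv, h2.snd.fderiv]
    exact h1
  · have tX := differentiableAt_of_contDiffOn hU (hX.contDiffOn hU) hz
    have tY := differentiableAt_of_contDiffOn hU (hY.contDiffOn hU) hz
    have hy := mem_planeProj hz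
    have pX : projY (X z) = F (z.1 2, z.1 3) := by simp [F, hX.x2 z hz, hX.x3 z hz, hκ]
    have pY : projY (Y z) = G (z.1 2, z.1 3) := by simp [G, hY.x2 z hz, hY.x3 z hz]
    rw [VectorField.lieBracket]
    refine Prod.ext (funext fun i => ?_) (funext fun i => ?_)
    · simp only [Prod.fst_sub, Pi.sub_apply, fderiv_comp1 tX, fderiv_comp1 tY]
      have hi : i = 0 ∨ i = 1 ∨ i = 2 ∨ i = 3 := by fin_cases i <;> simp
      rcases hi with rfl | rfl | rfl | rfl
      · rw [(hX.hasFDerivAt_x0 hU hz).fderiv, (hY.hasFDerivAt_x0 hU hz).fderiv]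
        simp [hY.x0 z hz]
      · rw [(hX.hasFDerivAt_x1 hU hz).fderiv, (hY.hasFDerivAt_x1 hU hz).fderiv]
        simp only [add_apply, smul_apply, ContinuousLinearMap.comp_apply, pX, pY, cx_apply]
        simp [hY.x1 z hz]
        ring
      · rw [(hX.hasFDerivAt_x2 hU hz).fderiv, (hY.hasFDerivAt_x2 hU hz).fderiv]
        simp only [add_apply, smul_apply, ContinuousLinearMap.comp_apply, pX, pY, cx_apply]
        simp [hY.x2 z hz, B, eF _ hy, eG _ hy, G, hκ]
      · rw [(hX.hasFDerivAt_x3 hU hz).fderiv, (hY.hasFDerivAt_x3 hU hz).fderiv]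
        simp only [add_apply, smul_apply, ContinuousLinearMap.comp_apply, pX, pY, cx_apply]
        simp [hY.x3 z hz, B, eF _ hy, eG _ hy, G, hκ]
    · simp only [Prod.snd_sub, Pi.sub_apply, fderiv_comp2 tX, fderiv_comp2 tY]
      rcases Fin.eq_zero_or_eq_succ i with rfl | ⟨k, rfl⟩
      · rw [(hX.hasFDerivAt_u0 hU hz).fderiv, (hY.hasFDerivAt_u0 hU hz).fderiv]
        have e1 : iteratedDeriv 2 (0 : ℝ → ℝ) = 0 := funext fun t => iteratedDeriv_fun_const_zero
        simp [hY.x0 z hz, hY.u0 z hz, hY.uγ z hz, e1]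
      · rw [(hX.hasFDerivAt_uγ hU hz k).fderiv, (hY.hasFDerivAt_uγ hU hz k).fderiv]
        simp [hY.x0 z hz, hY.uγ z hz]

theorem hasDerivAt_iteratedDeriv {V : Set ℝ} (hV : IsOpen V) {f : ℝ → ℝ} (hf : ContDiffOn ℝ ∞ f V)
    (n : ℕ) {t : ℝ} (ht : t ∈ V) : HasDerivAt (iteratedDeriv n f) (iteratedDeriv (n + 1) f t) t := by
  rw [iteratedDeriv_succ]
  exact (differentiableAt_of_contDiffOn hV (contDiffOn_iteratedDeriv hV hf n) ht).hasDerivAt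

theorem iteratedDeriv_two_eq {V : Set ℝ} (hV : IsOpen V) {f g : ℝ → ℝ} {h t : ℝ} (ht : t ∈ V)
    (h1 : ∀ t ∈ V, HasDerivAt f (g t) t) (h2 : HasDerivAt g h t) : iteratedDeriv 2 f t = h := by
  rw [iteratedDeriv_succ, iteratedDeriv_one]
  refine (h2.congr_of_eventuallyEq ?_).deriv
  exact Filter.eventuallyEq_of_mem (hV.mem_nhds ht) fun t ht => (h1 t ht).deriv

/-- In the bracket the scalings disappear, the matrices form a commutator, and the shifts combine
into `A`. The pressure component must then contain `-∑ γ^k A_k''`, which is why the derivatives `A1`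
and `A2` are written out. -/
theorem isGalileanFieldOn_lieBracket {U : Set Z} (hU : IsOpen U) {X Y : Z → Z}
    (hX : IsGalileanFieldOn U X) (hY : IsGalileanFieldOn U Y) :
    IsGalileanFieldOn U (VectorField.lieBracket ℝ X Y) := by
  obtain ⟨c, s₁, s₂, M, α, β, hX⟩ := isGalileanFieldOn_iff.1 hX
  obtain ⟨c', s₁', s₂', M', α', β', hY⟩ := isGalileanFieldOn_iff.1 hY
  have hV := isOpen_timeProj hU
  set V := timeProj U
  let A : Fin 3 → ℝ → ℝ := fun k t => ∑ l, (M' k l * α l t - M k l * α' l t)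
    + iteratedDeriv 1 (α' k) t * (c + s₁ * t) - iteratedDeriv 1 (α k) t * (c' + s₁' * t)
  let A1 : Fin 3 → ℝ → ℝ := fun k t =>
    ∑ l, (M' k l * iteratedDeriv 1 (α l) t - M k l * iteratedDeriv 1 (α' l) t)
    + (iteratedDeriv 2 (α' k) t * (c + s₁ * t) + iteratedDeriv 1 (α' k) t * s₁)
    - (iteratedDeriv 2 (α k) t * (c' + s₁' * t) + iteratedDeriv 1 (α k) t * s₁')
  let A2 : Fin 3 → ℝ → ℝ := fun k t =>
    ∑ l, (M' k l * iteratedDeriv 2 (α l) t - M k l * iteratedDeriv 2 (α' l) t)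
    + (iteratedDeriv 3 (α' k) t * (c + s₁ * t) + iteratedDeriv 2 (α' k) t * s₁
      + iteratedDeriv 2 (α' k) t * s₁)
    - (iteratedDeriv 3 (α k) t * (c' + s₁' * t) + iteratedDeriv 2 (α k) t * s₁'
      + iteratedDeriv 2 (α k) t * s₁')
  let B : ℝ → ℝ := fun t => 4 * s₂' * β t - 4 * s₂ * β' t
    - ∑ k, (iteratedDeriv 2 (α' k) t * α k t - iteratedDeriv 2 (α k) t * α' k t)
    + deriv β' t * (c + s₁ * t) - deriv β t * (c' + s₁' * t)
  have hlin : ∀ p q t : ℝ, HasDerivAt (fun t => p + q * t) q t := fun p q t => by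
    simpa using ((hasDerivAt_id t).const_mul q).const_add p
  have hA1 : ∀ k, ∀ t ∈ V, HasDerivAt (A k) (A1 k t) t := fun k t ht => by
    have i0 := fun l => hasDerivAt_iteratedDeriv hV (hX.smooth_α l) 0 ht
    have i0' := fun l => hasDerivAt_iteratedDeriv hV (hY.smooth_α l) 0 ht
    simp only [iteratedDeriv_zero, zero_add] at i0 i0'
    exact ((HasDerivAt.fun_sum (u := Finset.univ) fun l _ =>
      ((i0 l).const_mul (M' k l)).sub ((i0' l).const_mul (M k l))).add
      ((hasDerivAt_iteratedDeriv hV (hY.smooth_α k) 1 ht).mul (hlin c s₁ t))).sub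
      ((hasDerivAt_iteratedDeriv hV (hX.smooth_α k) 1 ht).mul (hlin c' s₁' t))
  have hA2 : ∀ k, ∀ t ∈ V, HasDerivAt (A1 k) (A2 k t) t := fun k t ht => by
    have i1 := fun l => hasDerivAt_iteratedDeriv hV (hX.smooth_α l) 1 ht
    have i1' := fun l => hasDerivAt_iteratedDeriv hV (hY.smooth_α l) 1 ht
    exact ((HasDerivAt.fun_sum (u := Finset.univ) fun l _ =>
      ((i1 l).const_mul (M' k l)).sub ((i1' l).const_mul (M k l))).add
      (((hasDerivAt_iteratedDeriv hV (hY.smooth_α k) 2 ht).mul (hlin c s₁ t)).add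
      ((i1' k).mul_const s₁))).sub
      (((hasDerivAt_iteratedDeriv hV (hX.smooth_α k) 2 ht).mul (hlin c' s₁' t)).add
      ((i1 k).mul_const s₁'))
  have hA : ∀ k, ∀ t ∈ V, iteratedDeriv 2 (A k) t = A2 k t := fun k t ht =>
    iteratedDeriv_two_eq hV ht (hA1 k) (hA2 k t ht)
  have sm := fun n k => contDiffOn_iteratedDeriv hV (hX.smooth_α k) n
  have sm' := fun n k => contDiffOn_iteratedDeriv hV (hY.smooth_α k) n
  have hl : ∀ p q : ℝ, ContDiffOn ℝ ∞ (fun t : ℝ => p + q * t) V := fun p q => by fun_prop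
  refine isGalileanFieldOn_iff.2 ⟨s₁' * c - s₁ * c', 0, 0,
    fun k l => ∑ m, (M' k m * M m l - M k m * M' m l), A, B,
    fun k l => ?_, fun k => ?_, ?_, contDiffOn_const, contDiffOn_const, contDiffOn_const,
    by simp, fun z hz => ?_, fun z hz => ?_, fun z hz => ?_, fun z hz => ?_, fun z hz => ?_,
    fun z hz k => ?_⟩
  -- The scalar parts drop out of the commutator and two antisymmetric matrices have an
  -- antisymmetric commutator, which agrees with zero scaling constants.
  · obtain ⟨r, rfl⟩ := exists_eq_crossMatrix hX.conformal
    obtain ⟨r', rfl⟩ := exists_eq_crossMatrix hY.conformal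
    fin_cases k <;> fin_cases l <;> simp [crossMatrix, Fin.sum_univ_three] <;> ring
  · exact ((ContDiffOn.sum fun l _ => (contDiffOn_const.mul (hX.smooth_α l)).sub
      (contDiffOn_const.mul (hY.smooth_α l))).add ((sm' 1 k).mul (hl c s₁))).sub
      ((sm 1 k).mul (hl c' s₁'))
  · exact ((((contDiffOn_const.mul hX.smooth_β).sub (contDiffOn_const.mul hY.smooth_β)).sub
      (ContDiffOn.sum fun k _ => ((sm' 2 k).mul (hX.smooth_α k)).sub
      ((sm 2 k).mul (hY.smooth_α k)))).add
      ((hY.smooth_β.deriv_of_isOpen hV (by simp)).mul (hl c s₁))).sub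
      ((hX.smooth_β.deriv_of_isOpen hV (by simp)).mul (hl c' s₁'))
  all_goals
    have tX := differentiableAt_of_contDiffOn hU (hX.contDiffOn hU) hz
    have tY := differentiableAt_of_contDiffOn hU (hY.contDiffOn hU) hz
    rw [VectorField.lieBracket]
    simp only [Prod.fst_sub, Prod.snd_sub, Pi.sub_apply, fderiv_comp1 tX, fderiv_comp1 tY,
      fderiv_comp2 tX, fderiv_comp2 tY]
  · rw [(hX.hasFDerivAt_x0 hU hz).fderiv, (hY.hasFDerivAt_x0 hU hz).fderiv]
    simp [hX.x0 z hz, hY.x0 z hz]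
    ring
  · rw [(hX.hasFDerivAt_x1 hU hz).fderiv, (hY.hasFDerivAt_x1 hU hz).fderiv]
    simp [hX.x1 z hz, hY.x1 z hz]
    ring
  · rw [(hX.hasFDerivAt_x2 hU hz).fderiv, (hY.hasFDerivAt_x2 hU hz).fderiv]
    simp [hX.x2 z hz, hY.x2 z hz]
    ring
  · rw [(hX.hasFDerivAt_x3 hU hz).fderiv, (hY.hasFDerivAt_x3 hU hz).fderiv]
    simp [hX.x3 z hz, hY.x3 z hz]
    ring
  · rw [(hX.hasFDerivAt_u0 hU hz).fderiv, (hY.hasFDerivAt_u0 hU hz).fderiv]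
    have ht := mem_timeProj hz
    obtain ⟨r, rfl⟩ := exists_eq_crossMatrix hX.conformal
    obtain ⟨r', rfl⟩ := exists_eq_crossMatrix hY.conformal
    simp only [hA _ _ ht, A2, B, add_apply, sub_apply, smul_apply, cx_apply, cu_apply,
      hX.u0 z hz, hY.u0 z hz, hX.uγ z hz, hY.uγ z hz, hX.x0 z hz, hY.x0 z hz, smul_eq_mul,
      ← iteratedDeriv_succ, Fin.sum_univ_three]
    simp [crossMatrix]
    ring
  · rw [(hX.hasFDerivAt_uγ hU hz k).fderiv, (hY.hasFDerivAt_uγ hU hz k).fderiv]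
    simp only [A, add_apply, smul_apply, cx_apply, cu_apply,
      hX.uγ z hz, hY.uγ z hz, hX.x0 z hz, hY.x0 z hz, smul_eq_mul, iteratedDeriv_one,
      Fin.sum_univ_three]
    ring

/-! ### Reparametrizations as symmetries: isotopies of unimodular maps -/

theorem plane_det_eq (A : (ℝ × ℝ) →L[ℝ] (ℝ × ℝ)) :
    A.det = (A (1, 0)).1 * (A (0, 1)).2 - (A (1, 0)).2 * (A (0, 1)).1 := by
  rw [ContinuousLinearMap.det, ← LinearMap.det_toMatrix (Module.Basis.finTwoProd ℝ),
    Matrix.det_fin_two]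
  simp [LinearMap.toMatrix_apply]
  ring

/-- Liouville's formula in the plane. -/
theorem hasDerivAt_det_fderiv {S : ℝ × (ℝ × ℝ) → ℝ × ℝ} (hS : ContDiff ℝ ∞ S)
    {V : ℝ → ℝ × ℝ → ℝ × ℝ} (hV : ∀ s, Differentiable ℝ (V s))
    (h : ∀ s x, HasDerivAt (fun r => S (r, x)) (V s (S (s, x))) s) (s : ℝ) (x : ℝ × ℝ) :
    HasDerivAt (fun r => (fderiv ℝ (fun y => S (r, y)) x).det)
      (planeTrace (fderiv ℝ (V s) (S (s, x))) * (fderiv ℝ (fun y => S (s, y)) x).det) s := by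
  have hd : Differentiable ℝ (fun y => S (s, y)) :=
    (hS.comp (contDiff_const.prodMk contDiff_id)).differentiable (by simp)
  -- The variational equation: the columns of the Jacobian matrix evolve by `w' = DV · w`.
  have key : ∀ v, HasDerivAt (fun r => fderiv ℝ (fun y => S (r, y)) x v)
      (fderiv ℝ (V s) (S (s, x)) (fderiv ℝ (fun y => S (s, y)) x v)) s := fun v => by
    have h1 := hasDerivAt_fderiv_param hS (h := fun q => V q.1 (S q)) h s x v
    refine h1.congr_deriv ?_
    exact congrArg (fun L => L v) (fderiv_comp x (hV s _) (hd x))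
  simp only [plane_det_eq, planeTrace_apply]
  have k1 := key (1, 0)
  have k2 := key (0, 1)
  rw [plane_map_eq (fderiv ℝ (V s) (S (s, x)))] at k1 k2
  have p1 := fun {w w'} (k : HasDerivAt w w' s) =>
    (ContinuousLinearMap.fst ℝ ℝ ℝ).hasFDerivAt.comp_hasDerivAt s k
  have p2 := fun {w w'} (k : HasDerivAt w w' s) =>
    (ContinuousLinearMap.snd ℝ ℝ ℝ).hasFDerivAt.comp_hasDerivAt s k
  have h2 := ((p1 k1).mul (p2 k2)).sub ((p2 k1).mul (p1 k2))
  refine h2.congr_deriv ?_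
  simp
  ring

theorem contDiff_reparamMap_param {a : ℝ × (ℝ × ℝ) → ℝ} {σ : ℝ × (ℝ × ℝ) → ℝ × ℝ}
    (ha : ContDiff ℝ ∞ a) (hσ : ContDiff ℝ ∞ σ) :
    ContDiff ℝ ∞ (fun q : ℝ × Z => reparamMap (fun y => a (q.1, y)) (fun y => σ (q.1, y)) q.2) := by
  have hy : ContDiff ℝ ∞ (fun q : ℝ × Z => (q.1, ((q.2.1 2, q.2.1 3) : ℝ × ℝ))) :=
    contDiff_fst.prodMk (projY.contDiff.comp contDiff_snd)
  have h1 : ∀ μ, ContDiff ℝ ∞ (fun q : ℝ × Z => q.2.1 μ) := fun μ =>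
    (cx μ).contDiff.comp contDiff_snd
  refine ContDiff.prodMk ?_ (contDiff_snd.comp contDiff_snd)
  rw [contDiff_pi]
  intro i
  have hi : i = 0 ∨ i = 1 ∨ i = 2 ∨ i = 3 := by fin_cases i <;> simp
  rcases hi with rfl | rfl | rfl | rfl
  · exact h1 0
  · exact (h1 1).add (ha.comp hy)
  · exact (hσ.comp hy).fst
  · exact (hσ.comp hy).snd

/-- The reparametrization with data `a` and `σ` as a transformation. -/
def reparamEquiv (a : ℝ × ℝ → ℝ) (σ : Equiv.Perm (ℝ × ℝ)) : Equiv.Perm Z where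
  toFun := reparamMap a σ
  invFun := reparamMap (fun y => -a (σ.symm y)) σ.symm
  left_inv z := by
    rw [reparamMap_comp]
    simpa using reparamMap_id z
  right_inv z := by
    rw [reparamMap_comp]
    simpa using reparamMap_id z

theorem reparamEquiv_apply (a : ℝ × ℝ → ℝ) (σ : Equiv.Perm (ℝ × ℝ)) (z : Z) :
    reparamEquiv a σ z = reparamMap a σ z := rfl

theorem reparamEquiv_mul (a b : ℝ × ℝ → ℝ) (σ τ : Equiv.Perm (ℝ × ℝ)) :
    reparamEquiv a σ * reparamEquiv b τ = reparamEquiv (fun y => b y + a (τ y)) (σ * τ) :=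
  Equiv.ext fun z => reparamMap_comp a b σ τ z

theorem mem_reparamGroup_iff {Φ : Equiv.Perm Z} : Φ ∈ reparamGroup ↔
    ∃ a σ, ContDiff ℝ ∞ a ∧ IsUnimodular σ ∧ Φ = reparamEquiv a σ := by
  constructor
  · rintro ⟨a, σ, ha, hσ, h⟩
    exact ⟨a, σ, ha, hσ, Equiv.ext h⟩
  · rintro ⟨a, σ, ha, hσ, rfl⟩
    exact ⟨a, σ, ha, hσ, fun z => rfl⟩

/-- The planar velocity is `V s = ∂ₛS ∘ (S s)⁻¹`. Since the Jacobian stays 1, Liouville's formula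
forces `div V = 0`. The label shift `s · a` contributes the velocity `a ∘ (S s)⁻¹` along `ξ¹`, so at
each instant the field is an infinitesimal reparametrization. -/
theorem isSymmetryIsotopy_reparamEquiv {S : ℝ → Equiv.Perm (ℝ × ℝ)}
    (hS : ContDiff ℝ ∞ (fun q : ℝ × (ℝ × ℝ) => S q.1 q.2))
    (hS' : ContDiff ℝ ∞ (fun q : ℝ × (ℝ × ℝ) => (S q.1).symm q.2))
    (hdet : ∀ s y, (fderiv ℝ (S s) y).det = 1) (h0 : S 0 = 1) {a : ℝ × ℝ → ℝ}
    (ha : ContDiff ℝ ∞ a) :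
    IsSymmetryIsotopy (fun s => reparamEquiv (fun y => s * a y) (S s)) := by
  let V : ℝ → ℝ × ℝ → ℝ × ℝ := fun s y =>
    fderiv ℝ (fun q : ℝ × (ℝ × ℝ) => S q.1 q.2) (s, (S s).symm y) (1, 0)
  have hVs : ∀ s, ContDiff ℝ ∞ (V s) := fun s => by
    have h1 : ContDiff ℝ ∞ (fun y => ((s, (S s).symm y) : ℝ × (ℝ × ℝ))) :=
      contDiff_const.prodMk (hS'.comp (contDiff_const.prodMk contDiff_id))
    exact ((hS.fderiv_right (by simp)).comp h1).clm_apply contDiff_const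
  have hd : ∀ s x, HasDerivAt (fun r => S r x) (V s (S s x)) s := fun s x => by
    have h1 := (hS.differentiable (by simp) (s, x)).hasFDerivAt.comp_hasDerivAt s
      ((hasDerivAt_id s).prodMk (hasDerivAt_const s x))
    refine h1.congr_deriv ?_
    simp [V]
  have hdiv : ∀ s y, planeTrace (fderiv ℝ (V s) y) = 0 := fun s y => by
    have h1 := hasDerivAt_det_fderiv hS (fun s => (hVs s).differentiable (by simp)) hd s
      ((S s).symm y)
    have h2 : HasDerivAt (fun r => (fderiv ℝ (fun y => S r y) ((S s).symm y)).det) 0 s := by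
      simp only [hdet]
      exact hasDerivAt_const s 1
    have h3 := h1.unique h2
    simp only [hdet, mul_one, Equiv.apply_symm_apply] at h3
    exact h3
  have ha2 : ContDiff ℝ ∞ (fun q : ℝ × (ℝ × ℝ) => q.1 * a q.2) :=
    contDiff_fst.mul (ha.comp contDiff_snd)
  have ha3 : ContDiff ℝ ∞ (fun q : ℝ × (ℝ × ℝ) => -(q.1 * a ((S q.1).symm q.2))) :=
    (contDiff_fst.mul (ha.comp hS')).neg
  refine ⟨contDiff_reparamMap_param ha2 hS, contDiff_reparamMap_param ha3 hS', ?_,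
    fun s z => (![0, a ((S s).symm (z.1 2, z.1 3)), (V s (z.1 2, z.1 3)).1,
      (V s (z.1 2, z.1 3)).2], 0), fun s => ?_, fun s z => ?_⟩
  · refine Equiv.ext fun z => ?_
    simp only [reparamEquiv_apply, zero_mul, h0]
    exact reparamMap_id z
  · have h1 : IsReparamFieldOn Set.univ (fun z => (![0, a ((S s).symm (z.1 2, z.1 3)),
        (V s (z.1 2, z.1 3)).1, (V s (z.1 2, z.1 3)).2], 0)) := by
      refine ⟨fun y => a ((S s).symm y), fun y => (V s y).1, fun y => (V s y).2,
        (ha.comp (hS'.comp (contDiff_const.prodMk contDiff_id))).contDiffOn,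
        (hVs s).fst.contDiffOn, (hVs s).snd.contDiffOn, fun y _ => ?_, fun z _ => rfl⟩
      have h2 := ((hVs s).differentiable (by simp) y).hasFDerivAt
      rw [h2.fst.fderiv, h2.snd.fderiv]
      exact hdiv s y
    obtain ⟨_, _, _, h2⟩ := isReparamFieldOn_iff.1 h1
    exact h2.isInfinitesimalSymmetryOn isOpen_univ
  · refine HasDerivAt.prodMk ?_ (hasDerivAt_const s _)
    rw [hasDerivAt_pi]
    intro i
    have h1 := hd s (z.1 2, z.1 3)
    have hi : i = 0 ∨ i = 1 ∨ i = 2 ∨ i = 3 := by fin_cases i <;> simp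
    rcases hi with rfl | rfl | rfl | rfl
    · exact hasDerivAt_const s _
    · refine (((hasDerivAt_id s).mul_const (a (z.1 2, z.1 3))).const_add (z.1 1)).congr_deriv ?_
      simp [reparamEquiv_apply, reparamMap]
    · exact h1.fst
    · exact h1.snd

theorem reparamEquiv_mem_of_isotopy {S : ℝ → Equiv.Perm (ℝ × ℝ)}
    (hS : ContDiff ℝ ∞ (fun q : ℝ × (ℝ × ℝ) => S q.1 q.2))
    (hS' : ContDiff ℝ ∞ (fun q : ℝ × (ℝ × ℝ) => (S q.1).symm q.2))
    (hdet : ∀ s y, (fderiv ℝ (S s) y).det = 1) (h0 : S 0 = 1) (s : ℝ) :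
    reparamEquiv 0 (S s) ∈ symmetryGroup := by
  have h := isSymmetryIsotopy_reparamEquiv hS hS' hdet h0 (a := 0) contDiff_const
  refine Subgroup.subset_closure ⟨_, h, s, ?_⟩
  simp only [Pi.zero_apply, mul_zero]
  rfl

/-- The shear `(y₁, y₂) ↦ (y₁ + f y₂, y₂)`. -/
def shearFst (f : ℝ → ℝ) : Equiv.Perm (ℝ × ℝ) where
  toFun y := (y.1 + f y.2, y.2)
  invFun y := (y.1 - f y.2, y.2)
  left_inv y := by simp
  right_inv y := by simp

/-- The shear `(y₁, y₂) ↦ (y₁, y₂ + f y₁)`. -/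
def shearSnd (f : ℝ → ℝ) : Equiv.Perm (ℝ × ℝ) where
  toFun y := (y.1, y.2 + f y.1)
  invFun y := (y.1, y.2 - f y.1)
  left_inv y := by simp
  right_inv y := by simp

theorem hasFDerivAt_shearFst {f : ℝ → ℝ} (hf : Differentiable ℝ f) (y : ℝ × ℝ) :
    HasFDerivAt (shearFst f) ((ContinuousLinearMap.fst ℝ ℝ ℝ
      + deriv f y.2 • ContinuousLinearMap.snd ℝ ℝ ℝ).prod (ContinuousLinearMap.snd ℝ ℝ ℝ)) y :=
  (hasFDerivAt_fst.add ((hf y.2).hasDerivAt.comp_hasFDerivAt y hasFDerivAt_snd)).prodMk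
    hasFDerivAt_snd

theorem hasFDerivAt_shearSnd {f : ℝ → ℝ} (hf : Differentiable ℝ f) (y : ℝ × ℝ) :
    HasFDerivAt (shearSnd f) ((ContinuousLinearMap.fst ℝ ℝ ℝ).prod (ContinuousLinearMap.snd ℝ ℝ ℝ
      + deriv f y.1 • ContinuousLinearMap.fst ℝ ℝ ℝ)) y :=
  hasFDerivAt_fst.prodMk
    (hasFDerivAt_snd.add ((hf y.1).hasDerivAt.comp_hasFDerivAt y hasFDerivAt_fst))

theorem isUnimodular_shearFst {f : ℝ → ℝ} (hf : ContDiff ℝ ∞ f) : IsUnimodular (shearFst f) := by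
  refine ⟨(contDiff_fst.add (hf.comp contDiff_snd)).prodMk contDiff_snd,
    (contDiff_fst.sub (hf.comp contDiff_snd)).prodMk contDiff_snd, fun y => ?_⟩
  rw [(hasFDerivAt_shearFst (hf.differentiable (by simp)) y).fderiv, plane_det_eq]
  simp

theorem isUnimodular_shearSnd {f : ℝ → ℝ} (hf : ContDiff ℝ ∞ f) : IsUnimodular (shearSnd f) := by
  refine ⟨contDiff_fst.prodMk (contDiff_snd.add (hf.comp contDiff_fst)),
    contDiff_fst.prodMk (contDiff_snd.sub (hf.comp contDiff_fst)), fun y => ?_⟩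
  rw [(hasFDerivAt_shearSnd (hf.differentiable (by simp)) y).fderiv, plane_det_eq]
  simp

theorem reparamEquiv_shearFst_mem {f : ℝ → ℝ} (hf : ContDiff ℝ ∞ f) :
    reparamEquiv 0 (shearFst f) ∈ symmetryGroup := by
  have e : ContDiff ℝ ∞ (fun q : ℝ × (ℝ × ℝ) => q.1 * f q.2.2) := by fun_prop
  have h := reparamEquiv_mem_of_isotopy (S := fun s => shearFst (fun x => s * f x))
    ((contDiff_snd.fst.add e).prodMk contDiff_snd.snd)
    ((contDiff_snd.fst.sub e).prodMk contDiff_snd.snd)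
    (fun s => (isUnimodular_shearFst (contDiff_const.mul hf)).2.2)
    (Equiv.ext fun y => by simp [shearFst]) 1
  simpa using h

theorem reparamEquiv_shearSnd_mem {f : ℝ → ℝ} (hf : ContDiff ℝ ∞ f) :
    reparamEquiv 0 (shearSnd f) ∈ symmetryGroup := by
  have e : ContDiff ℝ ∞ (fun q : ℝ × (ℝ × ℝ) => q.1 * f q.2.1) := by fun_prop
  have h := reparamEquiv_mem_of_isotopy (S := fun s => shearSnd (fun x => s * f x))
    (contDiff_snd.fst.prodMk (contDiff_snd.snd.add e))
    (contDiff_snd.fst.prodMk (contDiff_snd.snd.sub e))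
    (fun s => (isUnimodular_shearSnd (contDiff_const.mul hf)).2.2)
    (Equiv.ext fun y => by simp [shearSnd]) 1
  simpa using h

/-- The Alexander trick: a unimodular diffeomorphism tangent to the identity at a fixed point is
isotopic to the identity. -/
theorem reparamEquiv_mem_of_fderiv_eq_id {σ : Equiv.Perm (ℝ × ℝ)} (hσ : IsUnimodular σ)
    (h0 : σ 0 = 0) (h1 : fderiv ℝ σ 0 = ContinuousLinearMap.id ℝ (ℝ × ℝ)) :
    reparamEquiv 0 σ ∈ symmetryGroup := by
  have h0' : σ.symm 0 = 0 := by rw [Equiv.symm_apply_eq, h0]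
  have dσ := fun y => (hσ.1.differentiable (by simp) y).hasFDerivAt
  have dσ' := fun y => (hσ.2.1.differentiable (by simp) y).hasFDerivAt
  have h1' : fderiv ℝ σ.symm 0 = ContinuousLinearMap.id ℝ (ℝ × ℝ) := by
    have h2 := (dσ (σ.symm 0)).comp 0 (dσ' 0)
    rw [h0', h1, ContinuousLinearMap.id_comp] at h2
    have e : (σ : ℝ × ℝ → ℝ × ℝ) ∘ σ.symm = id := funext fun x => σ.apply_symm_apply x
    rw [e] at h2
    exact h2.unique (hasFDerivAt_id 0)
  obtain ⟨g, hg, hgs, hg0⟩ := exists_contDiff_scaling hσ.1 h0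
  obtain ⟨g', hg', hgs', hg0'⟩ := exists_contDiff_scaling hσ.2.1 h0'
  rw [h1] at hg0
  rw [h1'] at hg0'
  have e : ∀ s ≠ 0, ∀ x, g (s, x) = s⁻¹ • σ (s • x) := fun s hs x => by
    rw [← hgs, inv_smul_smul₀ hs]
  have e' : ∀ s ≠ 0, ∀ x, g' (s, x) = s⁻¹ • σ.symm (s • x) := fun s hs x => by
    rw [← hgs', inv_smul_smul₀ hs]
  -- The isotopy `x ↦ σ(sx)/s`, completed at `s = 0` by `dσ(0) = id`. Hadamard's lemma gives joint
  -- smoothness, for the inverses as well, and the two homotheties leave the Jacobian determinant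
  -- unchanged.
  let S : ℝ → Equiv.Perm (ℝ × ℝ) := fun s =>
    { toFun := fun x => g (s, x)
      invFun := fun x => g' (s, x)
      left_inv := fun x => by
        rcases eq_or_ne s 0 with rfl | hs
        · simp [hg0, hg0']
        · simp [e s hs, e' s hs, smul_inv_smul₀ hs, inv_smul_smul₀ hs]
      right_inv := fun x => by
        rcases eq_or_ne s 0 with rfl | hs
        · simp [hg0, hg0']
        · simp [e s hs, e' s hs, smul_inv_smul₀ hs, inv_smul_smul₀ hs] }
  have h := reparamEquiv_mem_of_isotopy (S := S) hg hg' (fun s y => ?_)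
    (Equiv.ext fun x => by simp [S, hg0]) 1
  · have e1 : S 1 = σ := Equiv.ext fun x => by simp [S, e 1 one_ne_zero]
    rwa [e1] at h
  · rcases eq_or_ne s 0 with rfl | hs
    · have e1 : (S 0 : ℝ × ℝ → ℝ × ℝ) = id := funext fun x => by simp [S, hg0]
      rw [e1, fderiv_id]
      simp [ContinuousLinearMap.det]
    · have e1 : (S s : ℝ × ℝ → ℝ × ℝ) = fun x => s⁻¹ • σ (s • x) := funext fun x => e s hs x
      have h2 : HasFDerivAt (fun x : ℝ × ℝ => s⁻¹ • σ (s • x))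
          (s⁻¹ • (fderiv ℝ σ (s • y)).comp (s • ContinuousLinearMap.id ℝ (ℝ × ℝ))) y :=
        ((dσ (s • y)).comp y ((hasFDerivAt_id y).const_smul s)).const_smul s⁻¹
      rw [e1, h2.fderiv, ContinuousLinearMap.comp_smul, ContinuousLinearMap.comp_id,
        inv_smul_smul₀ hs]
      exact hσ.2.2 _

theorem reparamEquiv_mem_of_mul_mem {σ τ : Equiv.Perm (ℝ × ℝ)}
    (hτ : reparamEquiv 0 τ ∈ symmetryGroup) (h : reparamEquiv 0 (τ * σ) ∈ symmetryGroup) :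
    reparamEquiv 0 σ ∈ symmetryGroup := by
  have e : reparamEquiv 0 (τ * σ) = reparamEquiv 0 τ * reparamEquiv 0 σ := by
    rw [reparamEquiv_mul]
    simp
    rfl
  rw [e] at h
  exact (Subgroup.mul_mem_cancel_left _ hτ).1 h

theorem fderiv_shearFst_mul {σ : Equiv.Perm (ℝ × ℝ)} (hσ : IsUnimodular σ) (x : ℝ) (v : ℝ × ℝ) :
    fderiv ℝ (shearFst (fun y => x * y) * σ : Equiv.Perm (ℝ × ℝ)) 0 v
      = ((fderiv ℝ σ 0 v).1 + x * (fderiv ℝ σ 0 v).2, (fderiv ℝ σ 0 v).2) := by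
  have h1 := (hasFDerivAt_shearFst (f := fun y => x * y) (by fun_prop) (σ 0)).comp 0
    (hσ.1.differentiable (by simp) 0).hasFDerivAt
  have h2 := congrArg (fun L => L v) h1.fderiv
  refine h2.trans ?_
  simp

theorem fderiv_shearSnd_mul {σ : Equiv.Perm (ℝ × ℝ)} (hσ : IsUnimodular σ) (x : ℝ) (v : ℝ × ℝ) :
    fderiv ℝ (shearSnd (fun y => x * y) * σ : Equiv.Perm (ℝ × ℝ)) 0 v
      = ((fderiv ℝ σ 0 v).1, (fderiv ℝ σ 0 v).2 + x * (fderiv ℝ σ 0 v).1) := by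
  have h1 := (hasFDerivAt_shearSnd (f := fun y => x * y) (by fun_prop) (σ 0)).comp 0
    (hσ.1.differentiable (by simp) 0).hasFDerivAt
  have h2 := congrArg (fun L => L v) h1.fderiv
  refine h2.trans ?_
  simp

/-- Row reduction in `SL₂(ℝ)`: composition with linear shears, which already belong to the group,
makes the derivative at the origin the identity. -/
theorem reparamEquiv_mem_of_map_zero {σ : Equiv.Perm (ℝ × ℝ)} (hσ : IsUnimodular σ)
    (h0 : σ 0 = 0) : reparamEquiv 0 σ ∈ symmetryGroup := by
  have sm : ∀ x : ℝ, ContDiff ℝ ∞ (fun y : ℝ => x * y) := fun x => by fun_prop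
  have m1 := fun x : ℝ => reparamEquiv_shearFst_mem (sm x)
  have m2 := fun x : ℝ => reparamEquiv_shearSnd_mem (sm x)
  have u1 := fun x : ℝ => isUnimodular_shearFst (sm x)
  have u2 := fun x : ℝ => isUnimodular_shearSnd (sm x)
  have z1 : ∀ (x : ℝ) (τ : Equiv.Perm (ℝ × ℝ)), τ 0 = 0 → (shearFst (fun y => x * y) * τ) 0 = 0 :=
    fun x τ h => by simp [h, shearFst]
  have z2 : ∀ (x : ℝ) (τ : Equiv.Perm (ℝ × ℝ)), τ 0 = 0 → (shearSnd (fun y => x * y) * τ) 0 = 0 :=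
    fun x τ h => by simp [h, shearSnd]
  have stepC : ∀ τ : Equiv.Perm (ℝ × ℝ), IsUnimodular τ → τ 0 = 0 →
      fderiv ℝ τ 0 (1, 0) = (1, 0) → reparamEquiv 0 τ ∈ symmetryGroup := fun τ hτ h0 h1 => by
    refine reparamEquiv_mem_of_mul_mem (m1 (-(fderiv ℝ τ 0 (0, 1)).1))
      (reparamEquiv_mem_of_fderiv_eq_id ((u1 _).mul hτ) (z1 _ τ h0) ?_)
    have hd := hτ.2.2 0
    rw [plane_det_eq, h1] at hd
    simp only [one_mul, zero_mul, sub_zero] at hd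
    refine ContinuousLinearMap.ext fun v => ?_
    rw [plane_map_eq, fderiv_shearFst_mul hτ, fderiv_shearFst_mul hτ, h1, hd]
    simp
  have stepB : ∀ τ : Equiv.Perm (ℝ × ℝ), IsUnimodular τ → τ 0 = 0 →
      (fderiv ℝ τ 0 (1, 0)).1 = 1 → reparamEquiv 0 τ ∈ symmetryGroup := fun τ hτ h0 h1 => by
    refine reparamEquiv_mem_of_mul_mem (m2 (-(fderiv ℝ τ 0 (1, 0)).2))
      (stepC _ ((u2 _).mul hτ) (z2 _ τ h0) ?_)
    rw [fderiv_shearSnd_mul hτ, h1]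
    simp
  -- If the lower left entry is nonzero, a shear makes the upper left entry 1, after which `stepB`
  -- clears the lower left entry and `stepC` the upper right one.
  have stepA : ∀ τ : Equiv.Perm (ℝ × ℝ), IsUnimodular τ → τ 0 = 0 →
      (fderiv ℝ τ 0 (1, 0)).2 ≠ 0 → reparamEquiv 0 τ ∈ symmetryGroup := fun τ hτ h0 h1 => by
    refine reparamEquiv_mem_of_mul_mem
      (m1 ((1 - (fderiv ℝ τ 0 (1, 0)).1) / (fderiv ℝ τ 0 (1, 0)).2))
      (stepB _ ((u1 _).mul hτ) (z1 _ τ h0) ?_)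
    rw [fderiv_shearFst_mul hτ]
    field_simp
    ring
  -- If the lower left entry is zero, determinant 1 makes the upper left one nonzero; adding the
  -- first row to the second leads back to `stepA`.
  by_cases hc : (fderiv ℝ σ 0 (1, 0)).2 = 0
  · refine reparamEquiv_mem_of_mul_mem (m2 1) (stepA _ ((u2 _).mul hσ) (z2 _ σ h0) ?_)
    have hd := hσ.2.2 0
    rw [plane_det_eq, hc] at hd
    rw [fderiv_shearSnd_mul hσ, hc]
    intro h
    simp only [zero_add, one_mul] at h
    simp [h] at hd
  · exact stepA σ hσ h0 hc

/-- Translations are shears with constant profile, so the image of the origin may be moved back to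
the origin. -/
theorem reparamEquiv_mem_of_isUnimodular {σ : Equiv.Perm (ℝ × ℝ)} (hσ : IsUnimodular σ) :
    reparamEquiv 0 σ ∈ symmetryGroup := by
  have u1 := isUnimodular_shearFst (f := fun _ => -(σ 0).1) contDiff_const
  have u2 := isUnimodular_shearSnd (f := fun _ => -(σ 0).2) contDiff_const
  refine reparamEquiv_mem_of_mul_mem (reparamEquiv_shearFst_mem (f := fun _ => -(σ 0).1)
    contDiff_const) (reparamEquiv_mem_of_mul_mem (reparamEquiv_shearSnd_mem
    (f := fun _ => -(σ 0).2) contDiff_const) (reparamEquiv_mem_of_map_zero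
    (u2.mul (u1.mul hσ)) ?_))
  simp [shearFst, shearSnd]

theorem reparamGroup_le_symmetryGroup : reparamGroup ≤ symmetryGroup := by
  intro Φ hΦ
  obtain ⟨a, σ, ha, hσ, rfl⟩ := mem_reparamGroup_iff.1 hΦ
  have h := isSymmetryIsotopy_reparamEquiv (S := fun _ => 1) contDiff_snd contDiff_snd
    (fun _ => IsUnimodular.one.2.2) rfl (ha.comp hσ.2.1)
  -- The plane map acts first, so the label shift has to be read in image coordinates, as `a ∘ σ⁻¹`.
  have e : reparamEquiv a σ
      = reparamEquiv (fun y => 1 * (a ∘ σ.symm) y) 1 * reparamEquiv 0 σ := by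
    rw [reparamEquiv_mul]
    simp
  rw [e]
  exact mul_mem (Subgroup.subset_closure ⟨_, h, 1, rfl⟩) (reparamEquiv_mem_of_isUnimodular hσ)

/-! ### Flows of the Galilean operators -/

theorem contDiff_iteratedDeriv {f : ℝ → ℝ} (hf : ContDiff ℝ ∞ f) (n : ℕ) :
    ContDiff ℝ ∞ (iteratedDeriv n f) :=
  contDiffOn_univ.1 (contDiffOn_iteratedDeriv isOpen_univ hf.contDiffOn n)

theorem Z_ext {z w : Z} (h0 : z.1 0 = w.1 0) (h1 : z.1 1 = w.1 1) (h2 : z.1 2 = w.1 2)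
    (h3 : z.1 3 = w.1 3) (hP : z.2 0 = w.2 0) (hγ : ∀ k : Fin 3, z.2 k.succ = w.2 k.succ) :
    z = w := by
  refine Prod.ext (funext fun i => ?_) (funext fun i => ?_)
  · have hi : i = 0 ∨ i = 1 ∨ i = 2 ∨ i = 3 := by fin_cases i <;> simp
    rcases hi with rfl | rfl | rfl | rfl <;> assumption
  · rcases Fin.eq_zero_or_eq_succ i with rfl | ⟨k, rfl⟩
    exacts [hP, hγ k]

theorem contDiff_Z_iff {E : Type*} [NormedAddCommGroup E] [NormedSpace ℝ E] {f : E → Z} :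
    ContDiff ℝ ∞ f ↔ (∀ μ, ContDiff ℝ ∞ fun x => (f x).1 μ) ∧ (ContDiff ℝ ∞ fun x => (f x).2 0) ∧
      ∀ k : Fin 3, ContDiff ℝ ∞ fun x => (f x).2 k.succ :=
  ⟨fun h => ⟨fun μ => (cx μ).contDiff.comp h, (cu 0).contDiff.comp h,
      fun k => (cu k.succ).contDiff.comp h⟩,
    fun h => (contDiff_pi.2 h.1).prodMk (contDiff_pi.2 (Fin.forall_fin_succ.2 h.2))⟩

theorem hasDerivAt_Z_iff {f : ℝ → Z} {f' : Z} {s : ℝ} : HasDerivAt f f' s ↔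
    (∀ μ, HasDerivAt (fun x => (f x).1 μ) (f'.1 μ) s) ∧
      HasDerivAt (fun x => (f x).2 0) (f'.2 0) s ∧
      ∀ k : Fin 3, HasDerivAt (fun x => (f x).2 k.succ) (f'.2 k.succ) s :=
  ⟨fun h => ⟨fun μ => (cx μ).hasFDerivAt.comp_hasDerivAt s h,
      (cu 0).hasFDerivAt.comp_hasDerivAt s h,
      fun k => (cu k.succ).hasFDerivAt.comp_hasDerivAt s h⟩,
    fun h => (hasDerivAt_pi.2 h.1).prodMk (hasDerivAt_pi.2 (Fin.forall_fin_succ.2 h.2))⟩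

theorem forall_fin_four {p : Fin 4 → Prop} : (∀ i, p i) ↔ p 0 ∧ p 1 ∧ p 2 ∧ p 3 := by
  constructor
  · exact fun h => ⟨h 0, h 1, h 2, h 3⟩
  · rintro ⟨h0, h1, h2, h3⟩ i
    fin_cases i <;> assumption

/-- The rotation about the `i`-th axis. -/
noncomputable def rot (i : Fin 3) (s : ℝ) : Matrix (Fin 3) (Fin 3) ℝ :=
  ![!![1, 0, 0; 0, Real.cos s, -Real.sin s; 0, Real.sin s, Real.cos s],
    !![Real.cos s, 0, Real.sin s; 0, 1, 0; -Real.sin s, 0, Real.cos s],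
    !![Real.cos s, -Real.sin s, 0; Real.sin s, Real.cos s, 0; 0, 0, 1]] i

theorem rot_add (i : Fin 3) (r s : ℝ) : rot i (r + s) = rot i r * rot i s := by
  fin_cases i <;> ext k l <;> fin_cases k <;> fin_cases l <;>
    simp [rot, Matrix.mul_apply, Fin.sum_univ_three, Real.cos_add, Real.sin_add] <;> ring

theorem rot_zero (i : Fin 3) : rot i 0 = 1 := by
  fin_cases i <;> ext k l <;> fin_cases k <;> fin_cases l <;> simp [rot]

theorem rot_transpose (i : Fin 3) (s : ℝ) : (rot i s)ᵀ = rot i (-s) := by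
  fin_cases i <;> ext k l <;> fin_cases k <;> fin_cases l <;> simp [rot]

theorem rot_transpose_mul (i : Fin 3) (s : ℝ) : (rot i s)ᵀ * rot i s = 1 := by
  rw [rot_transpose, ← rot_add, neg_add_cancel, rot_zero]

theorem rot_det (i : Fin 3) (s : ℝ) : (rot i s).det = 1 := by
  have h := Real.sin_sq_add_cos_sq s
  fin_cases i <;> simp [rot, Matrix.det_fin_three] <;> linarith

theorem contDiff_rot (i k l : Fin 3) : ContDiff ℝ ∞ fun s => rot i s k l := by
  have h1 : ContDiff ℝ ∞ Real.cos := Real.contDiff_cos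
  have h2 : ContDiff ℝ ∞ Real.sin := Real.contDiff_sin
  fin_cases i <;> fin_cases k <;> fin_cases l <;> simp [rot] <;> fun_prop

theorem hasDerivAt_rot_mulVec (i : Fin 3) (v : Fin 3 → ℝ) (s : ℝ) (k : Fin 3) :
    HasDerivAt (fun s => (rot i s *ᵥ v) k)
      (((Pi.single i 1 : Fin 3 → ℝ) ⨯₃ (rot i s *ᵥ v)) k) s := by
  have h : HasDerivAt (fun s => (rot i s *ᵥ v) k) (∑ l, deriv (fun s => rot i s k l) s * v l) s := by
    simp only [Matrix.mulVec, dotProduct]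
    exact HasDerivAt.fun_sum fun l _ =>
      (((contDiff_rot i k l).differentiable (by simp) s).hasDerivAt).mul_const (v l)
  refine h.congr_deriv ?_
  fin_cases i <;> fin_cases k <;>
    simp [rot, dotProduct, Fin.sum_univ_three, cross_apply] <;> ring

/-- The flow of `T`. -/
def flowT (s : ℝ) (z : Z) : Z := (![z.1 0 + s, z.1 1, z.1 2, z.1 3], z.2)

/-- The flow of `S₁`. -/
noncomputable def flowS1 (s : ℝ) (z : Z) : Z :=
  (Real.exp s • z.1, Fin.cons (z.2 0) fun k : Fin 3 => Real.exp s * z.2 k.succ)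

/-- The flow of `S₂`. -/
noncomputable def flowS2 (s : ℝ) (z : Z) : Z :=
  (![z.1 0, z.1 1, Real.exp s ^ 3 * z.1 2, Real.exp s ^ 3 * z.1 3],
    Fin.cons (Real.exp s ^ 4 * z.2 0) fun k : Fin 3 => Real.exp s ^ 2 * z.2 k.succ)

/-- The flow of `R_i`. -/
noncomputable def flowR (i : Fin 3) (s : ℝ) (z : Z) : Z :=
  (z.1, Fin.cons (z.2 0) (rot i s *ᵥ fun k : Fin 3 => z.2 k.succ))

/-- The flow of `G_i(α)`. -/
noncomputable def flowG (i : Fin 3) (α : ℝ → ℝ) (s : ℝ) (z : Z) : Z :=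
  (z.1, Fin.cons (z.2 0 - s * z.2 i.succ * iteratedDeriv 2 α (z.1 0)
      - s ^ 2 / 2 * α (z.1 0) * iteratedDeriv 2 α (z.1 0))
    fun k => z.2 k.succ + s * (Pi.single i (α (z.1 0)) : Fin 3 → ℝ) k)

/-- The flow of `K(β)`. -/
def flowK (β : ℝ → ℝ) (s : ℝ) (z : Z) : Z :=
  (z.1, Fin.cons (z.2 0 + s * β (z.1 0)) fun k : Fin 3 => z.2 k.succ)

/-- A smooth one-parameter group of transformations with generator `X`, as a family of maps. -/
structure IsSmoothFlow (X : Z → Z) (φ : ℝ → Z → Z) : Prop where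
  zero : ∀ z, φ 0 z = z
  add : ∀ r s z, φ (r + s) z = φ r (φ s z)
  deriv : ∀ z, HasDerivAt (fun r => φ r z) (X z) 0
  smooth : ContDiff ℝ ∞ fun q : ℝ × Z => φ q.1 q.2

theorem isSmoothFlow_flowT : IsSmoothFlow opT flowT := by
  refine ⟨fun z => ?_, fun r s z => ?_, fun z => ?_, ?_⟩
  · apply Z_ext <;> simp [flowT]
  · apply Z_ext <;> simp [flowT]
    ring
  · rw [hasDerivAt_Z_iff, forall_fin_four]
    simp [flowT, opT, hasDerivAt_const]
    simpa using (hasDerivAt_id (0 : ℝ)).const_add (z.1 0)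
  · rw [contDiff_Z_iff, forall_fin_four]
    simp [flowT]
    refine ⟨⟨?_, ?_, ?_, ?_⟩, ?_, fun k => ?_⟩ <;> fun_prop

theorem isSmoothFlow_flowS1 : IsSmoothFlow opS1 flowS1 := by
  have he : HasDerivAt Real.exp 1 0 := by simpa using Real.hasDerivAt_exp 0
  refine ⟨fun z => ?_, fun r s z => ?_, fun z => ?_, ?_⟩
  · apply Z_ext <;> simp [flowS1]
  · apply Z_ext <;> simp [flowS1, Real.exp_add, mul_assoc]
  · rw [hasDerivAt_Z_iff]
    refine ⟨fun μ => ?_, ?_, fun k => ?_⟩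
    · simpa [flowS1, opS1] using he.mul_const (z.1 μ)
    · simp [flowS1, opS1, hasDerivAt_const]
    · have h : (opS1 z).2 k.succ = z.2 k.succ := by fin_cases k <;> simp [opS1]
      rw [h]
      simpa [flowS1] using he.mul_const (z.2 k.succ)
  · rw [contDiff_Z_iff]
    refine ⟨fun μ => ?_, ?_, fun k => ?_⟩ <;> simp [flowS1] <;> fun_prop

theorem isSmoothFlow_flowS2 : IsSmoothFlow opS2 flowS2 := by
  have he : HasDerivAt Real.exp 1 0 := by simpa using Real.hasDerivAt_exp 0
  have hp : ∀ n : ℕ, HasDerivAt (fun s => Real.exp s ^ n) n 0 := fun n => by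
    have h := he.fun_pow n
    simpa using h
  refine ⟨fun z => ?_, fun r s z => ?_, fun z => ?_, ?_⟩
  · apply Z_ext <;> simp [flowS2]
  · apply Z_ext <;> simp [flowS2, Real.exp_add, mul_assoc, mul_pow]
  · rw [hasDerivAt_Z_iff, forall_fin_four]
    refine ⟨⟨hasDerivAt_const _ _, hasDerivAt_const _ _, ?_, ?_⟩, ?_, fun k => ?_⟩
    · simpa [flowS2, opS2] using (hp 3).mul_const (z.1 2)
    · simpa [flowS2, opS2] using (hp 3).mul_const (z.1 3)
    · simpa [flowS2, opS2] using (hp 4).mul_const (z.2 0)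
    · have h : (opS2 z).2 k.succ = 2 * z.2 k.succ := by fin_cases k <;> simp [opS2]
      rw [h]
      simpa [flowS2] using (hp 2).mul_const (z.2 k.succ)
  · rw [contDiff_Z_iff, forall_fin_four]
    refine ⟨⟨?_, ?_, ?_, ?_⟩, ?_, fun k => ?_⟩ <;> simp [flowS2] <;> fun_prop

theorem isSmoothFlow_flowR (i : Fin 3) : IsSmoothFlow (opR i) (flowR i) := by
  refine ⟨fun z => ?_, fun r s z => ?_, fun z => ?_, ?_⟩
  · apply Z_ext <;> simp [flowR, rot_zero]
  · apply Z_ext <;> simp [flowR, rot_add]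
  · rw [hasDerivAt_Z_iff]
    refine ⟨fun μ => hasDerivAt_const _ _, hasDerivAt_const _ _, fun k => ?_⟩
    have h := hasDerivAt_rot_mulVec i (fun k => z.2 k.succ) 0 k
    rw [rot_zero, Matrix.one_mulVec] at h
    exact h
  · rw [contDiff_Z_iff]
    refine ⟨fun μ => ?_, ?_, fun k => ?_⟩
    · simp [flowR]
      fun_prop
    · simp [flowR]
      fun_prop
    · simp only [flowR, Fin.cons_succ, Matrix.mulVec, dotProduct]
      refine ContDiff.sum fun l _ => ((contDiff_rot i k l).comp contDiff_fst).mul ?_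
      fun_prop

/-- The quadratic term of the flow arises because `γ^i` moves by `s α` while the pressure decreases
at rate `γ^i α''`; the group law is the binomial formula for `(r + s)²`. -/
theorem isSmoothFlow_flowG (i : Fin 3) {α : ℝ → ℝ} (hα : ContDiff ℝ ∞ α) :
    IsSmoothFlow (opG i α) (flowG i α) := by
  have h2 := contDiff_iteratedDeriv hα 2
  refine ⟨fun z => ?_, fun r s z => ?_, fun z => ?_, ?_⟩
  · apply Z_ext <;> simp [flowG]
  · apply Z_ext <;> simp [flowG]
    · ring
    · intro k
      ring
  · rw [hasDerivAt_Z_iff]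
    refine ⟨fun μ => hasDerivAt_const _ _, ?_, fun k => ?_⟩
    · have e1 := ((hasDerivAt_id (0 : ℝ)).mul_const (z.2 i.succ)).mul_const
        (iteratedDeriv 2 α (z.1 0))
      have e2 := ((((hasDerivAt_id (0 : ℝ)).pow 2).div_const 2).mul_const (α (z.1 0))).mul_const
        (iteratedDeriv 2 α (z.1 0))
      simpa [flowG, opG] using (e1.const_sub (z.2 0)).fun_sub e2
    · have e1 := ((hasDerivAt_id (0 : ℝ)).mul_const
        ((Pi.single i (α (z.1 0)) : Fin 3 → ℝ) k)).const_add (z.2 k.succ)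
      simpa [flowG, opG] using e1
  · rw [contDiff_Z_iff]
    refine ⟨fun μ => ?_, ?_, fun k => ?_⟩
    · simp [flowG]
      fun_prop
    · simp [flowG]
      fun_prop
    · by_cases h : k = i
      · subst h
        simp [flowG]
        fun_prop
      · simp [flowG, Pi.single_eq_of_ne h]
        fun_prop

theorem isSmoothFlow_flowK {β : ℝ → ℝ} (hβ : ContDiff ℝ ∞ β) :
    IsSmoothFlow (opK β) (flowK β) := by
  refine ⟨fun z => ?_, fun r s z => ?_, fun z => ?_, ?_⟩
  · apply Z_ext <;> simp [flowK]
  · apply Z_ext <;> simp [flowK]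
    ring
  · rw [hasDerivAt_Z_iff]
    refine ⟨fun μ => hasDerivAt_const _ _, ?_, fun k => ?_⟩
    · simpa [flowK, opK] using ((hasDerivAt_id (0 : ℝ)).mul_const (β (z.1 0))).const_add (z.2 0)
    · simp [flowK, opK, hasDerivAt_const]
  · rw [contDiff_Z_iff]
    refine ⟨fun μ => ?_, ?_, fun k => ?_⟩ <;> simp [flowK] <;> fun_prop

namespace IsSmoothFlow

variable {X : Z → Z} {φ : ℝ → Z → Z}

theorem hasDerivAt (h : IsSmoothFlow X φ) (s : ℝ) (z : Z) :
    HasDerivAt (fun r => φ r z) (X (φ s z)) s := by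
  have h1 := h.deriv (φ s z)
  have h2 : HasDerivAt (fun r => φ (r - s) (φ s z)) (X (φ s z)) s := by
    have h3 : HasDerivAt (fun r => φ r (φ s z)) (X (φ s z)) (s - s) := by rwa [sub_self]
    exact h3.comp_sub_const s s
  refine h2.congr_of_eventuallyEq (Filter.Eventually.of_forall fun r => ?_)
  simp only [← h.add, sub_add_cancel]

/-- The transformations of a smooth flow. -/
def equiv (h : IsSmoothFlow X φ) (s : ℝ) : Equiv.Perm Z where
  toFun := φ s
  invFun := φ (-s)
  left_inv z := by rw [← h.add, neg_add_cancel, h.zero]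
  right_inv z := by rw [← h.add, add_neg_cancel, h.zero]

theorem isOneParameterGroupOf (h : IsSmoothFlow X φ) : IsOneParameterGroupOf X h.equiv :=
  ⟨fun r s => Equiv.ext fun z => h.add r s z, h.hasDerivAt⟩

theorem contDiff (h : IsSmoothFlow X φ) : ContDiff ℝ ∞ X := by
  have e : X = fun z => fderiv ℝ (fun q : ℝ × Z => φ q.1 q.2) (0, z) (1, 0) := by
    funext z
    have h1 := (h.smooth.differentiable (by simp) (0, z)).hasFDerivAt.comp_hasDerivAt 0
      ((hasDerivAt_id (0 : ℝ)).prodMk (hasDerivAt_const 0 z))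
    exact (h.deriv z).unique h1
  rw [e]
  have h2 := h.smooth.fderiv_right (m := ∞) (by simp)
  exact (h2.comp (contDiff_const.prodMk contDiff_id)).clm_apply contDiff_const

/-- The Galilean group is defined through arbitrary one-parameter groups with a given generator. The
generator is smooth, so uniqueness for its differential equation leaves only the explicit flow. -/
theorem unique (h : IsSmoothFlow X φ) {Φ : ℝ → Equiv.Perm Z} (hΦ : IsOneParameterGroupOf X Φ) :
    Φ = h.equiv := by
  have h0 : Φ 0 = 1 := by
    have := hΦ.1 0 0
    rw [add_zero] at this
    exact (mul_eq_left.1 this.symm)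
  have h1 : ContDiff ℝ 1 (fun q : ℝ × Z => X q.2) := (h.contDiff.of_le (by simp)).comp contDiff_snd
  funext s
  refine Equiv.ext fun z => ?_
  have h2 := ode_unique h1 (fun s => hΦ.2 s z) (fun s => h.hasDerivAt s z) (by simp [h0, h.zero])
  exact congrFun h2 s

theorem isSymmetryIsotopy (h : IsSmoothFlow X φ) (hX : IsGalileanFieldOn Set.univ X) :
    IsSymmetryIsotopy h.equiv := by
  obtain ⟨_, _, _, _, _, _, hN⟩ := isGalileanFieldOn_iff.1 hX
  refine ⟨h.smooth, h.smooth.comp (contDiff_fst.neg.prodMk contDiff_snd),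
    Equiv.ext fun z => h.zero z, fun _ => X,
    fun _ => hN.isInfinitesimalSymmetryOn isOpen_univ, h.hasDerivAt⟩

end IsSmoothFlow

/-! ### Explicit elements of the Galilean group -/

/-- The general element of the generalized Galilean group. -/
noncomputable def galileanMap (lam μ t₀ : ℝ) (O : Matrix (Fin 3) (Fin 3) ℝ) (α : Fin 3 → ℝ → ℝ)
    (β : ℝ → ℝ) (z : Z) : Z :=
  (![lam * z.1 0 + t₀, lam * z.1 1, lam * μ ^ 3 * z.1 2, lam * μ ^ 3 * z.1 3],
    Fin.cons (μ ^ 4 * z.2 0 - ∑ k, lam * μ ^ 2 * (O *ᵥ fun l : Fin 3 => z.2 l.succ) k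
        * iteratedDeriv 2 (α k) (lam * z.1 0 + t₀) + β (lam * z.1 0 + t₀))
      fun k => lam * μ ^ 2 * (O *ᵥ fun l : Fin 3 => z.2 l.succ) k + α k (lam * z.1 0 + t₀))

/-- `Φ` is a general element of the generalized Galilean group. -/
def IsGalileanTransformation (Φ : Z → Z) : Prop :=
  ∃ (lam μ t₀ : ℝ) (O : Matrix (Fin 3) (Fin 3) ℝ) (α : Fin 3 → ℝ → ℝ) (β : ℝ → ℝ),
    0 < lam ∧ 0 < μ ∧ Oᵀ * O = 1 ∧ O.det = 1 ∧ (∀ k, ContDiff ℝ ∞ (α k)) ∧ ContDiff ℝ ∞ β ∧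
    ∀ z, Φ z = galileanMap lam μ t₀ O α β z

theorem iteratedDeriv_two_zero (t : ℝ) : iteratedDeriv 2 (fun _ : ℝ => (0 : ℝ)) t = 0 :=
  iteratedDeriv_fun_const_zero

theorem isGalileanTransformation_flowT (s : ℝ) : IsGalileanTransformation (flowT s) := by
  refine ⟨1, 1, s, 1, fun _ _ => 0, fun _ => 0, one_pos, one_pos, by simp, by simp,
    fun _ => contDiff_const, contDiff_const, fun z => ?_⟩
  apply Z_ext <;> simp [flowT, galileanMap]

theorem isGalileanTransformation_flowS1 (s : ℝ) : IsGalileanTransformation (flowS1 s) := by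
  refine ⟨Real.exp s, 1, 0, 1, fun _ _ => 0, fun _ => 0, Real.exp_pos s, one_pos, by simp, by simp,
    fun _ => contDiff_const, contDiff_const, fun z => ?_⟩
  apply Z_ext <;> simp [flowS1, galileanMap]

theorem isGalileanTransformation_flowS2 (s : ℝ) : IsGalileanTransformation (flowS2 s) := by
  refine ⟨1, Real.exp s, 0, 1, fun _ _ => 0, fun _ => 0, one_pos, Real.exp_pos s, by simp, by simp,
    fun _ => contDiff_const, contDiff_const, fun z => ?_⟩
  apply Z_ext <;> simp [flowS2, galileanMap]

theorem isGalileanTransformation_flowR (i : Fin 3) (s : ℝ) :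
    IsGalileanTransformation (flowR i s) := by
  refine ⟨1, 1, 0, rot i s, fun _ _ => 0, fun _ => 0, one_pos, one_pos, rot_transpose_mul i s,
    rot_det i s, fun _ => contDiff_const, contDiff_const, fun z => ?_⟩
  apply Z_ext <;> simp [flowR, galileanMap]

theorem isGalileanTransformation_flowK {β : ℝ → ℝ} (hβ : ContDiff ℝ ∞ β) (s : ℝ) :
    IsGalileanTransformation (flowK β s) := by
  refine ⟨1, 1, 0, 1, fun _ _ => 0, fun t => s * β t, one_pos, one_pos, by simp,
    by simp, fun _ => contDiff_const, contDiff_const.mul hβ, fun z => ?_⟩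
  apply Z_ext <;> simp [flowK, galileanMap]

theorem isGalileanTransformation_flowG (i : Fin 3) {α : ℝ → ℝ} (hα : ContDiff ℝ ∞ α) (s : ℝ) :
    IsGalileanTransformation (flowG i α s) := by
  have e : ∀ (k : Fin 3) (t : ℝ), iteratedDeriv 2 (fun t => if k = i then s * α t else 0) t
      = if k = i then s * iteratedDeriv 2 α t else 0 := fun k t => by
    by_cases h : k = i
    · simp only [h, if_true]
      exact iteratedDeriv_const_mul_field s α
    · simp only [h, if_false]
      exact iteratedDeriv_two_zero t
  -- The quadratic term of the flow depends on `t` only and is absorbed into the pressure shift.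
  refine ⟨1, 1, 0, 1, fun k t => if k = i then s * α t else 0,
    fun t => -(s ^ 2 / 2 * α t * iteratedDeriv 2 α t), one_pos, one_pos, by simp,
    by simp, fun k => ?_, ((contDiff_const.mul hα).mul (contDiff_iteratedDeriv hα 2)).neg,
    fun z => ?_⟩
  · by_cases h : k = i
    · simpa only [h, if_true] using contDiff_const.mul hα
    · simpa only [h, if_false] using contDiff_const
  · apply Z_ext
    · simp [flowG, galileanMap]
    · simp [flowG, galileanMap]
    · simp [flowG, galileanMap]
    · simp [flowG, galileanMap]
    · simp [flowG, galileanMap, e]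
      ring
    · intro k
      simp [flowG, galileanMap, Pi.single_apply]

theorem mem_galileanGroup_of_flow {X : Z → Z} {φ : ℝ → Z → Z} (hX : X ∈ galileanOperators)
    (h : IsSmoothFlow X φ) (s : ℝ) : h.equiv s ∈ galileanGroup :=
  Subgroup.subset_closure ⟨X, hX, h.equiv, h.isOneParameterGroupOf, s, rfl⟩

theorem opT_mem : opT ∈ galileanOperators := by simp [galileanOperators]
theorem opS1_mem : opS1 ∈ galileanOperators := by simp [galileanOperators]
theorem opS2_mem : opS2 ∈ galileanOperators := by simp [galileanOperators]
theorem opR_mem (i : Fin 3) : opR i ∈ galileanOperators := by simp [galileanOperators]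
theorem opG_mem (i : Fin 3) {α : ℝ → ℝ} (hα : ContDiff ℝ ∞ α) : opG i α ∈ galileanOperators :=
  Or.inl (Or.inr ⟨i, α, hα, rfl⟩)
theorem opK_mem {β : ℝ → ℝ} (hβ : ContDiff ℝ ∞ β) : opK β ∈ galileanOperators :=
  Or.inr ⟨β, hβ, rfl⟩

theorem opG_zero (i : Fin 3) (z : Z) : opG i (fun _ => 0) z = 0 := by
  apply Z_ext <;> simp [opG]

theorem opK_zero (z : Z) : opK (fun _ => 0) z = 0 := by
  simp [opK]

/-- Every operator is a Galilean field and has a smooth flow by Galilean transformations. -/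
theorem galileanOperators_spec {X : Z → Z} (hX : X ∈ galileanOperators) :
    IsGalileanFieldOn Set.univ X ∧
      ∃ φ : ℝ → Z → Z, IsSmoothFlow X φ ∧ ∀ s, IsGalileanTransformation (φ s) := by
  have c0 : ∀ V : Set ℝ, ContDiffOn ℝ ∞ (fun _ : ℝ => (0 : ℝ)) V := fun V => contDiffOn_const
  rcases hX with (((rfl | rfl | rfl) | ⟨i, rfl⟩) | ⟨i, α, hα, rfl⟩) | ⟨β, hβ, rfl⟩
  · refine ⟨⟨1, 0, 0, 0, fun _ _ => 0, fun _ => 0, fun _ => c0 _, c0 _, fun z _ => ?_⟩,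
      flowT, isSmoothFlow_flowT, isGalileanTransformation_flowT⟩
    simp [opG_zero, opK_zero]
  · refine ⟨⟨0, 0, 1, 0, fun _ _ => 0, fun _ => 0, fun _ => c0 _, c0 _, fun z _ => ?_⟩,
      flowS1, isSmoothFlow_flowS1, isGalileanTransformation_flowS1⟩
    simp [opG_zero, opK_zero]
  · refine ⟨⟨0, 0, 0, 1, fun _ _ => 0, fun _ => 0, fun _ => c0 _, c0 _, fun z _ => ?_⟩,
      flowS2, isSmoothFlow_flowS2, isGalileanTransformation_flowS2⟩
    simp [opG_zero, opK_zero]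
  · refine ⟨⟨0, Pi.single i 1, 0, 0, fun _ _ => 0, fun _ => 0, fun _ => c0 _, c0 _,
      fun z _ => ?_⟩, flowR i, isSmoothFlow_flowR i, isGalileanTransformation_flowR i⟩
    simp [opG_zero, opK_zero, Pi.single_apply]
  · refine ⟨⟨0, 0, 0, 0, fun j => if j = i then α else fun _ => 0, fun _ => 0, fun j => ?_, c0 _,
      fun z _ => ?_⟩, flowG i α, isSmoothFlow_flowG i hα, isGalileanTransformation_flowG i hα⟩
    · dsimp only
      split_ifs
      exacts [hα.contDiffOn, c0 _]
    · simp only [opK_zero]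
      rw [Finset.sum_eq_single (f := fun j => opG j (if j = i then α else fun _ => 0) z) i
        (fun j _ hj => by simp [hj, opG_zero]) (by simp)]
      simp
  · refine ⟨⟨0, 0, 0, 0, fun _ _ => 0, β, fun _ => c0 _, hβ.contDiffOn, fun z _ => ?_⟩,
      flowK β, isSmoothFlow_flowK hβ, isGalileanTransformation_flowK hβ⟩
    simp [opG_zero]

theorem galileanGroup_le_symmetryGroup : galileanGroup ≤ symmetryGroup := by
  refine (Subgroup.closure_le _).2 ?_
  rintro _ ⟨X, hX, Φ, hΦ, s, rfl⟩
  obtain ⟨h1, φ, h2, -⟩ := galileanOperators_spec hX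
  rw [h2.unique hΦ]
  exact Subgroup.subset_closure ⟨_, h2.isSymmetryIsotopy h1, s, rfl⟩

/-- A subgroup containing all Galilean transformations contains the Galilean group. -/
theorem galileanGroup_le_of {G : Subgroup (Equiv.Perm Z)}
    (h : ∀ Φ : Equiv.Perm Z, IsGalileanTransformation Φ → IsGalileanTransformation (Φ⁻¹ : Equiv.Perm Z) →
      Φ ∈ G) :
    galileanGroup ≤ G := by
  refine (Subgroup.closure_le _).2 ?_
  rintro _ ⟨X, hX, Φ, hΦ, s, rfl⟩
  obtain ⟨-, φ, h2, h3⟩ := galileanOperators_spec hX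
  rw [h2.unique hΦ]
  exact h _ (h3 s) (h3 (-s))

theorem exists_cos_sin {a b : ℝ} (h : a ^ 2 + b ^ 2 = 1) : ∃ θ, Real.cos θ = a ∧ Real.sin θ = b := by
  have hn : ‖(⟨a, b⟩ : ℂ)‖ = 1 := by
    rw [Complex.norm_eq_sqrt_sq_add_sq, h, Real.sqrt_one]
  refine ⟨Complex.arg ⟨a, b⟩, ?_, ?_⟩
  · rw [Complex.cos_arg (by intro h0; simp [h0] at hn), hn, div_one]
  · rw [Complex.sin_arg, hn, div_one]

/-- The Galilean group contains the rotation by `O`. -/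
def ContainsRotation (O : Matrix (Fin 3) (Fin 3) ℝ) : Prop :=
  ∃ Φ ∈ galileanGroup, ∀ z, Φ z = (z.1, Fin.cons (z.2 0) (O *ᵥ fun l : Fin 3 => z.2 l.succ))

theorem containsRotation_rot (i : Fin 3) (s : ℝ) : ContainsRotation (rot i s) :=
  ⟨_, mem_galileanGroup_of_flow (opR_mem i) (isSmoothFlow_flowR i) s, fun _ => rfl⟩

theorem ContainsRotation.of_rot_mul {i : Fin 3} {s : ℝ} {O : Matrix (Fin 3) (Fin 3) ℝ}
    (h : ContainsRotation (rot i s * O)) : ContainsRotation O := by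
  obtain ⟨Φ, hΦ, h⟩ := h
  obtain ⟨Ψ, hΨ, h'⟩ := containsRotation_rot i (-s)
  refine ⟨Ψ * Φ, mul_mem hΨ hΦ, fun z => ?_⟩
  rw [Equiv.Perm.mul_apply, h', h]
  simp [Matrix.mulVec_mulVec, ← Matrix.mul_assoc, ← rot_add, rot_zero]

theorem rot_mul_special {i : Fin 3} {s : ℝ} {O : Matrix (Fin 3) (Fin 3) ℝ}
    (h : Oᵀ * O = 1 ∧ O.det = 1) : (rot i s * O)ᵀ * (rot i s * O) = 1 ∧ (rot i s * O).det = 1 := by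
  rw [Matrix.transpose_mul, Matrix.mul_assoc, ← Matrix.mul_assoc _ (rot i s), rot_transpose_mul,
    Matrix.one_mul, Matrix.det_mul, rot_det, one_mul]
  exact h

/-- Euler angles: a rotation about the third axis and then one about the first bring the third
column to `e₃`; what remains fixes `e₃` and is a rotation about the third axis. -/
theorem containsRotation_of_special {O : Matrix (Fin 3) (Fin 3) ℝ}
    (h : Oᵀ * O = 1 ∧ O.det = 1) : ContainsRotation O := by
  have col : ∀ {A : Matrix (Fin 3) (Fin 3) ℝ}, Aᵀ * A = 1 → ∀ l m,
      A 0 l * A 0 m + A 1 l * A 1 m + A 2 l * A 2 m = if l = m then 1 else 0 := fun hA l m => by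
    have := congrFun (congrFun hA l) m
    simpa [Matrix.mul_apply, Fin.sum_univ_three, Matrix.one_apply] using this
  have row : ∀ {A : Matrix (Fin 3) (Fin 3) ℝ}, Aᵀ * A = 1 → ∀ l m,
      A l 0 * A m 0 + A l 1 * A m 1 + A l 2 * A m 2 = if l = m then 1 else 0 := fun {A} hA l m => by
    have hA' : A * Aᵀ = 1 := mul_eq_one_comm.1 hA
    have := congrFun (congrFun hA' l) m
    simpa [Matrix.mul_apply, Fin.sum_univ_three, Matrix.one_apply] using this
  have stepC : ∀ A : Matrix (Fin 3) (Fin 3) ℝ, Aᵀ * A = 1 ∧ A.det = 1 → A 0 2 = 0 → A 1 2 = 0 →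
      A 2 2 = 1 → ContainsRotation A := by
    intro A hA h0 h1 h2
    have r := row hA.1 2 2
    have c00 := col hA.1 0 0
    have c11 := col hA.1 1 1
    have hd := hA.2
    simp only [if_true, h2] at r
    have e0 : A 2 0 = 0 := by nlinarith [sq_nonneg (A 2 0), sq_nonneg (A 2 1)]
    have e1 : A 2 1 = 0 := by nlinarith [sq_nonneg (A 2 0), sq_nonneg (A 2 1)]
    simp only [if_true, e0, e1, mul_zero, add_zero] at c00 c11
    rw [Matrix.det_fin_three, h0, h1, h2, e0, e1] at hd
    -- The columns are unit vectors and the determinant is 1, so `(A 1 1 - A 0 0)² + (A 0 1 + A 1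
    -- 0)² = 1 + 1 - 2 = 0`.
    have f1 : A 1 1 = A 0 0 := by
      nlinarith [sq_nonneg (A 1 1 - A 0 0), sq_nonneg (A 0 1 + A 1 0)]
    have f2 : A 0 1 = -A 1 0 := by
      nlinarith [sq_nonneg (A 1 1 - A 0 0), sq_nonneg (A 0 1 + A 1 0)]
    obtain ⟨θ, hc, hs⟩ := exists_cos_sin (a := A 0 0) (b := A 1 0) (by linarith)
    have e : A = rot 2 θ := by
      ext k l
      fin_cases k <;> fin_cases l <;> simp [rot, hc, hs, h0, h1, h2, e0, e1, f1, f2]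
    rw [e]
    exact containsRotation_rot 2 θ
  have stepB : ∀ A : Matrix (Fin 3) (Fin 3) ℝ, Aᵀ * A = 1 ∧ A.det = 1 → A 0 2 = 0 →
      ContainsRotation A := by
    intro A hA h0
    have c := col hA.1 2 2
    simp only [if_true, h0, mul_zero, zero_add] at c
    obtain ⟨θ, hc, hs⟩ := exists_cos_sin (a := A 2 2) (b := A 1 2) (by linarith)
    refine ContainsRotation.of_rot_mul (i := 0) (s := θ) (stepC _ (rot_mul_special hA) ?_ ?_ ?_)
    · simp [rot, Matrix.mul_apply, Fin.sum_univ_three, h0]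
    · simp [rot, Matrix.mul_apply, Fin.sum_univ_three, hc, hs]
      ring
    · simp [rot, Matrix.mul_apply, Fin.sum_univ_three, hc, hs]
      exact c
  by_cases h0 : O 0 2 = 0
  · exact stepB O h h0
  · have hr : 0 < O 0 2 ^ 2 + O 1 2 ^ 2 := by positivity
    set r := Real.sqrt (O 0 2 ^ 2 + O 1 2 ^ 2)
    have hr2 : r ^ 2 = O 0 2 ^ 2 + O 1 2 ^ 2 := Real.sq_sqrt hr.le
    have hr0 : r ≠ 0 := (Real.sqrt_pos.2 hr).ne'
    -- The angle for which `cos θ · O 0 2 - sin θ · O 1 2 = 0`.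
    obtain ⟨θ, hc, hs⟩ := exists_cos_sin (a := O 1 2 / r) (b := O 0 2 / r) (by
      field_simp
      linarith)
    refine ContainsRotation.of_rot_mul (i := 2) (s := θ) (stepB _ (rot_mul_special h) ?_)
    simp [rot, Matrix.mul_apply, Fin.sum_univ_three, hc, hs]
    ring

theorem exists_mem_galileanGroup_eq_galileanMap {lam μ : ℝ} (hl : 0 < lam) (hμ : 0 < μ) (t₀ : ℝ)
    {O : Matrix (Fin 3) (Fin 3) ℝ} (hO : Oᵀ * O = 1) (hO' : O.det = 1) {α : Fin 3 → ℝ → ℝ}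
    (hα : ∀ k, ContDiff ℝ ∞ (α k)) {β : ℝ → ℝ} (hβ : ContDiff ℝ ∞ β) :
    ∃ Φ ∈ galileanGroup, ∀ z, Φ z = galileanMap lam μ t₀ O α β z := by
  obtain ⟨ΦR, hR, eR⟩ := containsRotation_of_special ⟨hO, hO'⟩
  -- Each of the three `G`-flows at parameter 1 leaves `-α α''/2` in the pressure; the final
  -- `K`-flow restores these terms.
  have hβ' : ContDiff ℝ ∞ fun t => β t + ∑ k, 1 / 2 * α k t * iteratedDeriv 2 (α k) t :=
    hβ.add (ContDiff.sum fun k _ =>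
      (contDiff_const.mul (hα k)).mul (contDiff_iteratedDeriv (hα k) 2))
  have fG := fun k => isSmoothFlow_flowG k (hα k)
  refine ⟨(isSmoothFlow_flowK hβ').equiv 1 * ((fG 0).equiv 1 * ((fG 1).equiv 1 * ((fG 2).equiv 1 *
    (isSmoothFlow_flowT.equiv t₀ * (isSmoothFlow_flowS1.equiv (Real.log lam) *
    (isSmoothFlow_flowS2.equiv (Real.log μ) * ΦR)))))),
    mul_mem (mem_galileanGroup_of_flow (opK_mem hβ') _ _)
    (mul_mem (mem_galileanGroup_of_flow (opG_mem 0 (hα 0)) _ _)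
    (mul_mem (mem_galileanGroup_of_flow (opG_mem 1 (hα 1)) _ _)
    (mul_mem (mem_galileanGroup_of_flow (opG_mem 2 (hα 2)) _ _)
    (mul_mem (mem_galileanGroup_of_flow opT_mem _ _)
    (mul_mem (mem_galileanGroup_of_flow opS1_mem _ _)
    (mul_mem (mem_galileanGroup_of_flow opS2_mem _ _) hR)))))), fun z => ?_⟩
  simp only [Equiv.Perm.mul_apply, eR]
  simp only [IsSmoothFlow.equiv, Equiv.coe_fn_mk]
  have e1 := Real.exp_log hl
  have e2 := Real.exp_log hμ
  apply Z_ext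
  · simp [flowK, flowG, flowT, flowS1, flowS2, galileanMap, e1, e2]
  · simp [flowK, flowG, flowT, flowS1, flowS2, galileanMap, e1, e2]
  · simp [flowK, flowG, flowT, flowS1, flowS2, galileanMap, e1, e2]
    ring
  · simp [flowK, flowG, flowT, flowS1, flowS2, galileanMap, e1, e2]
    ring
  · simp only [flowK, flowG, flowT, flowS1, flowS2, galileanMap, e1, e2, Fin.cons_zero,
      Fin.cons_succ, Fin.sum_univ_three]
    simp
    ring
  · intro k
    simp only [flowK, flowG, flowT, flowS1, flowS2, galileanMap, e1, e2, Fin.cons_succ]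
    fin_cases k <;> simp <;> ring

/-! ### Action on solutions -/

theorem der1_eq {v : Indep → Dep} {x : Indep} (h : DifferentiableAt ℝ v x) (a μ : Fin 4) :
    der1 v x a μ = fderiv ℝ (fun y => v y a) x (Pi.single μ 1) := by
  have h1 := (ContinuousLinearMap.proj (R := ℝ) (φ := fun _ : Fin 4 => ℝ) a).hasFDerivAt.comp x
    h.hasFDerivAt
  exact (congrArg (fun L => L (Pi.single μ 1)) h1.fderiv).symm

theorem contDiffOn_der1 {Ω : Set Indep} (hΩ : IsOpen Ω) {u : Indep → Dep}
    (hu : ContDiffOn ℝ ∞ u Ω) (a μ : Fin 4) : ContDiffOn ℝ ∞ (fun x => der1 u x a μ) Ω :=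
  contDiffOn_pi.1 ((hu.fderiv_of_isOpen hΩ (by simp)).clm_apply contDiffOn_const) a

theorem fderiv_congr_on {Ω : Set Indep} (hΩ : IsOpen Ω) {f g : Indep → ℝ} {x : Indep}
    (hx : x ∈ Ω) (h : ∀ y ∈ Ω, f y = g y) : fderiv ℝ f x = fderiv ℝ g x :=
  Filter.EventuallyEq.fderiv_eq (Filter.eventuallyEq_of_mem (hΩ.mem_nhds hx) h)

theorem system_eq_zero_iff {j : Jet2} :
    system j = 0 ↔ momentum j.1.2 j.2 = 0 ∧ mixedProduct j.1.2 = 1 := by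
  rw [system, Prod.mk_eq_zero, sub_eq_zero]

/-- A transformation that moves the independent variables independently of the dependent ones maps
solutions to solutions as soon as the transformed functions are solutions. -/
theorem mapsSolutionsToSolutions_of_fibered {Φ : Equiv.Perm Z} {A S : Indep → Indep}
    (hS : Continuous S) (hSA : ∀ x, S (A x) = x) (hAS : ∀ x, A (S x) = x)
    (hΦ : ∀ z, (Φ z).1 = A z.1)
    (h : ∀ (Ω : Set Indep) (u : Indep → Dep), IsOpen Ω → IsSolutionOn Ω u →
      IsSolutionOn (S ⁻¹' Ω) fun y => (Φ (S y, u (S y))).2) : MapsSolutionsToSolutions Φ := by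
  intro Ω u hΩ hu
  refine ⟨S ⁻¹' Ω, fun y => (Φ (S y, u (S y))).2, hΩ.preimage hS, h Ω u hΩ hu, ?_⟩
  ext z
  constructor
  · rintro ⟨_, ⟨x, hx, rfl⟩, rfl⟩
    refine ⟨A x, by simpa [hSA] using hx, ?_⟩
    exact Prod.ext (hΦ (x, u x)).symm (by simp [hSA])
  · rintro ⟨y, hy, rfl⟩
    refine ⟨(S y, u (S y)), ⟨S y, hy, rfl⟩, ?_⟩
    exact Prod.ext ((hΦ _).trans (hAS y)) rfl

theorem mapsSolutionsToSolutions_one : MapsSolutionsToSolutions 1 := fun Ω u hΩ hu =>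
  ⟨Ω, u, hΩ, hu, by simp⟩

theorem MapsSolutionsToSolutions.mul {Φ Ψ : Equiv.Perm Z} (hΦ : MapsSolutionsToSolutions Φ)
    (hΨ : MapsSolutionsToSolutions Ψ) : MapsSolutionsToSolutions (Φ * Ψ) := by
  intro Ω u hΩ hu
  obtain ⟨Ω', v, hΩ', hv, e⟩ := hΨ Ω u hΩ hu
  obtain ⟨Ω'', w, hΩ'', hw, e'⟩ := hΦ Ω' v hΩ' hv
  refine ⟨Ω'', w, hΩ'', hw, ?_⟩
  rw [← e', ← e, Equiv.Perm.coe_mul, Set.image_comp]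

/-! ### Reparametrizations -/

/-- The mixed product and the components of the pressure force, such as `∂(P, γ², γ³)/∂(ξ¹, ξ²,
ξ³)`, are Jacobian determinants, so they are multiplied by the Jacobian 1 of the label change. The
wave operator contains only `∂_t` and `∂_{ξ¹}`, which are unaffected. -/
theorem momentum_reparam {p p' : D1} {q q' : D2} {a₂ a₃ b₂ b₃ c₂ c₃ : ℝ}
    (hdet : b₂ * c₃ - c₂ * b₃ = 1) (h1 : ∀ a, p' a 1 = p a 1)
    (h2 : ∀ a, p' a 2 = a₂ * p a 1 + b₂ * p a 2 + c₂ * p a 3)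
    (h3 : ∀ a, p' a 3 = a₃ * p a 1 + b₃ * p a 2 + c₃ * p a 3)
    (q0 : ∀ a, q' a 0 0 = q a 0 0) (q1 : ∀ a, q' a 1 1 = q a 1 1) :
    momentum p' q' = momentum p q ∧ mixedProduct p' = mixedProduct p := by
  constructor
  · funext k
    fin_cases k <;> simp [momentum, gradγ, cross_apply, h1, h2, h3, q0, q1]
    · linear_combination (p 0 1 * (p 2 2 * p 3 3 - p 3 2 * p 2 3)
        + p 0 2 * (p 2 3 * p 3 1 - p 3 3 * p 2 1)
        + p 0 3 * (p 2 1 * p 3 2 - p 3 1 * p 2 2)) * hdet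
    · linear_combination (p 0 1 * (p 3 2 * p 1 3 - p 1 2 * p 3 3)
        + p 0 2 * (p 3 3 * p 1 1 - p 1 3 * p 3 1)
        + p 0 3 * (p 3 1 * p 1 2 - p 1 1 * p 3 2)) * hdet
    · linear_combination (p 0 1 * (p 1 2 * p 2 3 - p 2 2 * p 1 3)
        + p 0 2 * (p 1 3 * p 2 1 - p 2 3 * p 1 1)
        + p 0 3 * (p 1 1 * p 2 2 - p 2 1 * p 1 2)) * hdet
  · have e := mixedProduct_eq p
    rw [mixedProduct_eq p']
    simp only [h1, h2, h3]
    linear_combination (p 1 1 * (p 2 2 * p 3 3 - p 3 2 * p 2 3)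
      + p 2 1 * (p 3 2 * p 1 3 - p 1 2 * p 3 3) + p 3 1 * (p 1 2 * p 2 3 - p 2 2 * p 1 3)) * hdet - e

theorem isSolutionOn_reparam {a : ℝ × ℝ → ℝ} {σ : ℝ × ℝ → ℝ × ℝ} (ha : ContDiff ℝ ∞ a)
    (hσ : ContDiff ℝ ∞ σ) (hdet : ∀ y, (fderiv ℝ σ y).det = 1) {Ω : Set Indep} {u : Indep → Dep}
    (hΩ : IsOpen Ω) (hu : IsSolutionOn Ω u) {S : Indep → Indep}
    (hS : ∀ x, S x = ![x 0, x 1 + a (x 2, x 3), (σ (x 2, x 3)).1, (σ (x 2, x 3)).2]) :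
    IsSolutionOn (S ⁻¹' Ω) fun y => u (S y) := by
  let pr : Fin 4 → Indep →L[ℝ] ℝ := fun μ =>
    ContinuousLinearMap.proj (R := ℝ) (φ := fun _ : Fin 4 => ℝ) μ
  let pY : Indep →L[ℝ] ℝ × ℝ := (pr 2).prod (pr 3)
  have hSs : ContDiff ℝ ∞ S := by
    rw [contDiff_pi, forall_fin_four]
    have h1 := ha.comp pY.contDiff
    have h2 := hσ.comp pY.contDiff
    refine ⟨?_, ?_, ?_, ?_⟩ <;> simp only [hS]
    exacts [(pr 0).contDiff, (pr 1).contDiff.add h1, h2.fst, h2.snd]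
  let D : Indep → Indep →L[ℝ] Indep := fun x => ContinuousLinearMap.pi
    ![pr 0, pr 1 + (fderiv ℝ a (x 2, x 3)).comp pY,
      (ContinuousLinearMap.fst ℝ ℝ ℝ).comp ((fderiv ℝ σ (x 2, x 3)).comp pY),
      (ContinuousLinearMap.snd ℝ ℝ ℝ).comp ((fderiv ℝ σ (x 2, x 3)).comp pY)]
  have hD : ∀ x, HasFDerivAt S (D x) x := fun x => by
    have h1 := (ha.differentiable (by simp) (x 2, x 3)).hasFDerivAt.comp x pY.hasFDerivAt
    have h2 := (hσ.differentiable (by simp) (x 2, x 3)).hasFDerivAt.comp x pY.hasFDerivAt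
    rw [hasFDerivAt_pi', forall_fin_four]
    refine ⟨?_, ?_, ?_, ?_⟩ <;> simp only [hS]
    exacts [(pr 0).hasFDerivAt, (pr 1).hasFDerivAt.add h1, h2.fst, h2.snd]
  have hΩ' : IsOpen (S ⁻¹' Ω) := hΩ.preimage hSs.continuous
  have hv : ContDiffOn ℝ ∞ (fun y => u (S y)) (S ⁻¹' Ω) :=
    hu.1.comp hSs.contDiffOn fun y hy => hy
  have chain : ∀ {f : Indep → ℝ}, ContDiffOn ℝ ∞ f Ω → ∀ x ∈ S ⁻¹' Ω, ∀ w,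
      fderiv ℝ (fun y => f (S y)) x w = fderiv ℝ f (S x) (D x w) := fun hf x hx w => by
    have h1 := (differentiableAt_of_contDiffOn hΩ hf hx).hasFDerivAt.comp x (hD x)
    exact congrArg (fun L => L w) h1.fderiv
  have e0 : ∀ x, D x (Pi.single 0 1) = Pi.single 0 1 := fun x => by
    ext i
    fin_cases i <;> simp [D, pr, pY, Prod.mk_zero_zero]
  have e1 : ∀ x, D x (Pi.single 1 1) = Pi.single 1 1 := fun x => by
    ext i
    fin_cases i <;> simp [D, pr, pY, Prod.mk_zero_zero]
  have e2 : ∀ x, D x (Pi.single 2 1) = fderiv ℝ a (x 2, x 3) (1, 0) • Pi.single 1 1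
      + (fderiv ℝ σ (x 2, x 3) (1, 0)).1 • Pi.single 2 1
      + (fderiv ℝ σ (x 2, x 3) (1, 0)).2 • Pi.single 3 1 := fun x => by
    ext i
    fin_cases i <;> simp [D, pr, pY]
  have e3 : ∀ x, D x (Pi.single 3 1) = fderiv ℝ a (x 2, x 3) (0, 1) • Pi.single 1 1
      + (fderiv ℝ σ (x 2, x 3) (0, 1)).1 • Pi.single 2 1
      + (fderiv ℝ σ (x 2, x 3) (0, 1)).2 • Pi.single 3 1 := fun x => by
    ext i
    fin_cases i <;> simp [D, pr, pY]
  have du : ∀ x ∈ Ω, DifferentiableAt ℝ u x := fun x hx => differentiableAt_of_contDiffOn hΩ hu.1 hx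
  have hv1 : ∀ x ∈ S ⁻¹' Ω, ∀ b μ, der1 (fun y => u (S y)) x b μ
      = fderiv ℝ (fun y => u y b) (S x) (D x (Pi.single μ 1)) := fun x hx b μ => by
    rw [der1_eq (differentiableAt_of_contDiffOn hΩ' hv hx)]
    exact chain (contDiffOn_pi.1 hu.1 b) x hx _
  have hp : ∀ x ∈ S ⁻¹' Ω, ∀ b μ,
      fderiv ℝ (fun y => u y b) (S x) (Pi.single μ 1) = der1 u (S x) b μ := fun x hx b μ =>
    (der1_eq (du _ hx) b μ).symm
  have hp0 : ∀ x ∈ S ⁻¹' Ω, ∀ b, der1 (fun y => u (S y)) x b 0 = der1 u (S x) b 0 :=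
    fun x hx b => by rw [hv1 x hx, e0, hp x hx]
  have hp1 : ∀ x ∈ S ⁻¹' Ω, ∀ b, der1 (fun y => u (S y)) x b 1 = der1 u (S x) b 1 :=
    fun x hx b => by rw [hv1 x hx, e1, hp x hx]
  refine ⟨hv, fun x hx => ?_⟩
  have hd := hdet (x 2, x 3)
  rw [plane_det_eq] at hd
  obtain ⟨m1, m2⟩ := system_eq_zero_iff.1 (hu.2 (S x) hx)
  have key := momentum_reparam (p := der1 u (S x)) (p' := der1 (fun y => u (S y)) x)
    (q := (jet2 u (S x)).2) (q' := (jet2 (fun y => u (S y)) x).2) hd (hp1 x hx)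
    (fun b => by rw [hv1 x hx, e2, map_add, map_add, map_smul, map_smul, map_smul, hp x hx,
      hp x hx, hp x hx]; rfl)
    (fun b => by rw [hv1 x hx, e3, map_add, map_add, map_smul, map_smul, map_smul, hp x hx,
      hp x hx, hp x hx]; rfl)
    (fun b => by
      simp only [jet2]
      rw [fderiv_congr_on hΩ' hx fun y hy => hp0 y hy b,
        chain (contDiffOn_der1 hΩ hu.1 b 0) x hx, e0])
    (fun b => by
      simp only [jet2]
      rw [fderiv_congr_on hΩ' hx fun y hy => hp1 y hy b,
        chain (contDiffOn_der1 hΩ hu.1 b 1) x hx, e1])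
  exact system_eq_zero_iff.2 ⟨key.1.trans m1, key.2.trans m2⟩

theorem mapsSolutionsToSolutions_of_mem_reparamGroup {Φ : Equiv.Perm Z} (h : Φ ∈ reparamGroup) :
    MapsSolutionsToSolutions Φ := by
  obtain ⟨a, σ, ha, hσ, rfl⟩ := mem_reparamGroup_iff.1 h
  have h' := hσ.inv
  let S : Indep → Indep := fun x => (reparamMap (fun y => -a (σ.symm y)) σ.symm (x, 0)).1
  let A : Indep → Indep := fun x => (reparamMap a σ (x, 0)).1
  have ha' : ContDiff ℝ ∞ (fun y => -a (σ.symm y)) := (ha.comp hσ.2.1).neg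
  refine mapsSolutionsToSolutions_of_fibered (A := A) (S := S) ?_ (fun x => ?_) (fun x => ?_)
    (fun z => rfl) fun Ω u hΩ hu => isSolutionOn_reparam ha' h'.1 h'.2.2 hΩ hu fun x => rfl
  · have h1 := contDiff_reparamMap_param (a := fun q => -a (σ.symm q.2)) (σ := fun q => σ.symm q.2)
      (ha'.comp contDiff_snd) (hσ.2.1.comp contDiff_snd)
    have h2 : Continuous fun x : Indep => ((0, (x, 0)) : ℝ × Z) := by fun_prop
    exact continuous_fst.comp (h1.continuous.comp h2)
  · exact congrArg Prod.fst ((reparamEquiv a σ).symm_apply_apply (x, 0))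
  · exact congrArg Prod.fst ((reparamEquiv a σ).apply_symm_apply (x, 0))

/-! ### Galilean transformations -/

/-- The cross product transforms by the cofactor matrix, and a rotation is its own cofactor matrix.
-/
theorem mulVec_cross_mulVec {O : Matrix (Fin 3) (Fin 3) ℝ} (hO : Oᵀ * O = 1) (hO' : O.det = 1)
    (v w : Fin 3 → ℝ) : (O *ᵥ v) ⨯₃ (O *ᵥ w) = O *ᵥ (v ⨯₃ w) := by
  have h1 : O.adjugate = Oᵀ := by
    have h2 : O.adjugate * O = 1 := by rw [Matrix.adjugate_mul, hO', one_smul]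
    calc O.adjugate = O.adjugate * (O * Oᵀ) := by rw [mul_eq_one_comm.1 hO, Matrix.mul_one]
      _ = Oᵀ := by rw [← Matrix.mul_assoc, h2, Matrix.one_mul]
  have h2 : ∀ k l, O k l = O.adjugate l k := fun k l => by rw [h1]; rfl
  have h3 : ∀ (x : Fin 3 → ℝ) k, (O *ᵥ x) k = O k 0 * x 0 + O k 1 * x 1 + O k 2 * x 2 :=
    fun x k => by simp [Matrix.mulVec, dotProduct, Fin.sum_univ_three]
  ext k
  rw [h3, h2 k, h2 k, h2 k]
  fin_cases k <;> simp [Matrix.adjugate_fin_three, cross_apply, h3] <;> ring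

/-- Expansion in the reciprocal basis. It shows that the pressure shift `-γ · α''` exerts exactly
the force that cancels the acceleration `α''` of a moving frame. -/
theorem dot_cross_expansion (v₁ v₂ v₃ a : Fin 3 → ℝ) :
    (v₁ ⬝ᵥ a) • (v₂ ⨯₃ v₃) + (v₂ ⬝ᵥ a) • (v₃ ⨯₃ v₁) + (v₃ ⬝ᵥ a) • (v₁ ⨯₃ v₂)
      = (v₁ ⬝ᵥ (v₂ ⨯₃ v₃)) • a := by
  ext k
  fin_cases k <;> simp [cross_apply, dotProduct, Fin.sum_univ_three] <;> ring

/-- Here `m` scales `γ`, `ν` scales `P`, `c₁` scales `∂_t` and `∂_{ξ¹}`, and `c₂` scales `∂_{ξ²}`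
and `∂_{ξ³}`. The relation `hm` keeps the mixed product equal to 1, `hν` makes the pressure force
scale like the acceleration, and `a` is the acceleration of the frame. -/
theorem momentum_galilean {p p' : D1} {q q' : D2} {O : Matrix (Fin 3) (Fin 3) ℝ}
    (hO : Oᵀ * O = 1) (hO' : O.det = 1) {a : Fin 3 → ℝ} {c₁ c₂ m ν : ℝ} (hm : m ^ 3 * (c₁ * c₂ ^ 2) = 1)
    (hν : ν * m ^ 2 * (c₁ * c₂ ^ 2) = c₁ ^ 2 * m)
    (h1 : gradγ p' 1 = (c₁ * m) • (O *ᵥ gradγ p 1))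
    (h2 : gradγ p' 2 = (c₂ * m) • (O *ᵥ gradγ p 2))
    (h3 : gradγ p' 3 = (c₂ * m) • (O *ᵥ gradγ p 3))
    (k1 : p' 0 1 = c₁ * (ν * p 0 1 - m * ((O *ᵥ gradγ p 1) ⬝ᵥ a)))
    (k2 : p' 0 2 = c₂ * (ν * p 0 2 - m * ((O *ᵥ gradγ p 2) ⬝ᵥ a)))
    (k3 : p' 0 3 = c₂ * (ν * p 0 3 - m * ((O *ᵥ gradγ p 3) ⬝ᵥ a)))
    (q0 : (fun k : Fin 3 => q' k.succ 0 0) = (c₁ ^ 2 * m) • (O *ᵥ fun k => q k.succ 0 0) + a)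
    (q1 : (fun k : Fin 3 => q' k.succ 1 1) = (c₁ ^ 2 * m) • (O *ᵥ fun k => q k.succ 1 1))
    (hmix : mixedProduct p = 1) :
    momentum p' q' = (c₁ ^ 2 * m) • (O *ᵥ momentum p q) ∧ mixedProduct p' = 1 := by
  have hdet : (O *ᵥ gradγ p 1) ⬝ᵥ ((O *ᵥ gradγ p 2) ⨯₃ (O *ᵥ gradγ p 3)) = 1 := by
    rw [mulVec_cross_mulVec hO hO', Matrix.dotProduct_mulVec, Matrix.vecMul_mulVec, hO,
      Matrix.vecMul_one]
    exact hmix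
  have hexp := dot_cross_expansion (O *ᵥ gradγ p 1) (O *ᵥ gradγ p 2) (O *ᵥ gradγ p 3) a
  rw [hdet, one_smul] at hexp
  constructor
  · simp only [momentum, h1, h2, h3, k1, k2, k3, q0, q1, Matrix.mulVec_add, Matrix.mulVec_sub,
      Matrix.mulVec_smul, ← mulVec_cross_mulVec hO hO']
    funext k
    have hk := congrFun hexp k
    simp only [map_smul, LinearMap.smul_apply, Pi.add_apply, Pi.sub_apply, Pi.smul_apply,
      smul_eq_mul] at hk ⊢
    generalize (O *ᵥ gradγ p 1) ⬝ᵥ a = d1 at *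
    generalize (O *ᵥ gradγ p 2) ⬝ᵥ a = d2 at *
    generalize (O *ᵥ gradγ p 3) ⬝ᵥ a = d3 at *
    generalize ((O *ᵥ gradγ p 2) ⨯₃ (O *ᵥ gradγ p 3)) k = x1 at *
    generalize ((O *ᵥ gradγ p 3) ⨯₃ (O *ᵥ gradγ p 1)) k = x2 at *
    generalize ((O *ᵥ gradγ p 1) ⨯₃ (O *ᵥ gradγ p 2)) k = x3 at *
    linear_combination (p 0 1 * x1 + p 0 2 * x2 + p 0 3 * x3) * hν
      - (d1 * x1 + d2 * x2 + d3 * x3) * hm - hk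
  · rw [mixedProduct, h1, h2, h3]
    simp only [map_smul, LinearMap.smul_apply, smul_dotProduct, dotProduct_smul, smul_eq_mul, hdet]
    linear_combination hm

theorem isSolutionOn_galilean {lam μ t₀ : ℝ} (hl : 0 < lam) (hμ : 0 < μ)
    {O : Matrix (Fin 3) (Fin 3) ℝ} (hO : Oᵀ * O = 1) (hO' : O.det = 1) {α : Fin 3 → ℝ → ℝ}
    (hα : ∀ k, ContDiff ℝ ∞ (α k)) {β : ℝ → ℝ} (hβ : ContDiff ℝ ∞ β) {Ω : Set Indep}
    {u : Indep → Dep} (hΩ : IsOpen Ω) (hu : IsSolutionOn Ω u) {S : Indep → Indep}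
    (hS : ∀ x, S x = ![lam⁻¹ * (x 0 - t₀), lam⁻¹ * x 1, (lam * μ ^ 3)⁻¹ * x 2,
      (lam * μ ^ 3)⁻¹ * x 3]) :
    IsSolutionOn (S ⁻¹' Ω) fun y => (galileanMap lam μ t₀ O α β (S y, u (S y))).2 := by
  let pr : Fin 4 → Indep →L[ℝ] ℝ := fun μ =>
    ContinuousLinearMap.proj (R := ℝ) (φ := fun _ : Fin 4 => ℝ) μ
  set m := lam * μ ^ 2 with hm
  set c₁ := lam⁻¹ with hc₁
  set c₂ := (lam * μ ^ 3)⁻¹ with hc₂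
  have hSs : ContDiff ℝ ∞ S := by
    rw [contDiff_pi, forall_fin_four]
    refine ⟨?_, ?_, ?_, ?_⟩ <;> simp only [hS]
    exacts [contDiff_const.mul ((pr 0).contDiff.sub contDiff_const),
      contDiff_const.mul (pr 1).contDiff, contDiff_const.mul (pr 2).contDiff,
      contDiff_const.mul (pr 3).contDiff]
  let D : Indep →L[ℝ] Indep :=
    ContinuousLinearMap.pi ![c₁ • pr 0, c₁ • pr 1, c₂ • pr 2, c₂ • pr 3]
  have hD : ∀ x, HasFDerivAt S D x := fun x => by
    rw [hasFDerivAt_pi', forall_fin_four]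
    refine ⟨?_, ?_, ?_, ?_⟩ <;> simp only [hS]
    exacts [((pr 0).hasFDerivAt.sub_const t₀).const_mul c₁, (pr 1).hasFDerivAt.const_mul c₁,
      (pr 2).hasFDerivAt.const_mul c₂, (pr 3).hasFDerivAt.const_mul c₂]
  have hΩ' : IsOpen (S ⁻¹' Ω) := hΩ.preimage hSs.continuous
  have e0 : D (Pi.single 0 1) = c₁ • Pi.single 0 1 := by
    ext i
    fin_cases i <;> simp [D, pr]
  have e1 : D (Pi.single 1 1) = c₁ • Pi.single 1 1 := by
    ext i
    fin_cases i <;> simp [D, pr]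
  have e2 : D (Pi.single 2 1) = c₂ • Pi.single 2 1 := by
    ext i
    fin_cases i <;> simp [D, pr]
  have e3 : D (Pi.single 3 1) = c₂ • Pi.single 3 1 := by
    ext i
    fin_cases i <;> simp [D, pr]
  have hS0 : ∀ y, lam * S y 0 + t₀ = y 0 := fun y => by
    simp only [hS, hc₁, Matrix.cons_val_zero]
    field_simp
    ring
  let v : Indep → Dep := fun y => Fin.cons (μ ^ 4 * u (S y) 0
      - ∑ k, (m * (∑ l, O k l * u (S y) l.succ)) * iteratedDeriv 2 (α k) (y 0) + β (y 0))
    fun k => m * (∑ l, O k l * u (S y) l.succ) + α k (y 0)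
  have hv : (fun y => (galileanMap lam μ t₀ O α β (S y, u (S y))).2) = v := by
    funext y
    simp only [galileanMap, hS0]
    rfl
  rw [hv]
  have sα := fun k => contDiff_iteratedDeriv (hα k) 2
  have hus : ∀ b, ContDiffOn ℝ ∞ (fun x => u x b) Ω := fun b => contDiffOn_pi.1 hu.1 b
  have comp : ∀ {f : Indep → ℝ}, ContDiffOn ℝ ∞ f Ω → ContDiffOn ℝ ∞ (fun y => f (S y)) (S ⁻¹' Ω) :=
    fun hf => hf.comp hSs.contDiffOn fun y hy => hy
  have time : ∀ {g : ℝ → ℝ}, ContDiff ℝ ∞ g → ContDiffOn ℝ ∞ (fun y : Indep => g (y 0)) (S ⁻¹' Ω) :=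
    fun hg => (hg.comp (pr 0).contDiff).contDiffOn
  have chain : ∀ {f : Indep → ℝ}, ContDiffOn ℝ ∞ f Ω → ∀ x ∈ S ⁻¹' Ω,
      HasFDerivAt (fun y => f (S y)) ((fderiv ℝ f (S x)).comp D) x := fun hf x hx =>
    (differentiableAt_of_contDiffOn hΩ hf hx).hasFDerivAt.comp x (hD x)
  have timeD : ∀ {g : ℝ → ℝ}, ContDiff ℝ ∞ g → ∀ x : Indep,
      HasFDerivAt (fun y : Indep => g (y 0)) (deriv g (x 0) • pr 0) x := fun hg x =>
    (hg.differentiable (by simp) (x 0)).hasDerivAt.comp_hasFDerivAt x (pr 0).hasFDerivAt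
  have lin : ∀ {f : Fin 3 → Indep → ℝ} {g : ℝ → ℝ}, (∀ l, ContDiffOn ℝ ∞ (f l) Ω) →
      ContDiff ℝ ∞ g → ∀ (κ : ℝ) (k : Fin 3), ∀ x ∈ S ⁻¹' Ω,
      HasFDerivAt (fun y => κ * (∑ l, O k l * f l (S y)) + g (y 0))
        (κ • (∑ l, O k l • (fderiv ℝ (f l) (S x)).comp D) + deriv g (x 0) • pr 0) x :=
    fun hf hg κ k x hx =>
      ((HasFDerivAt.fun_sum fun l _ => (chain (hf l) x hx).const_mul (O k l)).const_mul κ).add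
        (timeD hg x)
  have hlin : ∀ k, ContDiffOn ℝ ∞ (fun y => m * ∑ l, O k l * u (S y) (Fin.succ l)) (S ⁻¹' Ω) :=
    fun k => contDiffOn_const.mul (ContDiffOn.sum fun l _ => contDiffOn_const.mul (comp (hus _)))
  have hvs : ContDiffOn ℝ ∞ v (S ⁻¹' Ω) := by
    rw [contDiffOn_pi, Fin.forall_fin_succ]
    refine ⟨?_, fun k => (hlin k).add (time (hα k))⟩
    exact ((contDiffOn_const.mul (comp (hus 0))).sub
      (ContDiffOn.sum fun k _ => (hlin k).mul (time (sα k)))).add (time hβ)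
  have dv := fun x (hx : x ∈ S ⁻¹' Ω) => differentiableAt_of_contDiffOn hΩ' hvs hx
  have hp : ∀ x ∈ S ⁻¹' Ω, ∀ b ν,
      fderiv ℝ (fun y => u y b) (S x) (Pi.single ν 1) = der1 u (S x) b ν := fun x hx b ν =>
    (der1_eq (differentiableAt_of_contDiffOn hΩ hu.1 hx) b ν).symm
  -- The inverse label map is diagonal, so each coordinate derivative is merely multiplied by its
  -- scale `c`. The last summand is present only for the time derivative.
  have pγ : ∀ x ∈ S ⁻¹' Ω, ∀ (k : Fin 3) (ν : Fin 4) (c : ℝ), D (Pi.single ν 1) = c • Pi.single ν 1 →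
      der1 v x k.succ ν = c * m * (∑ l, O k l * der1 u (S x) l.succ ν)
        + deriv (α k) (x 0) * (Pi.single ν 1 : Indep) 0 := fun x hx k ν c hc => by
    have h1 := lin (fun l => hus l.succ) (hα k) m k x hx
    rw [der1_eq (dv x hx)]
    refine (congrArg (fun L => L (Pi.single ν 1)) h1.fderiv).trans ?_
    simp only [add_apply, smul_apply, sum_apply, ContinuousLinearMap.comp_apply, hc, map_smul,
      hp x hx, smul_eq_mul]
    congr 1
    simp only [Finset.mul_sum]
    refine Finset.sum_congr rfl fun l _ => ?_
    ring
  have pP : ∀ x ∈ S ⁻¹' Ω, ∀ (ν : Fin 4) (c : ℝ), ν ≠ 0 → D (Pi.single ν 1) = c • Pi.single ν 1 →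
      der1 v x 0 ν = c * (μ ^ 4 * der1 u (S x) 0 ν
        - m * ((O *ᵥ gradγ (der1 u (S x)) ν) ⬝ᵥ fun k => iteratedDeriv 2 (α k) (x 0))) :=
    fun x hx ν c hν hc => by
    have h1 := (((chain (hus 0) x hx).const_mul (μ ^ 4)).sub (HasFDerivAt.fun_sum
      (u := Finset.univ) fun k _ => ((HasFDerivAt.fun_sum (u := Finset.univ)
        fun l _ => (chain (hus (Fin.succ l)) x hx).const_mul (O k l)).const_mul m).mul
        (timeD (sα k) x))).add (timeD hβ x)
    rw [der1_eq (dv x hx)]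
    refine (congrArg (fun L => L (Pi.single ν 1)) h1.fderiv).trans ?_
    have h0 : pr 0 (Pi.single ν 1) = 0 := Pi.single_eq_of_ne hν.symm 1
    simp only [add_apply, sub_apply, smul_apply, ContinuousLinearMap.comp_apply, hc,
      map_smul, hp x hx, smul_eq_mul, h0, Fin.sum_univ_three, Matrix.mulVec, dotProduct, gradγ]
    ring
  refine ⟨hvs, fun x hx => ?_⟩
  obtain ⟨m1, m2⟩ := system_eq_zero_iff.1 (hu.2 (S x) hx)
  have key := momentum_galilean (p := der1 u (S x)) (p' := der1 v x)
    (q := (jet2 u (S x)).2) (q' := (jet2 v x).2) hO hO'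
    (a := fun k => iteratedDeriv 2 (α k) (x 0)) (c₁ := c₁) (c₂ := c₂) (m := m) (ν := μ ^ 4)
    (by rw [hm, hc₁, hc₂]; field_simp) (by rw [hm, hc₁, hc₂]; field_simp)
    (funext fun k => by
      refine (pγ x hx k 1 c₁ e1).trans ?_
      simp [Matrix.mulVec, dotProduct, gradγ])
    (funext fun k => by
      refine (pγ x hx k 2 c₂ e2).trans ?_
      simp [Matrix.mulVec, dotProduct, gradγ])
    (funext fun k => by
      refine (pγ x hx k 3 c₂ e3).trans ?_
      simp [Matrix.mulVec, dotProduct, gradγ])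
    (pP x hx 1 c₁ (by decide) e1) (pP x hx 2 c₂ (by decide) e2) (pP x hx 3 c₂ (by decide) e3)
    (funext fun k => by
      simp only [jet2]
      rw [fderiv_congr_on hΩ' hx fun y hy => pγ y hy k 0 c₁ e0]
      simp only [Pi.single_eq_same, mul_one]
      rw [(lin (fun l => contDiffOn_der1 hΩ hu.1 l.succ 0)
        (by simpa using contDiff_iteratedDeriv (hα k) 1) (c₁ * m) k x hx).fderiv]
      simp only [add_apply, smul_apply, sum_apply, ContinuousLinearMap.comp_apply, e0, map_smul,
        smul_eq_mul, Pi.add_apply, Pi.smul_apply, Matrix.mulVec, dotProduct, Finset.mul_sum]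
      have h0 : pr 0 (Pi.single 0 1) = 1 := by simp [pr]
      rw [iteratedDeriv_succ, iteratedDeriv_one, h0, mul_one]
      congr 1
      exact Finset.sum_congr rfl fun l _ => by ring)
    (funext fun k => by
      simp only [jet2]
      rw [fderiv_congr_on hΩ' hx fun y hy => pγ y hy k 1 c₁ e1]
      have h0 : (Pi.single 1 1 : Indep) 0 = 0 := by simp
      simp only [h0, mul_zero]
      rw [(lin (g := fun _ => 0) (fun l => contDiffOn_der1 hΩ hu.1 l.succ 1)
        contDiff_const (c₁ * m) k x hx).fderiv]
      simp only [add_apply, smul_apply, sum_apply, ContinuousLinearMap.comp_apply, e1, map_smul,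
        smul_eq_mul, Pi.smul_apply, Matrix.mulVec, dotProduct, Finset.mul_sum]
      rw [deriv_const, zero_mul, add_zero]
      exact Finset.sum_congr rfl fun l _ => by ring) m2
  refine system_eq_zero_iff.2 ⟨key.1.trans ?_, key.2⟩
  have m3 : momentum (der1 u (S x)) (jet2 u (S x)).2 = 0 := m1
  rw [m3, Matrix.mulVec_zero, smul_zero]

theorem IsGalileanTransformation.mapsSolutionsToSolutions {Φ : Equiv.Perm Z}
    (h : IsGalileanTransformation Φ) : MapsSolutionsToSolutions Φ := by
  obtain ⟨lam, μ, t₀, O, α, β, hl, hμ, hO, hO', hα, hβ, h⟩ := h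
  let S : Indep → Indep := fun x => ![lam⁻¹ * (x 0 - t₀), lam⁻¹ * x 1, (lam * μ ^ 3)⁻¹ * x 2,
      (lam * μ ^ 3)⁻¹ * x 3]
  let A : Indep → Indep := fun x => ![lam * x 0 + t₀, lam * x 1, lam * μ ^ 3 * x 2,
    lam * μ ^ 3 * x 3]
  refine mapsSolutionsToSolutions_of_fibered (A := A) (S := S) ?_ (fun x => ?_) (fun x => ?_)
    (fun z => by rw [h]; rfl) fun Ω u hΩ hu => ?_
  · refine continuous_pi fun i => ?_
    fin_cases i <;> simp [S] <;> fun_prop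
  · funext i
    fin_cases i <;> simp [S, A, hl.ne'] <;> field_simp
  · funext i
    fin_cases i <;> simp [S, A, hl.ne'] <;> field_simp
  · simp only [h]
    exact isSolutionOn_galilean hl hμ hO hO' hα hβ hΩ hu fun x => rfl

/-! ### Normality and trivial intersection -/

/-- The group of transformations that act on the independent variables by a translation of the time
and positive scalings, and on the dependent variables in a way that depends on the time only. -/
def scalingGroup : Subgroup (Equiv.Perm Z) where
  carrier := {h | ∃ lam κ t₀ : ℝ, 0 < lam ∧ 0 < κ ∧
    (∀ z, (h z).1 = ![lam * z.1 0 + t₀, lam * z.1 1, κ * z.1 2, κ * z.1 3]) ∧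
    ∀ z w, z.1 0 = w.1 0 → z.2 = w.2 → (h z).2 = (h w).2}
  one_mem' := by
    refine ⟨1, 1, 0, one_pos, one_pos, fun z => ?_, fun z w _ h => h⟩
    funext i
    fin_cases i <;> simp
  mul_mem' := by
    rintro h g ⟨lam, κ, t₀, hl, hκ, h1, h2⟩ ⟨lam', κ', t₀', hl', hκ', g1, g2⟩
    refine ⟨lam * lam', κ * κ', lam * t₀' + t₀, mul_pos hl hl', mul_pos hκ hκ', fun z => ?_,
      fun z w e1 e2 => ?_⟩
    · rw [Equiv.Perm.mul_apply, h1, g1]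
      funext i
      fin_cases i <;> simp <;> ring
    · refine h2 _ _ ?_ (g2 z w e1 e2)
      rw [g1, g1]
      simp [e1]
  inv_mem' := by
    rintro h ⟨lam, κ, t₀, hl, hκ, h1, h2⟩
    have inv : ∀ z, h (h⁻¹ z) = z := fun z => h.apply_symm_apply z
    have key : ∀ z, (h⁻¹ z).1 = ![lam⁻¹ * z.1 0 + -(lam⁻¹ * t₀), lam⁻¹ * z.1 1, κ⁻¹ * z.1 2,
        κ⁻¹ * z.1 3] := fun z => by
      have e := h1 (h⁻¹ z)
      rw [inv] at e
      rw [e]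
      funext i
      fin_cases i <;> simp [hl.ne', hκ.ne', mul_add]
    refine ⟨lam⁻¹, κ⁻¹, -(lam⁻¹ * t₀), inv_pos.2 hl, inv_pos.2 hκ, key, fun z w e1 e2 => ?_⟩
    have e3 : (h ((h⁻¹ w).1, (h⁻¹ z).2)) = (w.1, z.2) := by
      refine Prod.ext ?_ ?_
      · rw [h1, ← h1 (h⁻¹ w), inv]
      · rw [h2 ((h⁻¹ w).1, (h⁻¹ z).2) (h⁻¹ z) (by
          simp only [key]
          simp [e1]) rfl, inv]
    have e4 : (w.1, z.2) = w := Prod.ext rfl e2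
    rw [e4, ← Equiv.Perm.eq_inv_iff_eq] at e3
    have e5 := congrArg Prod.snd e3
    exact e5

theorem galileanGroup_le_scalingGroup : galileanGroup ≤ scalingGroup := by
  refine galileanGroup_le_of fun Φ hΦ _ => ?_
  obtain ⟨lam, μ, t₀, O, α, β, hl, hμ, -, -, -, -, h⟩ := hΦ
  refine ⟨lam, lam * μ ^ 3, t₀, hl, by positivity, fun z => by rw [h]; rfl, fun z w e1 e2 => ?_⟩
  rw [h, h]
  simp [galileanMap, e1, e2]

/-- The homothety of the plane with nonzero ratio. -/
noncomputable def planeScaling {κ : ℝ} (hκ : κ ≠ 0) : Equiv.Perm (ℝ × ℝ) where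
  toFun y := κ • y
  invFun y := κ⁻¹ • y
  left_inv y := inv_smul_smul₀ hκ y
  right_inv y := smul_inv_smul₀ hκ y

theorem IsUnimodular.conj_planeScaling {σ : Equiv.Perm (ℝ × ℝ)} (hσ : IsUnimodular σ) {κ : ℝ}
    (hκ : κ ≠ 0) : IsUnimodular (planeScaling hκ * σ * (planeScaling hκ)⁻¹) := by
  have hs : ∀ c : ℝ, ContDiff ℝ ∞ (fun y : ℝ × ℝ => c • y) := fun c => contDiff_id.const_smul c
  refine ⟨(hs κ).comp (hσ.1.comp (hs κ⁻¹)), (hs κ).comp (hσ.2.1.comp (hs κ⁻¹)), fun y => ?_⟩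
  have h1 : HasFDerivAt (fun y : ℝ × ℝ => κ • σ (κ⁻¹ • y)) (κ • (fderiv ℝ σ (κ⁻¹ • y)).comp
      (κ⁻¹ • ContinuousLinearMap.id ℝ (ℝ × ℝ))) y :=
    ((hσ.1.differentiable (by simp) _).hasFDerivAt.comp y
      ((hasFDerivAt_id y).const_smul κ⁻¹)).const_smul κ
  have h2 : fderiv ℝ (planeScaling hκ * σ * (planeScaling hκ)⁻¹ : Equiv.Perm (ℝ × ℝ)) y = _ :=
    h1.fderiv
  rw [h2, ContinuousLinearMap.comp_smul, ContinuousLinearMap.comp_id, smul_inv_smul₀ hκ]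
  exact hσ.2.2 _

/-- A reparametrization leaves `t` and the dependent variables fixed, while the action of `h` on the
dependent variables sees nothing else. Conjugation therefore only rescales the data, to `lam · a(κ⁻¹
·)` and `κ σ(κ⁻¹ ·)`, and the Jacobian stays 1. -/
theorem conj_mem_reparamGroup {h n : Equiv.Perm Z} (hh : h ∈ scalingGroup)
    (hn : n ∈ reparamGroup) : h * n * h⁻¹ ∈ reparamGroup := by
  obtain ⟨lam, κ, t₀, -, hκ, h1, h2⟩ := hh
  obtain ⟨a, σ, ha, hσ, rfl⟩ := mem_reparamGroup_iff.1 hn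
  refine mem_reparamGroup_iff.2 ⟨fun y => lam * a (κ⁻¹ • y), _,
    contDiff_const.mul (ha.comp (contDiff_id.const_smul κ⁻¹)), hσ.conj_planeScaling hκ.ne', ?_⟩
  rw [mul_inv_eq_iff_eq_mul]
  refine Equiv.ext fun z => ?_
  simp only [Equiv.Perm.mul_apply, reparamEquiv_apply]
  have e : (κ⁻¹ • ((h z).1 2, (h z).1 3) : ℝ × ℝ) = (z.1 2, z.1 3) := by
    rw [h1]
    simp [hκ.ne']
  refine Prod.ext ?_ (h2 _ _ rfl rfl)
  simp only [reparamMap, Equiv.Perm.mul_apply, h1 z] at e ⊢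
  rw [h1]
  simp only [planeScaling, Equiv.Perm.inv_def, Equiv.symm_mk, Equiv.coe_fn_mk] at e ⊢
  simp only [Matrix.cons_val] at e ⊢
  rw [e]
  funext i
  fin_cases i <;> simp [mul_add]

/-- Fixing the time gives `lam = 1`; points with `ξ¹ = 0` give `a = 0`; and the plane map is a
homothety with `κ² = 1` and `κ > 0`. -/
theorem eq_one_of_mem_reparamGroup_of_mem_scalingGroup {n : Equiv.Perm Z} (hn : n ∈ reparamGroup)
    (hh : n ∈ scalingGroup) : n = 1 := by
  obtain ⟨lam, κ, t₀, -, hκ, h1, -⟩ := hh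
  obtain ⟨a, σ, ha, hσ, rfl⟩ := mem_reparamGroup_iff.1 hn
  have e0 : ∀ t, t = lam * t + t₀ := fun t => by
    simpa [reparamEquiv_apply, reparamMap, ex] using congrFun (h1 (t • ex 0)) 0
  have hl : lam = 1 := by
    have := e0 0
    have := e0 1
    linarith
  have ea : ∀ y, a y = 0 := fun y => by
    simpa [reparamEquiv_apply, reparamMap, ex] using
      congrFun (h1 (y.1 • ex 2 + y.2 • ex 3)) 1
  have eσ : ∀ y, σ y = κ • y := fun y => by
    have e2 := congrFun (h1 (y.1 • ex 2 + y.2 • ex 3)) 2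
    have e3 := congrFun (h1 (y.1 • ex 2 + y.2 • ex 3)) 3
    simp [reparamEquiv_apply, reparamMap, ex] at e2 e3
    exact Prod.ext e2 e3
  have hκ1 : κ = 1 := by
    have e2 : (σ : ℝ × ℝ → ℝ × ℝ) = fun y => κ • y := funext eσ
    have e3 : HasFDerivAt (fun y : ℝ × ℝ => κ • y) (κ • ContinuousLinearMap.id ℝ (ℝ × ℝ)) 0 :=
      (hasFDerivAt_id 0).const_smul κ
    have e4 := hσ.2.2 0
    rw [e2, e3.fderiv, plane_det_eq] at e4
    simp at e4
    nlinarith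
  refine Equiv.ext fun z => ?_
  have : (σ : ℝ × ℝ → ℝ × ℝ) = id := funext fun y => by simp [eσ, hκ1]
  rw [reparamEquiv_apply, this, funext ea]
  exact reparamMap_id z

/-- The transformations that, with their inverses, map solutions to solutions. -/
def solutionGroup : Subgroup (Equiv.Perm Z) where
  carrier := {Φ | MapsSolutionsToSolutions Φ ∧ MapsSolutionsToSolutions Φ⁻¹}
  one_mem' := ⟨mapsSolutionsToSolutions_one, by
    rw [inv_one]
    exact mapsSolutionsToSolutions_one⟩
  mul_mem' := by
    rintro Φ Ψ ⟨h1, h2⟩ ⟨h3, h4⟩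
    refine ⟨h1.mul h3, ?_⟩
    rw [mul_inv_rev]
    exact h4.mul h2
  inv_mem' := by
    rintro Φ ⟨h1, h2⟩
    exact ⟨h2, by rwa [inv_inv]⟩

theorem reparamGroup_le_solutionGroup : reparamGroup ≤ solutionGroup := fun _ h =>
  ⟨mapsSolutionsToSolutions_of_mem_reparamGroup h,
    mapsSolutionsToSolutions_of_mem_reparamGroup (inv_mem h)⟩

theorem galileanGroup_le_solutionGroup : galileanGroup ≤ solutionGroup :=
  galileanGroup_le_of fun _ h h' => ⟨h.mapsSolutionsToSolutions, h'.mapsSolutionsToSolutions⟩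

/-! ### Integration of a symmetry isotopy -/

theorem exists_exp_solution {κ : ℝ → ℝ} (hκ : Continuous κ) : ∃ L : ℝ → ℝ, (∀ s, 0 < L s) ∧
    L 0 = 1 ∧ ∀ s, HasDerivAt L (κ s * L s) s := by
  refine ⟨fun s => Real.exp (∫ r in (0 : ℝ)..s, κ r), fun s => Real.exp_pos _, by simp,
    fun s => ?_⟩
  have h1 := intervalIntegral.integral_hasDerivAt_right (hκ.intervalIntegrable 0 s)
    (hκ.stronglyMeasurableAtFilter _ _) hκ.continuousAt
  refine h1.exp.congr_deriv (mul_comm _ _)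

/-- The device behind the formulas for the flow: the difference of two candidate expressions
satisfies a homogeneous linear equation and starts at zero. -/
theorem linear_ode_eq_zero {κ h : ℝ → ℝ} (hκ : ContDiff ℝ ∞ κ)
    (hd : ∀ s, HasDerivAt h (κ s * h s) s) (h0 : h 0 = 0) (s : ℝ) : h s = 0 := by
  have hv : ContDiff ℝ 1 (fun q : ℝ × ℝ => κ q.1 * q.2) :=
    ((hκ.comp contDiff_fst).mul contDiff_snd).of_le (by simp)
  have h1 := ode_unique hv (f := h) (g := fun _ => 0) hd (fun s => by
    simpa using hasDerivAt_const s (0 : ℝ)) h0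
  exact congrFun h1 s

theorem contDiff_of_eq {E F : Type*} [NormedAddCommGroup E] [NormedSpace ℝ E]
    [NormedAddCommGroup F] [NormedSpace ℝ F] {f g : E → F} (hg : ContDiff ℝ ∞ g)
    (h : ∀ x, f x = g x) : ContDiff ℝ ∞ f := by rwa [funext h]

theorem contDiff_deriv_param {g : ℝ × ℝ → ℝ} (hg : ContDiff ℝ ∞ g) :
    ContDiff ℝ ∞ fun q : ℝ × ℝ => deriv (fun t => g (q.1, t)) q.2 := by
  have e : (fun q : ℝ × ℝ => deriv (fun t => g (q.1, t)) q.2) = fun q => fderiv ℝ g q (0, 1) := by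
    funext q
    have h1 := (hg.differentiable (by simp) q).hasFDerivAt.comp_hasDerivAt q.2
      ((hasDerivAt_const q.2 q.1).prodMk (hasDerivAt_id q.2))
    exact h1.deriv
  rw [e]
  exact (hg.fderiv_right (by simp)).clm_apply contDiff_const

theorem hasDerivAt_deriv_param {g h : ℝ × ℝ → ℝ} (hg : ContDiff ℝ ∞ g)
    (hgh : ∀ s t, HasDerivAt (fun r => g (r, t)) (h (s, t)) s) (s t : ℝ) :
    HasDerivAt (fun r => deriv (fun t => g (r, t)) t) (deriv (fun t => h (s, t)) t) s :=
  hasDerivAt_fderiv_param hg hgh s t 1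

/-- The point with `(ξ², ξ³) = y` and all other coordinates zero. -/
noncomputable def planePoint (y : ℝ × ℝ) : Z := y.1 • ex 2 + y.2 • ex 3

/-- The point with time `t` and all other coordinates zero. -/
noncomputable def timePoint (t : ℝ) : Z := t • ex 0

theorem contDiff_planePoint : ContDiff ℝ ∞ planePoint :=
  (contDiff_fst.smul contDiff_const).add (contDiff_snd.smul contDiff_const)

theorem contDiff_timePoint : ContDiff ℝ ∞ timePoint := contDiff_id.smul contDiff_const

/-- A symmetry isotopy together with the coefficients of its velocity field. -/
structure SymmetryFlow (Φ : ℝ → Equiv.Perm Z) (c s₁ s₂ lam mu : ℝ → ℝ) (M : ℝ → Fin 3 → Fin 3 → ℝ)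
    (α : ℝ → Fin 3 → ℝ → ℝ) (β : ℝ → ℝ → ℝ) (a b d : ℝ → ℝ × ℝ → ℝ) : Prop where
  smooth : ContDiff ℝ ∞ fun q : ℝ × Z => Φ q.1 q.2
  smooth_symm : ∀ s, ContDiff ℝ ∞ (Φ s).symm
  zero : ∀ z, Φ 0 z = z
  smooth_s₁ : ContDiff ℝ ∞ s₁
  smooth_s₂ : ContDiff ℝ ∞ s₂
  smooth_M : ∀ k l, ContDiff ℝ ∞ fun s => M s k l
  smooth_α : ∀ s k, ContDiff ℝ ∞ (α s k)
  smooth_b : ContDiff ℝ ∞ fun q : ℝ × (ℝ × ℝ) => b q.1 q.2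
  smooth_d : ContDiff ℝ ∞ fun q : ℝ × (ℝ × ℝ) => d q.1 q.2
  conformal : ∀ s k l, M s k l + M s l k = if k = l then 2 * (s₁ s + 2 * s₂ s) else 0
  div : ∀ s y, fderiv ℝ (b s) y (1, 0) + fderiv ℝ (d s) y (0, 1) = 0
  deriv_x0 : ∀ s z, HasDerivAt (fun r => (Φ r z).1 0) (c s + s₁ s * (Φ s z).1 0) s
  deriv_x1 : ∀ s z, HasDerivAt (fun r => (Φ r z).1 1)
    (s₁ s * (Φ s z).1 1 + a s ((Φ s z).1 2, (Φ s z).1 3)) s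
  deriv_x2 : ∀ s z, HasDerivAt (fun r => (Φ r z).1 2)
    ((s₁ s + 3 * s₂ s) * (Φ s z).1 2 + b s ((Φ s z).1 2, (Φ s z).1 3)) s
  deriv_x3 : ∀ s z, HasDerivAt (fun r => (Φ r z).1 3)
    ((s₁ s + 3 * s₂ s) * (Φ s z).1 3 + d s ((Φ s z).1 2, (Φ s z).1 3)) s
  deriv_u0 : ∀ s z, HasDerivAt (fun r => (Φ r z).2 0) (4 * s₂ s * (Φ s z).2 0
    - ∑ k : Fin 3, (Φ s z).2 k.succ * iteratedDeriv 2 (α s k) ((Φ s z).1 0)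
    + β s ((Φ s z).1 0)) s
  deriv_uγ : ∀ s z (k : Fin 3), HasDerivAt (fun r => (Φ r z).2 k.succ)
    (∑ l : Fin 3, M s k l * (Φ s z).2 l.succ + α s k ((Φ s z).1 0)) s
  lam_pos : ∀ s, 0 < lam s
  lam_zero : lam 0 = 1
  deriv_lam : ∀ s, HasDerivAt lam (s₁ s * lam s) s
  mu_pos : ∀ s, 0 < mu s
  mu_zero : mu 0 = 1
  deriv_mu : ∀ s, HasDerivAt mu (s₂ s * mu s) s

/-- The normal form is obtained for each `s` separately, so smoothness of its coefficients in `s` is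
not automatic. The velocity field is jointly smooth, being `∂ₛΦ ∘ Φₛ⁻¹`, and the required
coefficients are recovered from its values at special points. The functions `lam` and `mu` are the
exponentials of the integrals of `s₁` and `s₂`. -/
theorem IsSymmetryIsotopy.exists_symmetryFlow {Φ : ℝ → Equiv.Perm Z} (h : IsSymmetryIsotopy Φ) :
    ∃ c s₁ s₂ lam mu M α β a b d, SymmetryFlow Φ c s₁ s₂ lam mu M α β a b d := by
  obtain ⟨hs, hs', h0, X, hX, hd⟩ := h
  have hN := fun s => exists_normalForm isOpen_univ convex_univ (hX s)
  choose c s₁ s₂ M α β a b d hN using hN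
  have eX : ∀ s z, X s z = fderiv ℝ (fun q : ℝ × Z => Φ q.1 q.2) (s, (Φ s).symm z) (1, 0) :=
    fun s z => by
    have h1 := (hs.differentiable (by simp) (s, (Φ s).symm z)).hasFDerivAt.comp_hasDerivAt s
      ((hasDerivAt_id s).prodMk (hasDerivAt_const s ((Φ s).symm z)))
    have h2 := hd s ((Φ s).symm z)
    rw [Equiv.apply_symm_apply] at h2
    exact h2.unique h1
  have sX : ContDiff ℝ ∞ fun q : ℝ × Z => X q.1 q.2 := by
    have h1 := ((hs.fderiv_right (m := ∞) (by simp)).comp (contDiff_fst.prodMk hs')).clm_apply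
      (contDiff_const (c := ((1, 0) : ℝ × Z)))
    refine contDiff_of_eq h1 fun q => ?_
    rw [eX]
    rfl
  have sX1 : ∀ {E : Type} [NormedAddCommGroup E] [NormedSpace ℝ E] {f : E → ℝ} {g : E → Z} (μ : Fin 4),
      ContDiff ℝ ∞ f → ContDiff ℝ ∞ g → ContDiff ℝ ∞ fun e => (X (f e) (g e)).1 μ :=
    fun μ hf hg => (cx μ).contDiff.comp (sX.comp (hf.prodMk hg))
  have sX2 : ∀ {E : Type} [NormedAddCommGroup E] [NormedSpace ℝ E] {f : E → ℝ} {g : E → Z} (μ : Fin 4),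
      ContDiff ℝ ∞ f → ContDiff ℝ ∞ g → ContDiff ℝ ∞ fun e => (X (f e) (g e)).2 μ :=
    fun μ hf hg => (cu μ).contDiff.comp (sX.comp (hf.prodMk hg))
  have u : ∀ z : Z, z ∈ (Set.univ : Set Z) := fun _ => trivial
  have tu : timeProj (Set.univ : Set Z) = Set.univ := by
    refine Set.eq_univ_of_forall fun t => ⟨timePoint t, trivial, ?_⟩
    simp [timePoint, ex]
  have pu : planeProj (Set.univ : Set Z) = Set.univ := by
    refine Set.eq_univ_of_forall fun y => ⟨planePoint y, trivial, ?_⟩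
    simp [planePoint, ex]
  have es₁ : ∀ s, s₁ s = (X s (ex 0)).1 0 - (X s 0).1 0 := fun s => by
    rw [(hN s).x0 _ (u _), (hN s).x0 _ (u _)]
    simp [ex]
  have ss₁ : ContDiff ℝ ∞ s₁ := contDiff_of_eq ((sX1 0 contDiff_id contDiff_const).sub
    (sX1 0 contDiff_id contDiff_const)) es₁
  have es₂ : ∀ s, s₂ s = 1 / 4 * ((X s (eu 0)).2 0 - (X s 0).2 0) := fun s => by
    rw [(hN s).u0 _ (u _), (hN s).u0 _ (u _)]
    simp [eu]
  have ss₂ : ContDiff ℝ ∞ s₂ := contDiff_of_eq (contDiff_const.mul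
    ((sX2 0 contDiff_id contDiff_const).sub (sX2 0 contDiff_id contDiff_const))) es₂
  have eM : ∀ k l s, M s k l = (X s (eu l.succ)).2 k.succ - (X s 0).2 k.succ := fun k l s => by
    rw [(hN s).uγ _ (u _), (hN s).uγ _ (u _)]
    simp [eu, Pi.single_apply]
  have eb : ∀ q : ℝ × (ℝ × ℝ), b q.1 q.2 = (X q.1 (planePoint q.2)).1 2
      - (s₁ q.1 + 3 * s₂ q.1) * q.2.1 := fun q => by
    rw [(hN q.1).x2 _ (u _)]
    simp [planePoint, ex]
  have ed : ∀ q : ℝ × (ℝ × ℝ), d q.1 q.2 = (X q.1 (planePoint q.2)).1 3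
      - (s₁ q.1 + 3 * s₂ q.1) * q.2.2 := fun q => by
    rw [(hN q.1).x3 _ (u _)]
    simp [planePoint, ex]
  have sκ : ContDiff ℝ ∞ fun q : ℝ × (ℝ × ℝ) => s₁ q.1 + 3 * s₂ q.1 :=
    (ss₁.comp contDiff_fst).add (contDiff_const.mul (ss₂.comp contDiff_fst))
  have sp : ContDiff ℝ ∞ fun q : ℝ × (ℝ × ℝ) => planePoint q.2 :=
    contDiff_planePoint.comp contDiff_snd
  obtain ⟨lam, hl, hl0, hld⟩ := exists_exp_solution ss₁.continuous
  obtain ⟨mu, hm, hm0, hmd⟩ := exists_exp_solution ss₂.continuous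
  have hdZ := fun s z => hasDerivAt_Z_iff.1 (hd s z)
  refine ⟨c, s₁, s₂, lam, mu, M, α, β, a, b, d, hs, fun s => ?_, fun z => by simp [h0], ss₁, ss₂,
    fun k l => ?_, fun s k => ?_, ?_, ?_, fun s => (hN s).conformal, fun s y => ?_, ?_, ?_, ?_, ?_,
    ?_, ?_, hl, hl0, hld, hm, hm0, hmd⟩
  · exact hs'.comp (contDiff_const.prodMk contDiff_id)
  · exact contDiff_of_eq ((sX2 k.succ contDiff_id contDiff_const).sub
      (sX2 k.succ contDiff_id contDiff_const)) (eM k l)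
  · have := (hN s).smooth_α k
    rwa [tu, contDiffOn_univ] at this
  · exact contDiff_of_eq ((sX1 2 contDiff_fst sp).sub (sκ.mul contDiff_snd.fst)) eb
  · exact contDiff_of_eq ((sX1 3 contDiff_fst sp).sub (sκ.mul contDiff_snd.snd)) ed
  · exact (hN s).div y (by rw [pu]; trivial)
  · exact fun s z => ((hdZ s z).1 0).congr_deriv ((hN s).x0 _ (u _))
  · exact fun s z => ((hdZ s z).1 1).congr_deriv ((hN s).x1 _ (u _))
  · exact fun s z => ((hdZ s z).1 2).congr_deriv ((hN s).x2 _ (u _))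
  · exact fun s z => ((hdZ s z).1 3).congr_deriv ((hN s).x3 _ (u _))
  · exact fun s z => (hdZ s z).2.1.congr_deriv ((hN s).u0 _ (u _))
  · exact fun s z k => ((hdZ s z).2.2 k).congr_deriv ((hN s).uγ _ (u _) k)

namespace SymmetryFlow

variable {Φ : ℝ → Equiv.Perm Z} {c s₁ s₂ lam mu : ℝ → ℝ} {M : ℝ → Fin 3 → Fin 3 → ℝ}
    {α : ℝ → Fin 3 → ℝ → ℝ} {β : ℝ → ℝ → ℝ} {a b d : ℝ → ℝ × ℝ → ℝ}

theorem time_eq (h : SymmetryFlow Φ c s₁ s₂ lam mu M α β a b d) (s : ℝ) (z : Z) :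
    (Φ s z).1 0 = lam s * z.1 0 + (Φ s 0).1 0 := by
  have h1 := linear_ode_eq_zero (h := fun s => (Φ s z).1 0 - (lam s * z.1 0 + (Φ s 0).1 0))
    h.smooth_s₁ (fun s => (((h.deriv_x0 s z).sub (((h.deriv_lam s).mul_const _).add
      (h.deriv_x0 s 0)))).congr_deriv (by ring)) (by simp [h.zero, h.lam_zero]) s
  linarith

/-- The equations for `(ξ², ξ³)` form a closed system, so the plane coordinates evolve independently
of all others. -/
theorem plane_eq (h : SymmetryFlow Φ c s₁ s₂ lam mu M α β a b d) {z w : Z} (h2 : z.1 2 = w.1 2)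
    (h3 : z.1 3 = w.1 3) (s : ℝ) :
    (((Φ s z).1 2, (Φ s z).1 3) : ℝ × ℝ) = ((Φ s w).1 2, (Φ s w).1 3) := by
  let v : ℝ × (ℝ × ℝ) → ℝ × ℝ := fun q => ((s₁ q.1 + 3 * s₂ q.1) * q.2.1 + b q.1 q.2,
    (s₁ q.1 + 3 * s₂ q.1) * q.2.2 + d q.1 q.2)
  have sκ : ContDiff ℝ ∞ fun q : ℝ × (ℝ × ℝ) => s₁ q.1 + 3 * s₂ q.1 :=
    (h.smooth_s₁.comp contDiff_fst).add (contDiff_const.mul (h.smooth_s₂.comp contDiff_fst))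
  have hv : ContDiff ℝ ∞ v := ((sκ.mul contDiff_snd.fst).add h.smooth_b).prodMk
    ((sκ.mul contDiff_snd.snd).add h.smooth_d)
  have hd : ∀ z s, HasDerivAt (fun s => (((Φ s z).1 2, (Φ s z).1 3) : ℝ × ℝ))
      (v (s, ((Φ s z).1 2, (Φ s z).1 3))) s := fun z s =>
    (h.deriv_x2 s z).prodMk (h.deriv_x3 s z)
  exact congrFun (ode_unique (hv.of_le (by simp)) (hd z) (hd w) (by simp [h.zero, h2, h3])) s

theorem plane_eq_planePoint (h : SymmetryFlow Φ c s₁ s₂ lam mu M α β a b d) (s : ℝ) (z : Z) :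
    (((Φ s z).1 2, (Φ s z).1 3) : ℝ × ℝ)
      = ((Φ s (planePoint (z.1 2, z.1 3))).1 2, (Φ s (planePoint (z.1 2, z.1 3))).1 3) :=
  h.plane_eq (by simp [planePoint, ex]) (by simp [planePoint, ex]) s

/-- Two points with the same plane coordinates keep them in common, so the inhomogeneous term `a`
cancels in the difference of their `ξ¹`-coordinates. -/
theorem label_eq (h : SymmetryFlow Φ c s₁ s₂ lam mu M α β a b d) (s : ℝ) (z : Z) :
    (Φ s z).1 1 = lam s * z.1 1 + (Φ s (planePoint (z.1 2, z.1 3))).1 1 := by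
  set w := planePoint (z.1 2, z.1 3) with hw
  have h1 := linear_ode_eq_zero (h := fun s => (Φ s z).1 1 - (lam s * z.1 1 + (Φ s w).1 1))
    h.smooth_s₁ (fun s => ((h.deriv_x1 s z).sub (((h.deriv_lam s).mul_const _).add
      (h.deriv_x1 s w))).congr_deriv (by rw [h.plane_eq_planePoint s z, ← hw]; ring))
    (by simp [h.zero, h.lam_zero, hw, planePoint, ex]) s
  linarith

/-- The linear part of the flow in the variables `γ`. -/
def linPart (Φ : ℝ → Equiv.Perm Z) (s : ℝ) (k l : Fin 3) : ℝ :=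
  (Φ s (eu l.succ)).2 k.succ - (Φ s 0).2 k.succ

theorem deriv_linPart (h : SymmetryFlow Φ c s₁ s₂ lam mu M α β a b d) (s : ℝ) (k l : Fin 3) :
    HasDerivAt (fun r => linPart Φ r k l) (∑ j, M s k j * linPart Φ s j l) s := by
  refine ((h.deriv_uγ s (eu l.succ) k).sub (h.deriv_uγ s 0 k)).congr_deriv ?_
  have e : (Φ s (eu l.succ)).1 0 = (Φ s 0).1 0 := by
    rw [h.time_eq]
    simp [eu]
  simp only [e, linPart, Fin.sum_univ_three]
  ring

theorem linPart_zero (h : SymmetryFlow Φ c s₁ s₂ lam mu M α β a b d) (k l : Fin 3) :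
    linPart Φ 0 k l = if k = l then 1 else 0 := by
  simp [linPart, h.zero, eu, Pi.single_apply]

/-- Points with equal time keep equal times, so the terms in `α` cancel and the difference solves
the linear system with matrix `M`, whose fundamental solution is `linPart`. -/
theorem gamma_eq (h : SymmetryFlow Φ c s₁ s₂ lam mu M α β a b d) (s : ℝ) (z : Z) (k : Fin 3) :
    (Φ s z).2 k.succ
      = ∑ l, linPart Φ s k l * z.2 l.succ + (Φ s (timePoint (z.1 0))).2 k.succ := by
  set w := timePoint (z.1 0) with hw
  have hv : ContDiff ℝ 1 fun q : ℝ × (Fin 3 → ℝ) => fun k => ∑ l, M q.1 k l * q.2 l := by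
    rw [contDiff_pi]
    refine fun k => ContDiff.of_le (n := ∞) (ContDiff.sum fun l _ => ?_) (by simp)
    exact ((h.smooth_M k l).comp contDiff_fst).mul (by fun_prop)
  have e : ∀ s, (Φ s w).1 0 = (Φ s z).1 0 := fun s => by
    rw [h.time_eq s w, h.time_eq s z, hw]
    simp [timePoint, ex]
  have h1 := ode_unique hv (f := fun s k => (Φ s z).2 (Fin.succ k)
      - (∑ l, linPart Φ s k l * z.2 l.succ + (Φ s w).2 k.succ)) (g := fun _ => 0)
    (fun s => by
      rw [hasDerivAt_pi]
      intro k
      refine ((h.deriv_uγ s z k).sub ((HasDerivAt.fun_sum (u := Finset.univ) fun l _ =>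
        (h.deriv_linPart s k l).mul_const (z.2 l.succ)).add (h.deriv_uγ s w k))).congr_deriv ?_
      simp only [e, Fin.sum_univ_three]
      ring)
    (fun s => (hasDerivAt_const s (0 : Fin 3 → ℝ)).congr_deriv (by
      funext k
      simp))
    (by
      funext k
      simp [h.zero, h.linPart_zero, hw, timePoint, ex])
  have h2 := congrFun (congrFun h1 s) k
  simp only [Pi.zero_apply] at h2
  linarith

/-- For `L = linPart` one has `(LᵀL)' = Lᵀ(M + Mᵀ)L = 2 (s₁ + 2 s₂) LᵀL`, the equation that `(lam ·
mu²)²` satisfies too. -/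
theorem linPart_conformal (h : SymmetryFlow Φ c s₁ s₂ lam mu M α β a b d) (s : ℝ) (l m : Fin 3) :
    ∑ k, linPart Φ s k l * linPart Φ s k m = if l = m then (lam s * mu s ^ 2) ^ 2 else 0 := by
  have hκ : ContDiff ℝ ∞ fun s => 2 * (s₁ s + 2 * s₂ s) :=
    contDiff_const.mul (h.smooth_s₁.add (contDiff_const.mul h.smooth_s₂))
  have hρ : ∀ s, HasDerivAt (fun s => (lam s * mu s ^ 2) ^ 2)
      (2 * (s₁ s + 2 * s₂ s) * (lam s * mu s ^ 2) ^ 2) s := fun s =>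
    (((h.deriv_lam s).mul ((h.deriv_mu s).fun_pow 2)).fun_pow 2).congr_deriv (by
      simp
      ring)
  have hρ' : ∀ s, HasDerivAt (fun s => if l = m then (lam s * mu s ^ 2) ^ 2 else 0)
      (2 * (s₁ s + 2 * s₂ s) * if l = m then (lam s * mu s ^ 2) ^ 2 else 0) s := fun s => by
    by_cases hlm : l = m
    · simpa only [hlm, if_true] using hρ s
    · simpa only [hlm, if_false, mul_zero] using hasDerivAt_const s (0 : ℝ)
  have h1 := linear_ode_eq_zero (h := fun s => ∑ k, linPart Φ s k l * linPart Φ s k m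
      - if l = m then (lam s * mu s ^ 2) ^ 2 else 0) hκ
    (fun s => ((HasDerivAt.fun_sum (u := Finset.univ) fun k _ => (h.deriv_linPart s k l).mul
      (h.deriv_linPart s k m)).sub (hρ' s)).congr_deriv (by
        have c00 := h.conformal s 0 0
        have c11 := h.conformal s 1 1
        have c22 := h.conformal s 2 2
        have c01 := h.conformal s 0 1
        have c02 := h.conformal s 0 2
        have c12 := h.conformal s 1 2
        simp only [Fin.sum_univ_three] at *
        simp at c00 c11 c22 c01 c02 c12
        linear_combination linPart Φ s 0 l * linPart Φ s 0 m * c00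
          + linPart Φ s 1 l * linPart Φ s 1 m * c11 + linPart Φ s 2 l * linPart Φ s 2 m * c22
          + (linPart Φ s 0 l * linPart Φ s 1 m + linPart Φ s 1 l * linPart Φ s 0 m) * c01
          + (linPart Φ s 0 l * linPart Φ s 2 m + linPart Φ s 2 l * linPart Φ s 0 m) * c02
          + (linPart Φ s 1 l * linPart Φ s 2 m + linPart Φ s 2 l * linPart Φ s 1 m) * c12))
    (by simp [h.linPart_zero, h.lam_zero, h.mu_zero, eq_comm]) s
  linarith

/-- The orthogonal part of the flow in the variables `γ`. -/
noncomputable def rotPart (Φ : ℝ → Equiv.Perm Z) (lam mu : ℝ → ℝ) (s : ℝ) :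
    Matrix (Fin 3) (Fin 3) ℝ := fun k l => (lam s * mu s ^ 2)⁻¹ * linPart Φ s k l

theorem ratio_pos (h : SymmetryFlow Φ c s₁ s₂ lam mu M α β a b d) (s : ℝ) :
    0 < lam s * mu s ^ 2 := mul_pos (h.lam_pos s) (pow_pos (h.mu_pos s) 2)

theorem rotPart_transpose_mul (h : SymmetryFlow Φ c s₁ s₂ lam mu M α β a b d) (s : ℝ) :
    (rotPart Φ lam mu s)ᵀ * rotPart Φ lam mu s = 1 := by
  have h0 := (h.ratio_pos s).ne'
  ext l m
  have h1 := h.linPart_conformal s l m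
  simp only [Matrix.mul_apply, Matrix.transpose_apply, rotPart, Matrix.one_apply]
  have e : ∑ k, (lam s * mu s ^ 2)⁻¹ * linPart Φ s k l * ((lam s * mu s ^ 2)⁻¹ * linPart Φ s k m)
      = (lam s * mu s ^ 2)⁻¹ ^ 2 * ∑ k, linPart Φ s k l * linPart Φ s k m := by
    rw [Finset.mul_sum]
    exact Finset.sum_congr rfl fun k _ => by ring
  rw [e, h1]
  split_ifs
  · rw [inv_pow, inv_mul_cancel₀ (pow_ne_zero 2 h0)]
  · simp

/-- The determinant is `±1`, continuous in `s`, and 1 at `s = 0`; passing to `-1` would require the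
value 0 in between. -/
theorem rotPart_det (h : SymmetryFlow Φ c s₁ s₂ lam mu M α β a b d) (s : ℝ) :
    (rotPart Φ lam mu s).det = 1 := by
  have hsq : ∀ s, (rotPart Φ lam mu s).det ^ 2 = 1 := fun s => by
    have h1 := congrArg Matrix.det (h.rotPart_transpose_mul s)
    rw [Matrix.det_mul, Matrix.det_transpose, Matrix.det_one] at h1
    rw [sq, h1]
  have h0 : (rotPart Φ lam mu 0).det = 1 := by
    simp [rotPart, h.linPart_zero, h.lam_zero, h.mu_zero, Matrix.det_fin_three]
  have hc : Continuous fun s => (rotPart Φ lam mu s).det := by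
    have c1 : Continuous lam := continuous_iff_continuousAt.2 fun s => (h.deriv_lam s).continuousAt
    have c2 : Continuous mu := continuous_iff_continuousAt.2 fun s => (h.deriv_mu s).continuousAt
    refine Continuous.matrix_det (continuous_matrix fun k l => ?_)
    have c3 : Continuous fun s => linPart Φ s k l :=
      continuous_iff_continuousAt.2 fun s => (h.deriv_linPart s k l).continuousAt
    exact ((c1.mul (c2.pow 2)).inv₀ fun s => (h.ratio_pos s).ne').mul c3
  rcases sq_eq_one_iff.1 (hsq s) with h1 | h1
  · exact h1
  · obtain ⟨r, -, hr⟩ := intermediate_value_uIcc (a := 0) (b := s) hc.continuousOn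
      (show (0 : ℝ) ∈ _ by rw [h0, h1]; constructor <;> norm_num)
    have := hsq r
    simp only [hr] at this
    norm_num at this

end SymmetryFlow

theorem hasDerivAt_comp_affine {f : ℝ → ℝ} (hf : ContDiff ℝ ∞ f) (l τ t : ℝ) :
    HasDerivAt (fun t => f (l * t + τ)) (l * deriv f (l * t + τ)) t := by
  have h1 : HasDerivAt (fun t : ℝ => l * t + τ) l t := by
    simpa using ((hasDerivAt_id t).const_mul l).add_const τ
  exact ((hf.differentiable (by simp) _).hasDerivAt.comp t h1).congr_deriv (mul_comm _ _)

theorem iteratedDeriv_two_comp_affine {f : ℝ → ℝ} (hf : ContDiff ℝ ∞ f) (l τ t : ℝ) :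
    iteratedDeriv 2 (fun t => f (l * t + τ)) t = l ^ 2 * iteratedDeriv 2 f (l * t + τ) := by
  have h1 := hasDerivAt_comp_affine (by simpa using contDiff_iteratedDeriv hf 1) l τ t (f := deriv f)
  refine iteratedDeriv_two_eq isOpen_univ (Set.mem_univ t)
    (fun t _ => hasDerivAt_comp_affine hf l τ t) ((h1.const_mul l).congr_deriv ?_)
  rw [iteratedDeriv_succ, iteratedDeriv_one]
  ring

/-- The displacement of the `γ`-variables at the points of the time axis. -/
noncomputable def shiftPart (Φ : ℝ → Equiv.Perm Z) (k : Fin 3) (q : ℝ × ℝ) : ℝ :=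
  (Φ q.1 (timePoint q.2)).2 k.succ

/-- The derivative of `shiftPart` with respect to time. -/
noncomputable def shiftPart₁ (Φ : ℝ → Equiv.Perm Z) (k : Fin 3) (q : ℝ × ℝ) : ℝ :=
  deriv (fun t => shiftPart Φ k (q.1, t)) q.2

/-- The second derivative of `shiftPart` with respect to time. -/
noncomputable def shiftPart₂ (Φ : ℝ → Equiv.Perm Z) (k : Fin 3) (q : ℝ × ℝ) : ℝ :=
  deriv (fun t => shiftPart₁ Φ k (q.1, t)) q.2

namespace SymmetryFlow

variable {Φ : ℝ → Equiv.Perm Z} {c s₁ s₂ lam mu : ℝ → ℝ} {M : ℝ → Fin 3 → Fin 3 → ℝ}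
    {α : ℝ → Fin 3 → ℝ → ℝ} {β : ℝ → ℝ → ℝ} {a b d : ℝ → ℝ × ℝ → ℝ}

theorem contDiff_shiftPart (h : SymmetryFlow Φ c s₁ s₂ lam mu M α β a b d) (k : Fin 3) :
    ContDiff ℝ ∞ (shiftPart Φ k) :=
  (cu k.succ).contDiff.comp (h.smooth.comp
    (contDiff_fst.prodMk (contDiff_timePoint.comp contDiff_snd)))

theorem contDiff_shiftPart₁ (h : SymmetryFlow Φ c s₁ s₂ lam mu M α β a b d) (k : Fin 3) :
    ContDiff ℝ ∞ (shiftPart₁ Φ k) := contDiff_deriv_param (h.contDiff_shiftPart k)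

theorem hasDerivAt_section {g : ℝ × ℝ → ℝ} (hg : ContDiff ℝ ∞ g) (s t : ℝ) :
    HasDerivAt (fun t => g (s, t)) (deriv (fun t => g (s, t)) t) t :=
  ((hg.comp (contDiff_const.prodMk contDiff_id)).differentiable (by simp) t).hasDerivAt

theorem time_timePoint (h : SymmetryFlow Φ c s₁ s₂ lam mu M α β a b d) (s t : ℝ) :
    (Φ s (timePoint t)).1 0 = lam s * t + (Φ s 0).1 0 := by
  rw [h.time_eq]
  simp [timePoint, ex]

theorem deriv_shiftPart (h : SymmetryFlow Φ c s₁ s₂ lam mu M α β a b d) (k : Fin 3) (s t : ℝ) :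
    HasDerivAt (fun r => shiftPart Φ k (r, t)) (∑ j, M s k j * shiftPart Φ j (s, t)
      + α s k (lam s * t + (Φ s 0).1 0)) s := by
  rw [← h.time_timePoint]
  exact h.deriv_uγ s (timePoint t) k

theorem deriv_shiftPart₁ (h : SymmetryFlow Φ c s₁ s₂ lam mu M α β a b d) (k : Fin 3) (s t : ℝ) :
    HasDerivAt (fun r => shiftPart₁ Φ k (r, t)) (∑ j, M s k j * shiftPart₁ Φ j (s, t)
      + lam s * deriv (α s k) (lam s * t + (Φ s 0).1 0)) s := by
  have h1 := hasDerivAt_deriv_param (h.contDiff_shiftPart k)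
    (h := fun q => ∑ j, M q.1 k j * shiftPart Φ j q + α q.1 k (lam q.1 * q.2 + (Φ q.1 0).1 0))
    (h.deriv_shiftPart k) s t
  refine h1.congr_deriv (HasDerivAt.deriv ?_)
  dsimp only
  exact (HasDerivAt.fun_sum (u := Finset.univ) fun j _ =>
    (hasDerivAt_section (h.contDiff_shiftPart j) s t).const_mul (M s k j)).add
    (hasDerivAt_comp_affine (h.smooth_α s k) (lam s) _ t)

theorem deriv_shiftPart₂ (h : SymmetryFlow Φ c s₁ s₂ lam mu M α β a b d) (k : Fin 3) (s t : ℝ) :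
    HasDerivAt (fun r => shiftPart₂ Φ k (r, t)) (∑ j, M s k j * shiftPart₂ Φ j (s, t)
      + lam s ^ 2 * iteratedDeriv 2 (α s k) (lam s * t + (Φ s 0).1 0)) s := by
  have h1 := hasDerivAt_deriv_param (h.contDiff_shiftPart₁ k)
    (h := fun q => ∑ j, M q.1 k j * shiftPart₁ Φ j q
      + lam q.1 * deriv (α q.1 k) (lam q.1 * q.2 + (Φ q.1 0).1 0))
    (h.deriv_shiftPart₁ k) s t
  refine h1.congr_deriv (HasDerivAt.deriv ?_)
  dsimp only
  refine ((HasDerivAt.fun_sum (u := Finset.univ) fun j _ =>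
    (hasDerivAt_section (h.contDiff_shiftPart₁ j) s t).const_mul (M s k j)).add
    ((hasDerivAt_comp_affine (f := deriv (α s k))
      (by simpa using contDiff_iteratedDeriv (h.smooth_α s k) 1) (lam s) _ t).const_mul
      (lam s))).congr_deriv ?_
  rw [iteratedDeriv_succ, iteratedDeriv_one, sq, mul_assoc]
  rfl

/-- Both sides grow at the rate `4 s₂`. In the coupling term, `M + Mᵀ` yields `2 (s₁ + 2 s₂)` and
the factor `lam⁻²` yields `-2 s₁`, with sum `4 s₂`; the inhomogeneous terms in `α''` agree because
`shiftPart₂` is driven by `lam² α''`. -/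
theorem pressure_eq (h : SymmetryFlow Φ c s₁ s₂ lam mu M α β a b d) (s : ℝ) (z : Z) :
    (Φ s z).2 0 = mu s ^ 4 * z.2 0 - ∑ k, (∑ l, linPart Φ s k l * z.2 l.succ)
        * ((lam s)⁻¹ ^ 2 * shiftPart₂ Φ k (s, z.1 0)) + (Φ s (timePoint (z.1 0))).2 0 := by
  have hκ : ContDiff ℝ ∞ fun s => 4 * s₂ s := contDiff_const.mul h.smooth_s₂
  have e : ∀ s, (Φ s z).1 0 = lam s * z.1 0 + (Φ s 0).1 0 := fun s => h.time_eq s z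
  obtain ⟨w, hwdef⟩ : ∃ w : ℝ → Fin 3 → ℝ, ∀ s k, ∑ l, linPart Φ s k l * z.2 (Fin.succ l) = w s k :=
    ⟨_, fun _ _ => rfl⟩
  have hg := fun s => h.gamma_eq s z
  simp only [hwdef] at hg ⊢
  have hli : ∀ s, HasDerivAt (fun s => (lam s)⁻¹) (-s₁ s * (lam s)⁻¹) s := fun s => by
    have h0 := (h.lam_pos s).ne'
    refine ((h.deriv_lam s).fun_inv h0).congr_deriv ?_
    field_simp
  have hw : ∀ s (k : Fin 3), HasDerivAt (fun s => w s k) (∑ j, M s k j * w s j) s := fun s k => by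
    simp only [← hwdef]
    refine (HasDerivAt.fun_sum (u := Finset.univ) fun l _ =>
      (h.deriv_linPart s k l).mul_const (z.2 (Fin.succ l))).congr_deriv ?_
    simp only [Fin.sum_univ_three]
    ring
  have hS0 : ∀ k t, shiftPart₂ Φ k (0, t) = 0 := fun k t => by
    have : ∀ t, shiftPart Φ k (0, t) = 0 := fun t => by simp [shiftPart, h.zero, timePoint, ex]
    simp [shiftPart₂, shiftPart₁, this]
  have h1 := linear_ode_eq_zero (h := fun s => (Φ s z).2 0 - (mu s ^ 4 * z.2 0
      - ∑ k, w s k * ((lam s)⁻¹ ^ 2 * shiftPart₂ Φ k (s, z.1 0))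
      + (Φ s (timePoint (z.1 0))).2 0)) hκ
    (fun s => by
      refine ((h.deriv_u0 s z).sub (((((h.deriv_mu s).fun_pow 4).mul_const (z.2 0)).sub
        (HasDerivAt.fun_sum (u := Finset.univ) fun k _ => (hw s k).mul
          (((hli s).fun_pow 2).mul (h.deriv_shiftPart₂ k s (z.1 0))))).add
        (h.deriv_u0 s (timePoint (z.1 0))))).congr_deriv ?_
      have c00 := h.conformal s 0 0
      have c11 := h.conformal s 1 1
      have c22 := h.conformal s 2 2
      have c01 := h.conformal s 0 1
      have c02 := h.conformal s 0 2
      have c12 := h.conformal s 1 2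
      have hl : (lam s)⁻¹ ^ 2 * lam s ^ 2 = 1 := by
        rw [← mul_pow, inv_mul_cancel₀ (h.lam_pos s).ne', one_pow]
      simp only [e, h.time_timePoint, hg]
      simp at c00 c11 c22 c01 c02 c12
      simp only [Fin.sum_univ_three, Pi.mul_apply]
      push_cast
      linear_combination (lam s)⁻¹ ^ 2 * (w s 0 * shiftPart₂ Φ 0 (s, z.1 0) * c00
        + w s 1 * shiftPart₂ Φ 1 (s, z.1 0) * c11 + w s 2 * shiftPart₂ Φ 2 (s, z.1 0) * c22
        + (w s 0 * shiftPart₂ Φ 1 (s, z.1 0) + w s 1 * shiftPart₂ Φ 0 (s, z.1 0)) * c01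
        + (w s 0 * shiftPart₂ Φ 2 (s, z.1 0) + w s 2 * shiftPart₂ Φ 0 (s, z.1 0)) * c02
        + (w s 1 * shiftPart₂ Φ 2 (s, z.1 0) + w s 2 * shiftPart₂ Φ 1 (s, z.1 0)) * c12)
        + (w s 0 * iteratedDeriv 2 (α s 0) (lam s * z.1 0 + (Φ s 0).1 0)
        + w s 1 * iteratedDeriv 2 (α s 1) (lam s * z.1 0 + (Φ s 0).1 0)
        + w s 2 * iteratedDeriv 2 (α s 2) (lam s * z.1 0 + (Φ s 0).1 0)) * hl)
    (by simp [h.zero, h.mu_zero, hS0, timePoint, ex]) s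
  linarith

/-- Liouville's formula with the constant divergence `2 (s₁ + 3 s₂)`, which is the logarithmic
derivative of `(lam · mu³)²`. -/
theorem det_plane (h : SymmetryFlow Φ c s₁ s₂ lam mu M α β a b d) (s : ℝ) (y : ℝ × ℝ) :
    (fderiv ℝ (fun y => (((Φ s (planePoint y)).1 2, (Φ s (planePoint y)).1 3) : ℝ × ℝ)) y).det
      = (lam s * mu s ^ 3) ^ 2 := by
  let S : ℝ × (ℝ × ℝ) → ℝ × ℝ := fun q =>
    ((Φ q.1 (planePoint q.2)).1 2, (Φ q.1 (planePoint q.2)).1 3)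
  let V : ℝ → ℝ × ℝ → ℝ × ℝ := fun s y =>
    ((s₁ s + 3 * s₂ s) * y.1 + b s y, (s₁ s + 3 * s₂ s) * y.2 + d s y)
  have hS : ContDiff ℝ ∞ S := projY.contDiff.comp (h.smooth.comp
    (contDiff_fst.prodMk (contDiff_planePoint.comp contDiff_snd)))
  have hb : ∀ s y, HasFDerivAt (b s) (fderiv ℝ (b s) y) y := fun s y =>
    ((h.smooth_b.comp (contDiff_const.prodMk contDiff_id)).differentiable (by simp) y).hasFDerivAt
  have hd : ∀ s y, HasFDerivAt (d s) (fderiv ℝ (d s) y) y := fun s y =>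
    ((h.smooth_d.comp (contDiff_const.prodMk contDiff_id)).differentiable (by simp) y).hasFDerivAt
  have hV : ∀ s y, HasFDerivAt (V s)
      (((s₁ s + 3 * s₂ s) • ContinuousLinearMap.fst ℝ ℝ ℝ + fderiv ℝ (b s) y).prod
        ((s₁ s + 3 * s₂ s) • ContinuousLinearMap.snd ℝ ℝ ℝ + fderiv ℝ (d s) y)) y := fun s y =>
    ((hasFDerivAt_fst.const_mul _).add (hb s y)).prodMk
      ((hasFDerivAt_snd.const_mul _).add (hd s y))
  have htr : ∀ s y, planeTrace (fderiv ℝ (V s) y) = 2 * (s₁ s + 3 * s₂ s) := fun s y => by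
    rw [(hV s y).fderiv, planeTrace_apply]
    have := h.div s y
    simp
    linarith
  have hκ : ContDiff ℝ ∞ fun s => 2 * (s₁ s + 3 * s₂ s) :=
    contDiff_const.mul (h.smooth_s₁.add (contDiff_const.mul h.smooth_s₂))
  have hdet := hasDerivAt_det_fderiv hS (V := V) (fun s y => (hV s y).differentiableAt)
    (fun s x => (h.deriv_x2 s (planePoint x)).prodMk (h.deriv_x3 s (planePoint x)))
  have h1 := linear_ode_eq_zero (h := fun s => (fderiv ℝ (fun y => S (s, y)) y).det
      - (lam s * mu s ^ 3) ^ 2) hκ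
    (fun s => ((hdet s y).sub
      (((h.deriv_lam s).mul ((h.deriv_mu s).fun_pow 3)).fun_pow 2)).congr_deriv (by
        rw [htr]
        simp
        ring))
    (by
      have e : (fun y => S (0, y)) = id := by
        funext y
        simp [S, h.zero, planePoint, ex]
      rw [e, fderiv_id]
      simp [h.lam_zero, h.mu_zero, ContinuousLinearMap.det]) s
  exact sub_eq_zero.1 h1

theorem injective_plane (h : SymmetryFlow Φ c s₁ s₂ lam mu M α β a b d) (s : ℝ) :
    Function.Injective
      fun y => (((Φ s (planePoint y)).1 2, (Φ s (planePoint y)).1 3) : ℝ × ℝ) := by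
  intro y y' hy
  simp only [Prod.mk.injEq] at hy
  have hl := (h.lam_pos s).ne'
  -- Moving along `ξ¹` compensates the difference of the `ξ¹`-images. The remaining coordinates of
  -- the image agree, so injectivity of `Φ s` on `Z` yields injectivity on the plane.
  set w : Z := planePoint y'
    + ((lam s)⁻¹ * ((Φ s (planePoint y)).1 1 - (Φ s (planePoint y')).1 1)) • ex 1 with hw
  have w2 : w.1 2 = y'.1 := by simp [hw, planePoint, ex]
  have w3 : w.1 3 = y'.2 := by simp [hw, planePoint, ex]
  have wy := h.plane_eq_planePoint s w
  rw [w2, w3] at wy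
  simp only [Prod.mk.injEq] at wy
  have e : Φ s (planePoint y) = Φ s w := by
    refine Z_ext ?_ ?_ ?_ ?_ ?_ fun k => ?_
    · rw [h.time_eq s w, h.time_eq]
      simp [hw, planePoint, ex]
    · rw [h.label_eq s w, w2, w3]
      have : w.1 1 = (lam s)⁻¹ * ((Φ s (planePoint y)).1 1 - (Φ s (planePoint y')).1 1) := by
        simp [hw, planePoint, ex]
      rw [this, mul_inv_cancel_left₀ hl]
      ring
    · rw [wy.1, hy.1]
    · rw [wy.2, hy.2]
    · rw [h.pressure_eq s w, h.pressure_eq]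
      simp [hw, planePoint, ex]
    · rw [h.gamma_eq s w, h.gamma_eq]
      simp [hw, planePoint, ex]
  have e1 := (Φ s).injective e
  refine Prod.ext ?_ ?_
  · have := congrArg (fun z : Z => z.1 2) e1
    simpa [w2, planePoint, ex] using this
  · have := congrArg (fun z : Z => z.1 3) e1
    simpa [w3, planePoint, ex] using this

end SymmetryFlow

/-! ### Factorization of the symmetry group -/

/-- Symmetry isotopies consist of products of reparametrizations and Galilean transformations. -/
theorem IsSymmetryIsotopy.exists_eq_mul {Φ : ℝ → Equiv.Perm Z} (hΦ : IsSymmetryIsotopy Φ) (s : ℝ) :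
    ∃ n ∈ reparamGroup, ∃ g ∈ galileanGroup, Φ s = n * g := by
  obtain ⟨c, s₁, s₂, lam, mu, M, α, β, a, b, d, h⟩ := hΦ.exists_symmetryFlow
  have hl := h.lam_pos s
  have hm := h.mu_pos s
  set l := lam s with hl_def
  set m := mu s with hm_def
  set t₀ := (Φ s 0).1 0 with ht₀
  set κ := l * m ^ 3 with hκ
  have hκ0 : κ ≠ 0 := by positivity
  have sΦ : ContDiff ℝ ∞ (Φ s) := h.smooth.comp (contDiff_const.prodMk contDiff_id)
  -- the Galilean factor
  have sA : ∀ k, ContDiff ℝ ∞ fun t => shiftPart Φ k (s, t) := fun k =>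
    (h.contDiff_shiftPart k).comp (contDiff_const.prodMk contDiff_id)
  have aff : ContDiff ℝ ∞ fun t : ℝ => l⁻¹ * t + -(l⁻¹ * t₀) :=
    (contDiff_const.mul contDiff_id).add contDiff_const
  have sB : ContDiff ℝ ∞ fun t => (Φ s (timePoint t)).2 0 :=
    (cu 0).contDiff.comp (sΦ.comp contDiff_timePoint)
  -- The parameters of `galileanMap` are functions of the new time `l t + t₀`, hence the composition
  -- with the inverse affine map.
  obtain ⟨g, hg, eg⟩ := exists_mem_galileanGroup_eq_galileanMap hl hm t₀
    (h.rotPart_transpose_mul s) (h.rotPart_det s)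
    (α := fun k t => shiftPart Φ k (s, l⁻¹ * t + -(l⁻¹ * t₀))) (fun k => (sA k).comp aff)
    (β := fun t => (Φ s (timePoint (l⁻¹ * t + -(l⁻¹ * t₀)))).2 0) (sB.comp aff)
  -- the reparametrization
  let S : ℝ × ℝ → ℝ × ℝ := fun y => ((Φ s (planePoint y)).1 2, (Φ s (planePoint y)).1 3)
  -- A right inverse of `S`, because the plane image of `Φ s` depends on the plane coordinates
  -- alone; injectivity of `S` makes it two-sided.
  let S' : ℝ × ℝ → ℝ × ℝ := fun y =>
    (((Φ s).symm (planePoint y)).1 2, ((Φ s).symm (planePoint y)).1 3)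
  have sS : ContDiff ℝ ∞ S := projY.contDiff.comp (sΦ.comp contDiff_planePoint)
  have sS' : ContDiff ℝ ∞ S' := projY.contDiff.comp ((h.smooth_symm s).comp contDiff_planePoint)
  have hSS' : ∀ y, S (S' y) = y := fun y => by
    have := h.plane_eq_planePoint s ((Φ s).symm (planePoint y))
    rw [Equiv.apply_symm_apply] at this
    refine this.symm.trans ?_
    simp [planePoint, ex]
  have hS'S : ∀ y, S' (S y) = y := fun y => h.injective_plane s (hSS' (S y))
  -- The Galilean factor acts first and dilates the plane by `κ`. Undoing this in `S`, whose
  -- Jacobian is `κ²`, leaves a map of unit Jacobian.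
  let σ : Equiv.Perm (ℝ × ℝ) :=
    { toFun := fun y => S (κ⁻¹ • y)
      invFun := fun y => κ • S' y
      left_inv := fun y => by simp [hS'S, smul_inv_smul₀ hκ0]
      right_inv := fun y => by simp [hSS', inv_smul_smul₀ hκ0] }
  have sκ : ContDiff ℝ ∞ fun y : ℝ × ℝ => κ⁻¹ • y := contDiff_id.const_smul κ⁻¹
  have hσ : IsUnimodular σ := by
    refine ⟨sS.comp sκ, sS'.const_smul κ, fun y => ?_⟩
    have h1 : HasFDerivAt σ ((fderiv ℝ S (κ⁻¹ • y)).comp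
        (κ⁻¹ • ContinuousLinearMap.id ℝ (ℝ × ℝ))) y :=
      (sS.differentiable (by simp) _).hasFDerivAt.comp y ((hasFDerivAt_id y).const_smul κ⁻¹)
    have h2 := h.det_plane s (κ⁻¹ • y)
    change (fderiv ℝ S (κ⁻¹ • y)).det = κ ^ 2 at h2
    rw [plane_det_eq] at h2
    rw [h1.fderiv, plane_det_eq, ContinuousLinearMap.comp_smul, ContinuousLinearMap.comp_id]
    simp only [smul_apply, Prod.smul_fst, Prod.smul_snd, smul_eq_mul]
    have h3 : κ⁻¹ ^ 2 * κ ^ 2 = 1 := by rw [← mul_pow, inv_mul_cancel₀ hκ0, one_pow]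
    linear_combination κ⁻¹ ^ 2 * h2 + h3
  have sf : ContDiff ℝ ∞ fun y : ℝ × ℝ => (Φ s (planePoint (κ⁻¹ • y))).1 1 :=
    (cx 1).contDiff.comp (sΦ.comp (contDiff_planePoint.comp sκ))
  refine ⟨reparamEquiv (fun y => (Φ s (planePoint (κ⁻¹ • y))).1 1) σ,
    mem_reparamGroup_iff.2 ⟨_, σ, sf, hσ, rfl⟩, g, hg, Equiv.ext fun z => ?_⟩
  rw [Equiv.Perm.mul_apply, eg, reparamEquiv_apply]
  have hz : (κ⁻¹ • (κ * z.1 2, κ * z.1 3) : ℝ × ℝ) = (z.1 2, z.1 3) := by simp [hκ0]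
  have ht : l⁻¹ * (l * z.1 0 + t₀) + -(l⁻¹ * t₀) = z.1 0 := by
    field_simp
    ring
  have hrot : ∀ k, l * m ^ 2 * (SymmetryFlow.rotPart Φ lam mu s *ᵥ fun l : Fin 3 => z.2 l.succ) k
      = ∑ j, SymmetryFlow.linPart Φ s k j * z.2 j.succ := fun k => by
    have h0 := (h.ratio_pos s).ne'
    simp only [Matrix.mulVec, dotProduct, SymmetryFlow.rotPart, Finset.mul_sum]
    refine Finset.sum_congr rfl fun j _ => ?_
    rw [hl_def, hm_def, ← mul_assoc, ← mul_assoc, mul_inv_cancel₀ h0, one_mul]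
  have hp := h.plane_eq_planePoint s z
  simp only [Prod.mk.injEq] at hp
  refine Z_ext ?_ ?_ ?_ ?_ ?_ fun k => ?_
  · exact h.time_eq s z
  · simp only [reparamMap, galileanMap, Matrix.cons_val]
    rw [h.label_eq, hz]
  · simp only [reparamMap, galileanMap, Matrix.cons_val]
    change _ = (S (κ⁻¹ • (κ * z.1 2, κ * z.1 3))).1
    rw [hz]
    exact hp.1
  · simp only [reparamMap, galileanMap, Matrix.cons_val]
    change _ = (S (κ⁻¹ • (κ * z.1 2, κ * z.1 3))).2
    rw [hz]
    exact hp.2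
  · simp only [reparamMap, galileanMap, Fin.cons_zero, hrot]
    have e2 : ∀ k, iteratedDeriv 2 (fun t => shiftPart Φ k (s, l⁻¹ * t + -(l⁻¹ * t₀)))
        (l * z.1 0 + t₀) = l⁻¹ ^ 2 * shiftPart₂ Φ k (s, z.1 0) := fun k => by
      rw [iteratedDeriv_two_comp_affine (sA k), ht, iteratedDeriv_succ, iteratedDeriv_one]
      rfl
    simp only [e2, ht]
    exact h.pressure_eq s z
  · simp only [reparamMap, galileanMap, Fin.cons_succ, hrot, ht]
    exact h.gamma_eq s z k

/-- The Galilean group normalizes the reparametrizations, so the products form a group; it contains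
all generators of the symmetry group. -/
theorem exists_eq_mul_of_mem_symmetryGroup {Φ : Equiv.Perm Z} (hΦ : Φ ∈ symmetryGroup) :
    ∃ n ∈ reparamGroup, ∃ g ∈ galileanGroup, Φ = n * g := by
  have hc : ∀ {g n : Equiv.Perm Z}, g ∈ galileanGroup → n ∈ reparamGroup →
      g * n * g⁻¹ ∈ reparamGroup := fun hg hn =>
    conj_mem_reparamGroup (galileanGroup_le_scalingGroup hg) hn
  induction hΦ using Subgroup.closure_induction with
  | mem Φ h =>
    obtain ⟨Φ, hΦ, s, rfl⟩ := h
    exact hΦ.exists_eq_mul s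
  | one => exact ⟨1, one_mem _, 1, one_mem _, (mul_one 1).symm⟩
  | mul Φ Ψ _ _ h1 h2 =>
    obtain ⟨n, hn, g, hg, rfl⟩ := h1
    obtain ⟨n', hn', g', hg', rfl⟩ := h2
    exact ⟨n * (g * n' * g⁻¹), mul_mem hn (hc hg hn'), g * g', mul_mem hg hg', by group⟩
  | inv Φ _ h =>
    obtain ⟨n, hn, g, hg, rfl⟩ := h
    refine ⟨g⁻¹ * n⁻¹ * g, ?_, g⁻¹, inv_mem hg, by group⟩
    simpa using hc (inv_mem hg) (inv_mem hn)

theorem symmetryGroup_le_solutionGroup : symmetryGroup ≤ solutionGroup := by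
  intro Φ hΦ
  obtain ⟨n, hn, g, hg, rfl⟩ := exists_eq_mul_of_mem_symmetryGroup hΦ
  exact mul_mem (reparamGroup_le_solutionGroup hn) (galileanGroup_le_solutionGroup hg)

theorem normal_reparamGroup_subgroupOf :
    (reparamGroup.subgroupOf symmetryGroup).Normal := by
  refine ⟨fun n hn Φ => ?_⟩
  rw [Subgroup.mem_subgroupOf] at hn ⊢
  obtain ⟨m, hm, g, hg, e⟩ := exists_eq_mul_of_mem_symmetryGroup Φ.2
  have h1 := mul_mem (mul_mem hm
    (conj_mem_reparamGroup (galileanGroup_le_scalingGroup hg) hn)) (inv_mem hm)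
  have e2 : ((Φ * n * Φ⁻¹ : symmetryGroup) : Equiv.Perm Z)
      = m * (g * (n : Equiv.Perm Z) * g⁻¹) * m⁻¹ := by
    rw [Subgroup.coe_mul, Subgroup.coe_mul, Subgroup.coe_inv, e]
    group
  rw [e2]
  exact h1

theorem isComplement'_reparamGroup_galileanGroup :
    Subgroup.IsComplement' (reparamGroup.subgroupOf symmetryGroup)
      (galileanGroup.subgroupOf symmetryGroup) := by
  refine Subgroup.isComplement'_of_disjoint_and_mul_eq_univ ?_ ?_
  · rw [Subgroup.disjoint_def]
    intro x hx hx'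
    rw [Subgroup.mem_subgroupOf] at hx hx'
    exact Subtype.ext (eq_one_of_mem_reparamGroup_of_mem_scalingGroup hx
      (galileanGroup_le_scalingGroup hx'))
  · refine Set.eq_univ_of_forall fun Φ => ?_
    obtain ⟨n, hn, g, hg, e⟩ := exists_eq_mul_of_mem_symmetryGroup Φ.2
    refine Set.mem_mul.2 ⟨⟨n, reparamGroup_le_symmetryGroup hn⟩, hn,
      ⟨g, galileanGroup_le_symmetryGroup hg⟩, hg, Subtype.ext e.symm⟩

end NaturalMHD
/-- The Lie point symmetries of the incompressible natural-coordinate MHD system. First part, for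
generators on an arbitrary convex open set: the infinitesimal symmetries are the semidirect sum of
the ideal of infinitesimal reparametrizations and the subalgebra spanned by the Galilean operators.
Second part, for the group: it is the internal semidirect product of the (normal) reparametrization
group and the generalized Galilean group, and it acts on solutions. -/
theorem theorem1 :
    (∀ U : Set NaturalMHD.Z, IsOpen U → Convex ℝ U →
      (∀ X : NaturalMHD.Z → NaturalMHD.Z,
        NaturalMHD.IsInfinitesimalSymmetryOn U X ↔
          ∃ Y W : NaturalMHD.Z → NaturalMHD.Z,
            NaturalMHD.IsReparamFieldOn U Y ∧ NaturalMHD.IsGalileanFieldOn U W ∧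
              Set.EqOn X (Y + W) U) ∧
      (∀ X : NaturalMHD.Z → NaturalMHD.Z,
        NaturalMHD.IsReparamFieldOn U X → NaturalMHD.IsGalileanFieldOn U X → Set.EqOn X 0 U) ∧
      (∀ X Y : NaturalMHD.Z → NaturalMHD.Z,
        NaturalMHD.IsInfinitesimalSymmetryOn U X → NaturalMHD.IsReparamFieldOn U Y →
          NaturalMHD.IsReparamFieldOn U (VectorField.lieBracket ℝ X Y)) ∧
      (∀ X Y : NaturalMHD.Z → NaturalMHD.Z,
        NaturalMHD.IsGalileanFieldOn U X → NaturalMHD.IsGalileanFieldOn U Y →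
          NaturalMHD.IsGalileanFieldOn U (VectorField.lieBracket ℝ X Y))) ∧
    (NaturalMHD.reparamGroup ≤ NaturalMHD.symmetryGroup ∧
      NaturalMHD.galileanGroup ≤ NaturalMHD.symmetryGroup ∧
      (NaturalMHD.reparamGroup.subgroupOf NaturalMHD.symmetryGroup).Normal ∧
      Subgroup.IsComplement'
        (NaturalMHD.reparamGroup.subgroupOf NaturalMHD.symmetryGroup)
        (NaturalMHD.galileanGroup.subgroupOf NaturalMHD.symmetryGroup)) ∧
    (∀ Φ ∈ NaturalMHD.symmetryGroup, NaturalMHD.MapsSolutionsToSolutions Φ) :=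
  ⟨fun _ hU hc => ⟨NaturalMHD.isInfinitesimalSymmetryOn_iff_decomposition hU hc,
      fun _ => NaturalMHD.eqOn_zero_of_reparam_of_galilean hU,
      fun _ _ => NaturalMHD.isReparamFieldOn_lieBracket hU hc,
      fun _ _ => NaturalMHD.isGalileanFieldOn_lieBracket hU⟩,
    ⟨NaturalMHD.reparamGroup_le_symmetryGroup, NaturalMHD.galileanGroup_le_symmetryGroup,
      NaturalMHD.normal_reparamGroup_subgroupOf,
      NaturalMHD.isComplement'_reparamGroup_galileanGroup⟩,
    fun _ hΦ => (NaturalMHD.symmetryGroup_le_solutionGroup hΦ).1⟩
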